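/- **Setting.** Let $2s\in\mathbb{Z}_{\ge 0}$, let $q\in\mathbb{C}^*$ be not a root of unity, $r_0\in\mathbb{C}^*$, and for each label $a\in\{\cdot,*,\diamond\}$ let $\mathsf b^a,\mathsf c^a\in\mathbb{C}$ with $\mathsf b^a\mathsf c^a=r_0^{-2}$ (for $a=\cdot$ the label is omitted). Write $(x;q^2)_n=\prod_{k=0}^{n-1}(1-xq^{2k})$ and $(x_1,\dots,x_j;q^2)_n=\prod_i(x_i;q^2)_n$, $b(x)=x-x^{-1}$, $[X,Y]_t=tXY-t^{-1}YX$, and $$\theta^a_M=\mathsf b^aq^{2M}+\mathsf c^aq^{-2M},\qquad \theta^a_s=\mathsf b^aq^{2s}+\mathsf c^aq^{-2s},$$ $$\omega^{\{a,b,c\}}=-(q-q^{-1})^2\Big(\theta^a_s\theta^b_s-\tfrac1{r_0}(q^{2s+1}+q^{-2s-1})\theta^c_s\Big).$$ Assume (i) $\mathsf b^a/\mathsf c^a\ne q^{-2M}$ for $0\le M\le 4s$ and every label $a$; (ii) for $1\le M\le 2s$: $\mathsf c^*\ne -r_0q^{-2M+1}\mathsf c\,\mathsf c^\diamond$, $\mathsf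 b\ne -r_0q^{-2M+1+4s}\mathsf b^*\mathsf b^\diamond$, $\mathsf c\ne -r_0q^{2M+4s-1}\mathsf b^*\mathsf b^\diamond$, $\mathsf c^*\ne -r_0q^{2M-1}\mathsf b\,\mathsf c^\diamond$. Let $(A,A^*)$ be a Leonard pair on a complex vector space $\mathcal V$ of dimension $2s+1$ with eigenvalue sequences $\theta_M$ and $\theta^*_N$, $0\le M,N\le 2s$ (i.e. in an eigenbasis of $A$ ordered by $M$ the matrix of $A^*$ is irreducible tridiagonal, and in an eigenbasis of $A^*$ ordered by $N$ so is the matrix of $A$), satisfying the Askey-Wilson relations $$[A,[A,A^*]_q]_{q^{-1}}=\rho A^*+\omega A+\eta\,\mathbb I,\qquad [A^*,[A^*,A]_q]_{q^{-1}}=\rho A+\omega A^*+\eta^*\mathbb I$$ with $\rho=-\frac{(q^2-q^{-2})^2}{r_0^2}$, $\omega=\omega^{\{\cdot,*,\diamond\}}$, $\eta=\frac{q+q^{-1}}{r_0}\omega^{\{\cdot,\diamond,*\}}$, $\eta^*=\frac{q+q^{-1}}{r_0}\omega^{\{*,\diamond,\cdot\}}$. Put $$A^\diamond=\frac{r_0}{q^2-q^{-2}}[A^*,A]_q+\frac{r_0\,\omega^{\{\cdot,*,\diamond\}}}{(q-q^{-1})(q^2-q^{-2})}\mathbb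 I .$$ **Eigenbases.** For $(a,b,c)$ a cyclic permutation of $(\cdot,*,\diamond)$ let $$A^{(b,a)}_{M,M-1}=q^{2-4s}\frac{(1-q^{2M})(\mathsf c^a-\mathsf b^aq^{2M+4s})(\mathsf b^b\mathsf b^cr_0q^{4s-1}+\mathsf b^aq^{2M-2})(\mathsf c^a\mathsf c^cr_0q^{-1}+\mathsf c^bq^{2M-2})}{(\mathsf c^a-\mathsf b^aq^{4M-2})(\mathsf c^a-\mathsf b^aq^{4M})},$$ and let $A^{(a,b)}_{M,M-1}$ be obtained from it by $\mathsf b^a\leftrightarrow\mathsf b^b$, $\mathsf c^a\leftrightarrow\mathsf c^b$, $\mathsf b^cq^{4s}\leftrightarrow\mathsf c^c$. Let $|\theta_M\rangle$, $|\theta^*_N\rangle$, $|\theta^\diamond_N\rangle$ ($0\le M,N\le 2s$) be bases of eigenvectors of $A$, $A^*$, $A^\diamond$ for the eigenvalues $\theta_M,\theta^*_N,\theta^\diamond_N$, normalized as follows: the coefficient of $|\theta_{M+1}\rangle$ in $A^*|\theta_M\rangle$ is $A^{(*,\cdot)}_{M+1,M}$, that of $|\theta^*_{N+1}\rangle$ in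 $A|\theta^*_N\rangle$ is $A^{(\cdot,*)}_{N+1,N}$, that of $|\theta^\diamond_{N+1}\rangle$ in $A^*|\theta^\diamond_N\rangle$ is $A^{(*,\diamond)}_{N+1,N}$; the coefficient of $|\theta_0\rangle$ in $|\theta^*_0\rangle$ is $1$. The scalars $f_0,g_0,h_0\in\mathbb C^*$ are such that $g_0$ is the coefficient of $|\theta^*_0\rangle$ in $|\theta^\diamond_0\rangle$ and $h_0/f_0$ is the coefficient of $|\theta^\diamond_0\rangle$ in $|\theta_0\rangle$. Put $$f_M=f_0\prod_{k=0}^{M-1}\frac{\mathsf cq^{-2k-2}+r_0q^{-1}\mathsf c^*\mathsf b^\diamond}{\mathsf bq^{2k}+r_0q^{-1}\mathsf c^*\mathsf b^\diamond},\qquad h_M=h_0\prod_{k=0}^{M-1}q^{4k}\frac{\mathsf b^\diamond}{\mathsf c^\diamond}\,\frac{\mathsf c^\diamond q^{-2k}+r_0q\,\mathsf c^*\mathsf b}{\mathsf b^\diamond q^{2k}+r_0q^{-1}\mathsf c^*\mathsf b}.$$ **$q$-Racah polynomials.** For $(a,b,c)$ a cyclic permutation of $(\cdot,*,\diamond)$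 let $$R^{\{a,c\}}_M(\theta^b_N)={}_4\phi_3\!\left[\begin{matrix}q^{-2M},\ \frac{\mathsf b^a}{\mathsf c^a}q^{2M},\ q^{-2N},\ \frac{\mathsf b^b}{\mathsf c^b}q^{2N}\\ -\frac{\mathsf b^a\mathsf c^c}{\mathsf c^b}r_0q,\ -\frac{\mathsf b^b\mathsf b^c}{\mathsf c^a}r_0q^{4s+1},\ q^{-4s}\end{matrix};q^2,q^2\right],$$ $$k^{\{a,b,c\}}_N=\frac{\big(-\frac{\mathsf b^b\mathsf b^c}{\mathsf c^a}r_0q^{4s+1},-\frac{\mathsf b^a\mathsf c^c}{\mathsf c^b}r_0q,\frac{\mathsf b^b}{\mathsf c^b},q^{-4s};q^2\big)_N}{\big(q^2,-\frac{\mathsf b^b\mathsf b^c}{\mathsf b^a}r_0q,-\frac{\mathsf c^a\mathsf c^c}{\mathsf c^b}r_0q^{1-4s},\frac{\mathsf b^b}{\mathsf c^b}q^{4s+2};q^2\big)_N}\,\frac{1-\frac{\mathsf b^b}{\mathsf c^b}q^{4N}}{\big(\frac{\mathsf b^a}{\mathsf c^a}\big)^N\big(1-\frac{\mathsf b^b}{\mathsf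 c^b}\big)},$$ let $k^{\{b,a,c\}}_M$ be obtained from $k^{\{a,b,c\}}_M$ by $\mathsf b^a\leftrightarrow\mathsf b^b$, $\mathsf c^a\leftrightarrow\mathsf c^b$, $\mathsf b^cq^{4s}\leftrightarrow\mathsf c^c$, and let $$\nu_0^{\{a,b,c\}}=\frac{\big(\frac{\mathsf b^a}{\mathsf c^a}q^2,\frac{\mathsf b^b}{\mathsf c^b}q^2;q^2\big)_{2s}}{\big(-\frac{\mathsf b^b\mathsf b^c}{\mathsf c^a}r_0q^{4s+1}\big)^{2s}\big(-\frac{\mathsf b^a\mathsf c^c}{\mathsf b^b}r_0q^{1-4s},-\frac{\mathsf c^a\mathsf c^c}{\mathsf c^b}r_0q^{1-4s};q^2\big)_{2s}}.$$ Let $P^{\{\diamond,\cdot\}}$ be the matrix with entries $P^{\{\diamond,\cdot\}}_{MN}=k_N^{\{\diamond,\cdot,*\}}R^{\{\diamond,*\}}_M(\theta_N)$, and let $\big((P^{\{\diamond,\cdot\}})^{-1}\big)_{NM}=\big(\nu_0^{\{\diamond,\cdot,*\}}\big)^{-1}k_M^{\{\cdot,\diamond,*\}}R^{\{\diamond,*\}}_M(\theta_N)$,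 where $0\le M,N\le 2s$. **Off-shell Bethe states.** For $\alpha,\chi\in\mathbb C^*$, $\beta\in\mathbb C$, $m\in\mathbb Z$, $u\in\mathbb C^*$ let $$\mathscr B^+(u,m)=\frac{b(u^2)}{\alpha q^{2m+2}-\beta}\Big(\tfrac{\chi q^m}{\rho u}[A^*,A]_q-\tfrac{\beta^2q^{-m}}{u\chi}[A,A^*]_q+\beta\tfrac{q^2+1}{qu}A-\beta\big(\tfrac1{qu^3}+qu\big)A^*+\tfrac{q^{-m-3}}{\rho\chi b(q^2)}\kappa_+\mathbb I\Big),$$ $$\kappa_+=(q^2+1)u^{-1}\big(\omega(\chi^2q^{2m+2}-\beta^2q^2\rho)+\beta(q^4-1)\eta^*\chi q^m\big)-q^2\rho(q^2u+u^{-3})(\beta^2\rho-\chi^2q^{2m}),$$ $$\mathscr B^-(u,m)=\frac{b(u^2)q^{2m+1}}{\alpha q^{-2}-\beta q^{2m}}\Big(\tfrac{u\chi q^{-m-1}}{\rho}[A^*,A]_q-\tfrac{\beta^2uq^{m-1}}{\chi}[A,A^*]_q+\beta\tfrac{q^2u^4+1}{q^2u}A-\beta\tfrac{(q^2+1)u}{q^2}A^*-\tfrac{q^{-m-4}}{\rho\chi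 b(q^2)}\kappa_-\mathbb I\Big),$$ $$\kappa_-=\rho q^2(q^2u^3+u^{-1})(\beta^2\rho q^{2m}-\chi^2)+(q^2+1)u\big(\omega(\beta^2\rho q^{2m+2}-q^2\chi^2)+\beta(q^4-1)\eta\chi q^m\big).$$ For $M''\ge 0$ and $\bar u=(u_1,\dots,u_{M''})\in(\mathbb C^*)^{M''}$ set, with $\beta=0$, $$|\Psi_\mp^{M''}(\bar u,m)\rangle=\mathscr B^\mp(u_1,m+2(M''-1))\cdots\mathscr B^\mp(u_{M''},m)\,|\Omega^\mp\rangle,\qquad |\Omega^-\rangle=|\theta_0\rangle,\ |\Omega^+\rangle=|\theta^*_0\rangle,$$ where $(q^2-q^{-2})\chi^{-1}\alpha\,\mathsf b\,q^{-m}=-1$ in the case $-$ and $(q^2-q^{-2})\chi^{-1}\alpha\,\mathsf c^*q^{m}=1$ in the case $+$. Put $U_i=\frac{qu_i^2+q^{-1}u_i^{-2}}{q+q^{-1}}$ and $$\mathcal G^-_{M''}(\bar u)=\big(-(q+q^{-1})q^{M''+1}\mathsf b\big)^{M''}\prod_ib(u_i^2)u_i,\qquad \mathcal G^+_{M''}(\bar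 u)=\big((q+q^{-1})q^{-M''-1}\mathsf c^*\big)^{M''}\prod_ib(u_i^2)u_i^{-1}.$$ **Theorem.** Normalized eigenbases and scalars $f_0,g_0,h_0$ as above exist, the matrix denoted $(P^{\{\diamond,\cdot\}})^{-1}$ is the inverse of $P^{\{\diamond,\cdot\}}$, and for every choice of such eigenbases and scalars $$f_0h_0^{-1}g_0^{-1}=(-1)^{2s}q^{2s(2s-1)}\frac{(q^2r_0^2\mathsf b^2,\ q^2r_0^2(\mathsf b^\diamond)^2,\ q^2r_0^2(\mathsf b^*)^2;q^2)_{2s}}{\big(-\frac{qr_0\mathsf b\mathsf b^\diamond}{\mathsf b^*},-\frac{qr_0\mathsf b\mathsf b^*}{\mathsf b^\diamond},-\frac{qr_0\mathsf b^\diamond\mathsf b^*}{\mathsf b};q^2\big)_{2s}} .$$ Moreover, for every $0\le M\le 2s$ and every nonzero linear form $\langle\theta_M|$ on $\mathcal V$ with $\langle\theta_M|A=\theta_M\langle\theta_M|$, one has $\langle\theta_M|\theta_M\rangle\ne0$ and, for all $M''\ge0$, $\bar u\in(\mathbb C^*)^{M''}$, $m\in\mathbb Z$ and all $\alpha,\chi$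 as above, $$\frac{\langle\theta_M|\Psi_-^{M''}(\bar u,m)\rangle}{\langle\theta_M|\theta_M\rangle}=\mathcal G^-_{M''}(\bar u)\frac{f_M}{f_0}\sum_{M'=0}^{2s}\big((P^{\{\diamond,\cdot\}})^{-1}\big)_{MM'}\prod_{i=1}^{M''}\Big(U_i-\frac{r_0}{q+q^{-1}}\theta^\diamond_{M'}\Big),$$ $$\frac{\langle\theta_M|\Psi_+^{M''}(\bar u,m)\rangle}{\langle\theta_M|\theta_M\rangle}=\mathcal G^+_{M''}(\bar u)\frac{f_M}{g_0\,\nu_0^{\{*,\diamond,\cdot\}}}\sum_{M'=0}^{2s}\frac1{h_{M'}}\big((P^{\{\diamond,\cdot\}})^{-1}\big)_{MM'}\prod_{i=1}^{M''}\Big(U_i-\frac{r_0}{q+q^{-1}}\theta^\diamond_{M'}\Big).$$ -/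

import Mathlib

namespace LeonardBethe

open Finset

/-! ### Parameters of a Leonard triple of q-Racah type -/

/-- The three labels `.`, `*`, `⋄` of the triple `(A, A*, A⋄)`. -/
inductive Idx : Type
  | pt : Idx
  | st : Idx
  | di : Idx

open Idx

/-- The scalars on which everything depends: `q`, `r₀`, the integer `d = 2s`
(`s` is an integer or a half-integer) and `𝖻ᵃ`, `𝖼ᵃ` for the three labels `a`. -/
structure Params : Type where
  q : ℂ
  r0 : ℂ
  d : ℕ
  b : Idx → ℂ
  c : Idx → ℂ

/-- The `q²`-shifted factorial `(x; q²)_n = ∏_{k<n} (1 - x q^{2k})`. -/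
def poch (q x : ℂ) (n : ℕ) : ℂ := ∏ k ∈ range n, (1 - x * (q ^ 2) ^ k)

/-- `b(x) = x - x⁻¹`. -/
noncomputable def bfun (x : ℂ) : ℂ := x - x⁻¹

/-- The `q`-commutator `[X, Y]_t = t X Y - t⁻¹ Y X`. -/
noncomputable def qComm {R : Type*} [Ring R] [Algebra ℂ R] (t : ℂ) (X Y : R) : R :=
  t • (X * Y) - t⁻¹ • (Y * X)

/-- The string `𝓑(u_1, m + 2(n-1)) 𝓑(u_2, m + 2(n-2)) ⋯ 𝓑(u_n, m)`. -/
def bString {R : Type*} [Ring R] (B : ℂ → ℤ → R) (n : ℕ) (u : Fin n → ℂ) (m : ℤ) : R :=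
  (List.ofFn fun i : Fin n => B (u i) (m + 2 * ((n : ℤ) - 1 - (i : ℤ)))).prod

namespace Params

variable (p : Params)

/-- The eigenvalues `θᵃ_M = 𝖻ᵃ q^{2M} + 𝖼ᵃ q^{-2M}`. -/
noncomputable def theta (a : Idx) (M : ℕ) : ℂ :=
  p.b a * p.q ^ (2 * (M : ℤ)) + p.c a * p.q ^ (-(2 * (M : ℤ)))

/-- `θᵃ_s = 𝖻ᵃ q^{2s} + 𝖼ᵃ q^{-2s}` at the (possibly half-integral) middle point `s`. -/
noncomputable def thetaMid (a : Idx) : ℂ :=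
  p.b a * p.q ^ (p.d : ℤ) + p.c a * p.q ^ (-(p.d : ℤ))

/-- `ω^{a,b,c} = -(q - q⁻¹)² (θᵃ_s θᵇ_s - r₀⁻¹ (q^{2s+1} + q^{-2s-1}) θᶜ_s)`. -/
noncomputable def omega (a b c : Idx) : ℂ :=
  -(p.q - p.q⁻¹) ^ 2 * (p.thetaMid a * p.thetaMid b
    - 1 / p.r0 * (p.q ^ ((p.d : ℤ) + 1) + p.q ^ (-(p.d : ℤ) - 1)) * p.thetaMid c)

/-- The structure constant `ρ` of the Askey-Wilson relations. -/
noncomputable def rho : ℂ := -(p.q ^ 2 - (p.q ^ 2)⁻¹) ^ 2 / p.r0 ^ 2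

/-- The structure constant `ω` of the Askey-Wilson relations. -/
noncomputable def om : ℂ := p.omega pt st di

/-- The structure constant `η` of the Askey-Wilson relations. -/
noncomputable def eta : ℂ := (p.q + p.q⁻¹) / p.r0 * p.omega pt di st

/-- The structure constant `η*` of the Askey-Wilson relations. -/
noncomputable def etaStar : ℂ := (p.q + p.q⁻¹) / p.r0 * p.omega st di pt

/-- Standing assumptions on the parameters: `q` is nonzero and not a root of unity, `r₀` is nonzero,
`r₀⁻² = 𝖻𝖼 = 𝖻*𝖼* = 𝖻⋄𝖼⋄` (so all `𝖻ᵃ, 𝖼ᵃ` are nonzero), and the parameters avoid the values at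
which a spectrum degenerates, tridiagonality becomes reducible, or a denominator in the explicit
formulas vanishes. The four inequalities `ii₁`-`ii₄` are stated for `(a,b,c) = (., *, ⋄)`; up to
`r₀⁻² = 𝖻ᵃ𝖼ᵃ` their conjunction is symmetric in the three labels. -/
structure Admissible : Prop where
  q_ne_zero : p.q ≠ 0
  q_not_root : ∀ n : ℕ, 0 < n → p.q ^ n ≠ 1
  r0_ne_zero : p.r0 ≠ 0
  b_mul_c : ∀ a, p.b a * p.c a = (p.r0 ^ 2)⁻¹
  cond_i : ∀ a, ∀ M : ℕ, M ≤ 2 * p.d → p.b a * (p.c a)⁻¹ ≠ p.q ^ (-(2 * (M : ℤ)))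
  cond_ii₁ : ∀ M : ℕ, 1 ≤ M → M ≤ p.d →
    p.c st ≠ -p.r0 * p.q ^ (-(2 * (M : ℤ)) + 1) * p.c pt * p.c di
  cond_ii₂ : ∀ M : ℕ, 1 ≤ M → M ≤ p.d →
    p.b pt ≠ -p.r0 * p.q ^ (-(2 * (M : ℤ)) + 1 + 2 * (p.d : ℤ)) * p.b st * p.b di
  cond_ii₃ : ∀ M : ℕ, 1 ≤ M → M ≤ p.d →
    p.c pt ≠ -p.r0 * p.q ^ (2 * (M : ℤ) + 2 * (p.d : ℤ) - 1) * p.b st * p.b di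
  cond_ii₄ : ∀ M : ℕ, 1 ≤ M → M ≤ p.d →
    p.c st ≠ -p.r0 * p.q ^ (2 * (M : ℤ) - 1) * p.b pt * p.c di

/-! ### Normalization coefficients of the eigenbases -/

/-- The coefficient `A^{(b,a)}_{M,M-1}` as a function of `𝖻ᵃ, 𝖼ᵃ, 𝖻ᵇ, 𝖼ᵇ, 𝖻ᶜ, 𝖼ᶜ`. -/
noncomputable def lowAux (ba ca bb cb bc cc : ℂ) (M : ℕ) : ℂ :=
  p.q ^ (2 - 2 * (p.d : ℤ)) *
    ((1 - p.q ^ (2 * (M : ℤ))) * (ca - ba * p.q ^ (2 * (M : ℤ) + 2 * (p.d : ℤ))) *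
      (bb * bc * p.r0 * p.q ^ (2 * (p.d : ℤ) - 1) + ba * p.q ^ (2 * (M : ℤ) - 2)) *
      (ca * cc * p.r0 * p.q⁻¹ + cb * p.q ^ (2 * (M : ℤ) - 2))) /
    ((ca - ba * p.q ^ (4 * (M : ℤ) - 2)) * (ca - ba * p.q ^ (4 * (M : ℤ))))

/-- `A^{(b,a)}_{M,M-1}` for `(a,b,c)` a cyclic permutation of `(., *, ⋄)`: the coefficient of
`|θᵃ_M⟩` in `Aᵇ |θᵃ_{M-1}⟩`. -/
noncomputable def lowBA (a b c : Idx) (M : ℕ) : ℂ :=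
  p.lowAux (p.b a) (p.c a) (p.b b) (p.c b) (p.b c) (p.c c) M

/-- `A^{(a,b)}_{M,M-1}` for `(a,b,c)` a cyclic permutation of `(., *, ⋄)`: the coefficient of
`|θᵇ_M⟩` in `Aᵃ |θᵇ_{M-1}⟩`. It is obtained from `A^{(b,a)}_{M,M-1}` by exchanging
`𝖻ᵃ ↔ 𝖻ᵇ`, `𝖼ᵃ ↔ 𝖼ᵇ`, `𝖻ᶜ q^{4s} ↔ 𝖼ᶜ`. -/
noncomputable def lowAB (a b c : Idx) (M : ℕ) : ℂ :=
  p.lowAux (p.b b) (p.c b) (p.b a) (p.c a)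
    (p.c c * p.q ^ (-(2 * (p.d : ℤ)))) (p.b c * p.q ^ (2 * (p.d : ℤ))) M

/-- `f_M = f_0 ∏_{k<M} 𝔣(k)`, for `(a,b,c) = (., *, ⋄)`. -/
noncomputable def fSeq (f0 : ℂ) (M : ℕ) : ℂ :=
  f0 * ∏ k ∈ range M,
    (p.c pt * p.q ^ (-(2 * (k : ℤ)) - 2) + p.r0 * p.q⁻¹ * p.c st * p.b di) /
    (p.b pt * p.q ^ (2 * (k : ℤ)) + p.r0 * p.q⁻¹ * p.c st * p.b di)

/-- `h_M = h_0 ∏_{k<M} 𝔥(k)`, for `(a,b,c) = (., *, ⋄)`. -/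
noncomputable def hSeq (h0 : ℂ) (M : ℕ) : ℂ :=
  h0 * ∏ k ∈ range M,
    p.q ^ (4 * (k : ℤ)) * (p.b di / p.c di) *
    ((p.c di * p.q ^ (-(2 * (k : ℤ))) + p.r0 * p.q * p.c st * p.b pt) /
     (p.b di * p.q ^ (2 * (k : ℤ)) + p.r0 * p.q⁻¹ * p.c st * p.b pt))

/-! ### q-Racah polynomials and transition matrices -/

/-- The q-Racah polynomial `R^{a,c}_M(θᵇ_N)`, i.e. the terminating basic hypergeometric series
`₄φ₃(q^{-2M}, (𝖻ᵃ/𝖼ᵃ) q^{2M}, q^{-2N}, (𝖻ᵇ/𝖼ᵇ) q^{2N};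
  -(𝖻ᵃ𝖼ᶜ/𝖼ᵇ) r₀ q, -(𝖻ᵇ𝖻ᶜ/𝖼ᵃ) r₀ q^{4s+1}, q^{-4s}; q², q²)`;
the terms of index larger than `M` vanish. -/
noncomputable def racahR (a b c : Idx) (M N : ℕ) : ℂ :=
  ∑ n ∈ range (M + 1),
    (poch p.q (p.q ^ (-(2 * (M : ℤ)))) n
      * poch p.q (p.b a / p.c a * p.q ^ (2 * (M : ℤ))) n
      * poch p.q (p.q ^ (-(2 * (N : ℤ)))) n
      * poch p.q (p.b b / p.c b * p.q ^ (2 * (N : ℤ))) n) /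
    (poch p.q (-(p.b a * p.c c / p.c b) * p.r0 * p.q) n
      * poch p.q (-(p.b b * p.b c / p.c a) * p.r0 * p.q ^ (2 * (p.d : ℤ) + 1)) n
      * poch p.q (p.q ^ (-(2 * (p.d : ℤ)))) n
      * poch p.q (p.q ^ 2) n) * (p.q ^ 2) ^ n

/-- `k^{a,b,c}_N` as a function of `𝖻ᵃ, 𝖼ᵃ, 𝖻ᵇ, 𝖼ᵇ, 𝖻ᶜ, 𝖼ᶜ`. -/
noncomputable def kAux (ba ca bb cb bc cc : ℂ) (N : ℕ) : ℂ :=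
  (poch p.q (-(bb * bc / ca) * p.r0 * p.q ^ (2 * (p.d : ℤ) + 1)) N
    * poch p.q (-(ba * cc / cb) * p.r0 * p.q) N
    * poch p.q (bb / cb) N
    * poch p.q (p.q ^ (-(2 * (p.d : ℤ)))) N) /
  (poch p.q (p.q ^ 2) N
    * poch p.q (-(bb * bc / ba) * p.r0 * p.q) N
    * poch p.q (-(ca * cc / cb) * p.r0 * p.q ^ (1 - 2 * (p.d : ℤ))) N
    * poch p.q (bb / cb * p.q ^ (2 * (p.d : ℤ) + 2)) N)
  * ((1 - bb / cb * p.q ^ (4 * (N : ℤ))) / ((ba / ca) ^ N * (1 - bb / cb)))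

/-- `k^{a,b,c}_N`, for `(a,b,c)` a cyclic permutation of `(., *, ⋄)`. -/
noncomputable def kABC (a b c : Idx) (N : ℕ) : ℂ :=
  p.kAux (p.b a) (p.c a) (p.b b) (p.c b) (p.b c) (p.c c) N

/-- `k^{b,a,c}_M`, for `(a,b,c)` a cyclic permutation of `(., *, ⋄)`: obtained from `k^{a,b,c}_M`
by exchanging `𝖻ᵃ ↔ 𝖻ᵇ`, `𝖼ᵃ ↔ 𝖼ᵇ`, `𝖻ᶜ q^{4s} ↔ 𝖼ᶜ`. -/
noncomputable def kBAC (a b c : Idx) (M : ℕ) : ℂ :=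
  p.kAux (p.b b) (p.c b) (p.b a) (p.c a)
    (p.c c * p.q ^ (-(2 * (p.d : ℤ)))) (p.b c * p.q ^ (2 * (p.d : ℤ))) M

/-- `ν₀^{a,b,c}`. -/
noncomputable def nu0 (a b c : Idx) : ℂ :=
  (poch p.q (p.b a / p.c a * p.q ^ 2) p.d * poch p.q (p.b b / p.c b * p.q ^ 2) p.d) /
  ((-(p.b b * p.b c / p.c a) * p.r0 * p.q ^ (2 * (p.d : ℤ) + 1)) ^ p.d
    * (poch p.q (-(p.b a * p.c c / p.b b) * p.r0 * p.q ^ (1 - 2 * (p.d : ℤ))) p.d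
      * poch p.q (-(p.c a * p.c c / p.c b) * p.r0 * p.q ^ (1 - 2 * (p.d : ℤ))) p.d))

/-- The matrix `P^{a,b}`, with entries `P^{a,b}_{MN} = k^{a,b,c}_N R^{a,c}_M(θᵇ_N)`. -/
noncomputable def P (a b c : Idx) : Matrix (Fin (p.d + 1)) (Fin (p.d + 1)) ℂ :=
  Matrix.of fun M N => p.kABC a b c N * p.racahR a b c M N

/-- The explicit matrix `(P^{a,b})⁻¹`, with entries
`((P^{a,b})⁻¹)_{NM} = (ν₀^{a,b,c})⁻¹ k^{b,a,c}_M R^{a,c}_M(θᵇ_N)`. -/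
noncomputable def Pinv (a b c : Idx) : Matrix (Fin (p.d + 1)) (Fin (p.d + 1)) ℂ :=
  Matrix.of fun N M => (p.nu0 a b c)⁻¹ * p.kBAC a b c M * p.racahR a b c M N

/-! ### Dynamical operators and Bethe states -/

section Operators

variable {R : Type*} [Ring R] [Algebra ℂ R]

/-- The dynamical operator `𝓑⁺(u,m)` with gauge parameters `α, β, χ`. The overall factor `β` has
been multiplied into the bracket, where it cancels the denominators `β`, so that the formula also
makes sense at `β = 0`. -/
noncomputable def dynBPlus (A As : R) (α β χ : ℂ) (u : ℂ) (m : ℤ) : R :=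
  (bfun (u ^ 2) / (α * p.q ^ (2 * m + 2) - β)) •
    ((χ * p.q ^ m / (p.rho * u)) • qComm p.q As A
      - (β ^ 2 * p.q ^ (-m) / (u * χ)) • qComm p.q A As
      + (β * ((p.q ^ 2 + 1) / (p.q * u))) • A
      - (β * (1 / (p.q * u ^ 3) + p.q * u)) • As
      + (p.q ^ (-m - 3) / (p.rho * χ * bfun (p.q ^ 2)) *
          ((p.q ^ 2 + 1) * u⁻¹ *
              (p.om * (χ ^ 2 * p.q ^ (2 * m + 2) - β ^ 2 * p.q ^ 2 * p.rho)
                + β * (p.q ^ 4 - 1) * p.etaStar * χ * p.q ^ m)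
            - p.q ^ 2 * p.rho * (p.q ^ 2 * u + (u ^ 3)⁻¹) *
              (β ^ 2 * p.rho - χ ^ 2 * p.q ^ (2 * m)))) • (1 : R))

/-- The dynamical operator `𝓑⁻(u,m)` with gauge parameters `α, β, χ`, the overall factor `β` being
multiplied into the bracket as for `𝓑⁺(u,m)`. -/
noncomputable def dynBMinus (A As : R) (α β χ : ℂ) (u : ℂ) (m : ℤ) : R :=
  (bfun (u ^ 2) * p.q ^ (2 * m + 1) / (α * (p.q ^ 2)⁻¹ - β * p.q ^ (2 * m))) •
    ((u * χ * p.q ^ (-m - 1) / p.rho) • qComm p.q As A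
      - (β ^ 2 * u * p.q ^ (m - 1) / χ) • qComm p.q A As
      + (β * ((p.q ^ 2 * u ^ 4 + 1) / (p.q ^ 2 * u))) • A
      - (β * ((p.q ^ 2 + 1) * u / p.q ^ 2)) • As
      - (p.q ^ (-m - 4) / (p.rho * χ * bfun (p.q ^ 2)) *
          (p.rho * p.q ^ 2 * (p.q ^ 2 * u ^ 3 + u⁻¹) *
              (β ^ 2 * p.rho * p.q ^ (2 * m) - χ ^ 2)
            + (p.q ^ 2 + 1) * u *
              (p.om * (β ^ 2 * p.rho * p.q ^ (2 * m + 2) - p.q ^ 2 * χ ^ 2)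
                + β * (p.q ^ 4 - 1) * p.eta * χ * p.q ^ m))) • (1 : R))

/-- `A⋄ = r₀/(q²-q⁻²) [A*, A]_q + r₀ ω^{.,*,⋄} / ((q-q⁻¹)(q²-q⁻²))`. -/
noncomputable def Adiam (A As : R) : R :=
  (p.r0 / (p.q ^ 2 - (p.q ^ 2)⁻¹)) • qComm p.q As A
    + (p.r0 * p.omega pt st di / ((p.q - p.q⁻¹) * (p.q ^ 2 - (p.q ^ 2)⁻¹))) • (1 : R)

end Operators

/-- The symmetric variable `U = (q u² + q⁻¹ u⁻²)/(q + q⁻¹)`. -/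
noncomputable def U (u : ℂ) : ℂ := (p.q * u ^ 2 + p.q⁻¹ * (u ^ 2)⁻¹) / (p.q + p.q⁻¹)

/-- `𝒢⁻_n(ū) = (-(q+q⁻¹) q^{n+1} 𝖻)^n ∏ b(u_i²) u_i`. -/
noncomputable def GMinus (n : ℕ) (u : Fin n → ℂ) : ℂ :=
  (-(p.q + p.q⁻¹) * p.q ^ ((n : ℤ) + 1) * p.b pt) ^ n * ∏ i, (bfun (u i ^ 2) * u i)

/-- `𝒢⁺_n(ū) = ((q+q⁻¹) q^{-n-1} 𝖼*)^n ∏ b(u_i²) u_i⁻¹`. -/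
noncomputable def GPlus (n : ℕ) (u : Fin n → ℂ) : ℂ :=
  ((p.q + p.q⁻¹) * p.q ^ (-((n : ℤ) + 1)) * p.c st) ^ n * ∏ i, (bfun (u i ^ 2) * (u i)⁻¹)

/-! ### Leonard pairs and eigenbases -/

section Modules

variable {V : Type*} [AddCommGroup V] [Module ℂ V]

/-- `v` is a basis of eigenvectors `|θᵃ_M⟩` of `X`, with the eigenvalue sequence `θᵃ`. -/
def IsEigenbasis (a : Idx) (X : Module.End ℂ V) (v : Module.Basis (Fin (p.d + 1)) ℂ V) : Prop :=
  ∀ M : Fin (p.d + 1), X (v M) = p.theta a M • v M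

/-- The Bethe state `|Ψ₋ⁿ(ū,m)⟩`: the string of operators `𝓑⁻` with `β = 0` applied to the reference
state `Ω = |θ_0⟩`. It is used for `(q² - q⁻²) χ⁻¹ α 𝖻 q^{-m} = -1`. -/
noncomputable def psiMinus (A As : Module.End ℂ V) (α χ : ℂ) (n : ℕ) (u : Fin n → ℂ) (m : ℤ)
    (Ω : V) : V :=
  bString (p.dynBMinus A As α 0 χ) n u m Ω

/-- The Bethe state `|Ψ₊ⁿ(ū,m)⟩`: the string of operators `𝓑⁺` with `β = 0` applied to the reference
state `Ω = |θ*_0⟩`. It is used for `(q² - q⁻²) χ⁻¹ α 𝖼* q^{m} = 1`. -/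
noncomputable def psiPlus (A As : Module.End ℂ V) (α χ : ℂ) (n : ℕ) (u : Fin n → ℂ) (m : ℤ)
    (Ω : V) : V :=
  bString (p.dynBPlus A As α 0 χ) n u m Ω

end Modules

end Params

/-- A square matrix is irreducible tridiagonal: its entries off the three central diagonals are zero
and those just above and just below the main diagonal are nonzero. -/
def IrreducibleTridiagonal {n : ℕ} (X : Matrix (Fin n) (Fin n) ℂ) : Prop :=
  (∀ i j : Fin n, (i : ℕ) + 1 < j ∨ (j : ℕ) + 1 < i → X i j = 0) ∧
  (∀ i j : Fin n, (i : ℕ) + 1 = j ∨ (j : ℕ) + 1 = i → X i j ≠ 0)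

section Modules

variable {V : Type*} [AddCommGroup V] [Module ℂ V]

/-- `(A, A*)` is a Leonard pair on `V` (of dimension `2s + 1`) with eigenvalue sequences `θ_M`,
`θ*_N` of q-Racah type, satisfying the Askey-Wilson relations with structure constants
`ρ, ω, η, η*`. -/
structure IsLeonardPair (p : Params) (A As : Module.End ℂ V) : Prop where
  diag_A : ∃ v : Module.Basis (Fin (p.d + 1)) ℂ V,
    p.IsEigenbasis pt A v ∧ IrreducibleTridiagonal (LinearMap.toMatrix v v As)
  diag_As : ∃ w : Module.Basis (Fin (p.d + 1)) ℂ V,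
    p.IsEigenbasis st As w ∧ IrreducibleTridiagonal (LinearMap.toMatrix w w A)
  aw₁ : qComm p.q⁻¹ A (qComm p.q A As) = p.rho • As + p.om • A + p.eta • 1
  aw₂ : qComm p.q⁻¹ As (qComm p.q As A) = p.rho • A + p.om • As + p.etaStar • 1

/-- The normalized eigenbases `|θ_M⟩`, `|θ*_N⟩`, `|θ⋄_N⟩` of `A`, `A*`, `A⋄` and the scalars
`f₀, g₀, h₀`. Inside each basis, the vectors are normalized one relatively to the other by
prescribing the subdiagonal coefficients `A^{(*,.)}_{M+1,M}`, `A^{(.,*)}_{M+1,M}`,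
`A^{(*,⋄)}_{M+1,M}`. The bases are normalized relatively to each other at index `0`: the
coefficient of `|θ_0⟩` in `|θ*_0⟩` is `1`, that of `|θ*_0⟩` in `|θ⋄_0⟩` is `g₀`, and that of
`|θ⋄_0⟩` in `|θ_0⟩` is `h₀/f₀`. -/
structure NormalizedBases (p : Params) (A As : Module.End ℂ V)
    (v w x : Module.Basis (Fin (p.d + 1)) ℂ V) (f0 g0 h0 : ℂ) : Prop where
  eigen_v : p.IsEigenbasis pt A v
  eigen_w : p.IsEigenbasis st As w
  eigen_x : p.IsEigenbasis di (p.Adiam A As) x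
  norm_v : ∀ M : Fin p.d,
    v.repr (As (v M.castSucc)) M.succ = p.lowBA pt st di ((M : ℕ) + 1)
  norm_w : ∀ M : Fin p.d,
    w.repr (A (w M.castSucc)) M.succ = p.lowAB pt st di ((M : ℕ) + 1)
  norm_x : ∀ M : Fin p.d,
    x.repr (As (x M.castSucc)) M.succ = p.lowAB st di pt ((M : ℕ) + 1)
  f0_ne_zero : f0 ≠ 0
  g0_ne_zero : g0 ≠ 0
  h0_ne_zero : h0 ≠ 0
  v_w : v.repr (w 0) 0 = 1
  w_x : w.repr (x 0) 0 = g0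
  x_v : x.repr (v 0) 0 = h0 / f0

end Modules

end LeonardBethe

/-! At β = 0 both dynamical operators collapse: `dynBMinus` and `dynBPlus` become scalars times U(u)
- r₀/(q+q⁻¹) A⋄ (`dynBMinus_eq`, `dynBPlus_eq`). A Bethe state is therefore a polynomial in A⋄
applied to |θ_0⟩ or |θ*_0⟩, and the scalars multiply up to 𝒢∓. Inserting the eigenbasis of A⋄
reduces both sums to the products ⟨θ⋄_N|θ_0⟩⟨θ_M|θ⋄_N⟩ and ⟨θ⋄_N|θ*_0⟩⟨θ_M|θ⋄_N⟩, where ⟨·| denotes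
coordinate forms.

These overlaps come from the split decomposition. For a pair X, Y with eigenbases v, x, the vectors
(Y - θ*_{n-1})⋯(Y - θ*_0) v_0 are triangular with respect to both bases, and X acts on them
bidiagonally (`Sys.split_exists`). The Askey-Wilson relation turns the unknown entries into a linear
recursion, whose two boundary zeros leave the q-Racah sequence `ph` as the only solution
(`Sys.split`). Expanding v_M in the split basis gives the q-Racah polynomials (`Sys.racah`). The
last split vector is an eigenvector of Y, and reversing the spectrum of Y turns this into the
overlap of v_M with x_0 (`Sys.overlap`).

The Askey-Wilson relations say that each of A, A*, A⋄ is the same q-commutator expression in the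
other two (`Triple.of_aw`), so this analysis applies to every ordered pair of the triple once the
relevant subdiagonal entries are nonzero. The explicit constants follow by comparing successive
ratios (`Gen.ovl_eq_kk`, `Gen.f_step`, `Gen.h_step`) and initial values (`Gen.ovl_zero`).
Orthogonality is the change of basis from v to x and back.

Two facts need the string of A⋄ itself. Its expansion in the split basis of (A, A*) has explicit
coefficients (`Sys.third_str`). With d + 1 factors the string kills |θ_0⟩, which yields the
eigenvectors of A⋄. With d factors and the reversed spectrum it projects |θ_0⟩ onto |θ⋄_0⟩, and its
|θ*_0⟩-coordinate retains a single term. This evaluates ⟨θ_0|θ*_0⟩⟨θ*_0|θ⋄_0⟩⟨θ⋄_0|θ_0⟩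
(`Bases.triple_product`), hence f₀h₀⁻¹g₀⁻¹.

All parameters are written multiplicatively as s, t, z = r₀𝖻, r₀𝖻*, r₀𝖻⋄. The exchange 𝖻ᶜq^{4s} ↔ 𝖼ᶜ
is then z ↦ (z q^{2d})⁻¹, the reversal of an eigenvalue sequence. -/

namespace LeonardBethe

open Finset

/-! ### Eigenvalue sequences and split sequences of q-Racah type -/

/-- The eigenvalue sequence `(t q^{2n} + t⁻¹ q^{-2n}) / r`. -/
noncomputable def th (q r t : ℂ) (n : ℕ) : ℂ := (t * (q ^ 2) ^ n + (t * (q ^ 2) ^ n)⁻¹) / r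

/-- The split sequence of a Leonard pair of q-Racah type. -/
noncomputable def ph (q r : ℂ) (d : ℕ) (s t z : ℂ) (n : ℕ) : ℂ :=
  (1 - (q ^ 2) ^ n) * (1 - (q ^ 2) ^ n / (q ^ 2) ^ (d + 1)) * (1 + s * t / z * (q ^ 2) ^ n / q)
    * (1 + s * t * z * (q ^ 2) ^ d * (q ^ 2) ^ n / q) * q ^ 2 / (r ^ 2 * s * t * ((q ^ 2) ^ n) ^ 2)

/-- The structure constant `ω` in multiplicative parameters. -/
noncomputable def omg (q r : ℂ) (d : ℕ) (s t z : ℂ) : ℂ :=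
  -(q - q⁻¹) ^ 2 / r ^ 2 * ((s * q ^ d + (s * q ^ d)⁻¹) * (t * q ^ d + (t * q ^ d)⁻¹)
    - (q ^ (d + 1) + (q ^ (d + 1))⁻¹) * (z * q ^ d + (z * q ^ d)⁻¹))

/-- Genericity of the multiplicative parameters of a Leonard triple of q-Racah type. -/
structure Gen (q r : ℂ) (d : ℕ) (s t z : ℂ) : Prop where
  q0 : q ≠ 0
  qr : ∀ n : ℕ, 0 < n → (q ^ 2) ^ n ≠ 1
  r0 : r ≠ 0
  s0 : s ≠ 0
  t0 : t ≠ 0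
  z0 : z ≠ 0
  hs : ∀ M ≤ 2 * d, 1 - s ^ 2 * (q ^ 2) ^ M ≠ 0
  ht : ∀ M ≤ 2 * d, 1 - t ^ 2 * (q ^ 2) ^ M ≠ 0
  hz : ∀ M ≤ 2 * d, 1 - z ^ 2 * (q ^ 2) ^ M ≠ 0
  k0 : ∀ M, 1 ≤ M → M ≤ d → 1 + s * t * z * (q ^ 2) ^ d * (q ^ 2) ^ M / q ≠ 0
  ks : ∀ M, 1 ≤ M → M ≤ d → 1 + t * z / s * (q ^ 2) ^ M / q ≠ 0
  kt : ∀ M, 1 ≤ M → M ≤ d → 1 + s * z / t * (q ^ 2) ^ M / q ≠ 0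
  kz : ∀ M, 1 ≤ M → M ≤ d → 1 + s * t / z * (q ^ 2) ^ M / q ≠ 0

variable {q r : ℂ} {d : ℕ} {s t z : ℂ}

/-- Genericity is symmetric in the three parameters. Together with `Gen.rot`, this transports each
result proved for one ordered pair to the other five. -/
theorem Gen.swap (h : Gen q r d s t z) : Gen q r d t s z where
  q0 := h.q0
  qr := h.qr
  r0 := h.r0
  s0 := h.t0
  t0 := h.s0
  z0 := h.z0
  hs := h.ht
  ht := h.hs
  hz := h.hz
  k0 M h1 h2 := by rw [mul_comm t s]; exact h.k0 M h1 h2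
  ks := h.kt
  kt := h.ks
  kz M h1 h2 := by rw [mul_comm t s]; exact h.kz M h1 h2

theorem Gen.rot (h : Gen q r d s t z) : Gen q r d t z s where
  q0 := h.q0
  qr := h.qr
  r0 := h.r0
  s0 := h.t0
  t0 := h.z0
  z0 := h.s0
  hs := h.ht
  ht := h.hz
  hz := h.hs
  k0 M h1 h2 := by rw [mul_comm (t * z) s, ← mul_assoc s]; exact h.k0 M h1 h2
  ks M h1 h2 := by rw [mul_comm z s]; exact h.kt M h1 h2
  kt M h1 h2 := by rw [mul_comm t s]; exact h.kz M h1 h2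
  kz := h.ks

theorem one_add_ne_zero_of_mul_eq_one {x y : ℂ} (hxy : x * y = 1) (hx : 1 + x ≠ 0) :
    1 + y ≠ 0 := by
  intro h
  apply hx
  linear_combination x * h - hxy

theorem Gen.Q0 (h : Gen q r d s t z) (n : ℕ) : (q ^ 2) ^ n ≠ 0 := pow_ne_zero _ (pow_ne_zero _ h.q0)

/-- Reversal of the second eigenvalue sequence. -/
theorem Gen.rev (h : Gen q r d s t z) : Gen q r d s (t * (q ^ 2) ^ d)⁻¹ z := by
  have hq := h.q0
  have hs := h.s0
  have ht := h.t0
  have hz := h.z0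
  have hD := h.Q0 d
  refine ⟨hq, h.qr, h.r0, hs, inv_ne_zero (mul_ne_zero ht hD), hz, h.hs, ?_, h.hz, ?_, ?_, ?_, ?_⟩
  · intro M hM hc
    -- Reversal inverts t q^{2d}, so the exponent M is exchanged with 2d - M.
    apply h.ht (2 * d - M) (by omega)
    have e : (q ^ 2) ^ d * (q ^ 2) ^ d = (q ^ 2) ^ (2 * d - M) * (q ^ 2) ^ M := by
      rw [← pow_add, ← pow_add]; congr 1; omega
    field_simp at hc
    have hc' : t ^ 2 * ((q ^ 2) ^ d * (q ^ 2) ^ d) = (q ^ 2) ^ M := by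
      linear_combination hc
    rw [e] at hc'
    have hM0 := h.Q0 M
    apply mul_right_cancel₀ hM0
    linear_combination -hc'
  -- Reversal exchanges the conditions `k0` and `kt` at the same index. It exchanges `ks` and `kz`
  -- at the index d + 1 - M, the product being inverted.
  · intro M h1 h2
    convert h.kt M h1 h2 using 2
    field_simp
  · intro M h1 h2
    refine one_add_ne_zero_of_mul_eq_one ?_ (h.kz (d + 1 - M) (by omega) (by omega))
    have e : (q ^ 2) ^ (d + 1 - M) * (q ^ 2) ^ M = (q ^ 2) ^ d * q ^ 2 := by
      rw [← pow_add, ← pow_succ]; congr 1; omega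
    field_simp
    linear_combination e
  · intro M h1 h2
    convert h.k0 M h1 h2 using 2
    field_simp
  · intro M h1 h2
    refine one_add_ne_zero_of_mul_eq_one ?_ (h.ks (d + 1 - M) (by omega) (by omega))
    have e : (q ^ 2) ^ (d + 1 - M) * (q ^ 2) ^ M = (q ^ 2) ^ d * q ^ 2 := by
      rw [← pow_add, ← pow_succ]; congr 1; omega
    field_simp
    linear_combination e

theorem th_rev (hq : q ≠ 0) (ht : t ≠ 0) {n : ℕ} (hn : n ≤ d) :
    th q r (t * (q ^ 2) ^ d)⁻¹ n = th q r t (d - n) := by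
  have e : (q ^ 2) ^ d = (q ^ 2) ^ (d - n) * (q ^ 2) ^ n := by
    rw [← pow_add]; congr 1; omega
  unfold th
  rw [e]
  have h1 : (q ^ 2) ^ (d - n) ≠ 0 := pow_ne_zero _ (pow_ne_zero _ hq)
  have h2 : (q ^ 2) ^ n ≠ 0 := pow_ne_zero _ (pow_ne_zero _ hq)
  congr 1
  generalize (q ^ 2) ^ (d - n) = x at *
  generalize (q ^ 2) ^ n = y at *
  field_simp
  ring

/-- Reversal inverts t q^d, which enters ω only through the sum of it and its inverse. Hence the
Askey-Wilson relations do not see the order of the spectrum. -/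
theorem omg_rev (hq : q ≠ 0) (ht : t ≠ 0) : omg q r d s (t * (q ^ 2) ^ d)⁻¹ z = omg q r d s t z := by
  have h1 : q ^ d ≠ 0 := pow_ne_zero _ hq
  unfold omg
  rw [show (q ^ 2) ^ d = q ^ d * q ^ d by rw [← pow_mul, ← pow_add]; congr 1; omega]
  have : (t * (q ^ d * q ^ d))⁻¹ * q ^ d = (t * q ^ d)⁻¹ := by field_simp
  rw [this, inv_inv, add_comm (t * q ^ d)⁻¹]

theorem omg_swap : omg q r d s t z = omg q r d t s z := by
  unfold omg; ring

/-- The second factor depends on i + j only. This is the source of both the simplicity of the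
spectra and the shift arguments for products of differences. -/
theorem th_sub_th (hq : q ≠ 0) (ht : t ≠ 0) (i j : ℕ) : th q r t i - th q r t j =
    ((q ^ 2) ^ i - (q ^ 2) ^ j) * (t ^ 2 * (q ^ 2) ^ (i + j) - 1) /
      (t * (q ^ 2) ^ (i + j) * r) := by
  have h1 : (q ^ 2) ^ i ≠ 0 := pow_ne_zero _ (pow_ne_zero _ hq)
  have h2 : (q ^ 2) ^ j ≠ 0 := pow_ne_zero _ (pow_ne_zero _ hq)
  unfold th
  rw [pow_add]
  generalize (q ^ 2) ^ i = x at *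
  generalize (q ^ 2) ^ j = y at *
  by_cases hr : r = 0
  · simp [hr]
  field_simp
  ring

theorem Gen.pow_sub_ne (h : Gen q r d s t z) {i j : ℕ} (hij : i ≠ j) :
    (q ^ 2) ^ i - (q ^ 2) ^ j ≠ 0 := by
  wlog hlt : i < j generalizing i j
  · have := this (i := j) (j := i) hij.symm (by omega)
    intro hc
    apply this
    linear_combination -hc
  have e : (q ^ 2) ^ j = (q ^ 2) ^ i * (q ^ 2) ^ (j - i) := by
    rw [← pow_add]; congr 1; omega
  intro hc
  apply h.qr (j - i) (by omega)
  rw [e] at hc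
  apply mul_left_cancel₀ (h.Q0 i)
  linear_combination -hc

theorem Gen.th_sub_ne (h : Gen q r d s t z) {i j : ℕ} (hij : i ≠ j) (hd : i + j ≤ 2 * d) :
    th q r t i - th q r t j ≠ 0 := by
  rw [th_sub_th h.q0 h.t0]
  refine div_ne_zero (mul_ne_zero (h.pow_sub_ne hij) ?_)
    (mul_ne_zero (mul_ne_zero h.t0 (h.Q0 _)) h.r0)
  intro hc
  apply h.ht (i + j) hd
  linear_combination -hc

theorem Gen.ph_ne (h : Gen q r d s t z) {n : ℕ} (h1 : 1 ≤ n) (h2 : n ≤ d) :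
    ph q r d s t z n ≠ 0 := by
  unfold ph
  have e : 1 - (q ^ 2) ^ n / (q ^ 2) ^ (d + 1) ≠ 0 := by
    have := h.pow_sub_ne (i := d + 1) (j := n) (by omega)
    have h0 := h.Q0 (d + 1)
    intro hc
    apply this
    field_simp at hc
    linear_combination hc
  refine div_ne_zero (mul_ne_zero (mul_ne_zero (mul_ne_zero (mul_ne_zero ?_ e) (h.kz n h1 h2))
    (h.k0 n h1 h2)) (pow_ne_zero _ h.q0)) ?_
  · intro hc
    exact h.qr n (by omega) (by linear_combination -hc)
  · exact mul_ne_zero (mul_ne_zero (mul_ne_zero (pow_ne_zero _ h.r0) h.s0) h.t0)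
      (pow_ne_zero _ (h.Q0 n))

theorem ph_zero : ph q r d s t z 0 = 0 := by simp [ph]

theorem Gen.ph_succ (h : Gen q r d s t z) : ph q r d s t z (d + 1) = 0 := by
  simp [ph, div_self (h.Q0 (d + 1))]

theorem th_rec (hq : q ≠ 0) (n : ℕ) :
    th q r t n - (q ^ 2 + (q ^ 2)⁻¹) * th q r t (n + 1) + th q r t (n + 2) = 0 := by
  have h1 : (q ^ 2) ^ n ≠ 0 := pow_ne_zero _ (pow_ne_zero _ hq)
  unfold th
  simp only [pow_add, pow_one]
  generalize (q ^ 2) ^ n = x at *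
  by_cases hr : r = 0
  · simp [hr]
  by_cases ht : t = 0
  · simp [ht]
  field_simp
  ring

/-- This inhomogeneous recursion is the one that the Askey-Wilson relation imposes on the split
sequence. The parameter z enters its right side only through ω. -/
theorem Gen.ph_rec (h : Gen q r d s t z) (n : ℕ) :
    ph q r d s t z (n + 2) - (q ^ 2 + (q ^ 2)⁻¹) * ph q r d s t z (n + 1) + ph q r d s t z n =
    omg q r d s t z - (th q r s n + th q r s (n + 1)) * (th q r t n + th q r t (n + 1))
      + (q ^ 2 + (q ^ 2)⁻¹) * (th q r s n * th q r t n + th q r s (n + 1) * th q r t (n + 1)) := by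
  have hQ := h.Q0 n
  have hE : q ^ d ≠ 0 := pow_ne_zero _ h.q0
  obtain ⟨hq, hr, hs, ht, hz⟩ : q ≠ 0 ∧ r ≠ 0 ∧ s ≠ 0 ∧ t ≠ 0 ∧ z ≠ 0 :=
    ⟨h.q0, h.r0, h.s0, h.t0, h.z0⟩
  have e : (q ^ 2) ^ d = q ^ d * q ^ d := by rw [← pow_mul, ← pow_add]; congr 1; omega
  unfold ph omg th
  simp only [pow_add, pow_one, e]
  generalize (q ^ 2) ^ n = x at *
  generalize q ^ d = y at *
  field_simp
  ring

end LeonardBethe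

namespace LeonardBethe

open Finset

variable {q r : ℂ} {d : ℕ} {s t z : ℂ}

/-! ### Coordinates indexed by natural numbers -/

section Coordinates

variable {V : Type*} [AddCommGroup V] [Module ℂ V]

/-- The `i`-th coordinate functional of a basis, zero when `i` is out of range. -/
noncomputable def cn (v : Module.Basis (Fin (d + 1)) ℂ V) (i : ℕ) : V →ₗ[ℂ] ℂ :=
  if h : i < d + 1 then v.coord ⟨i, h⟩ else 0

/-- The `i`-th vector of a basis, zero when `i` is out of range. -/
noncomputable def vn (v : Module.Basis (Fin (d + 1)) ℂ V) (i : ℕ) : V :=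
  if h : i < d + 1 then v ⟨i, h⟩ else 0

variable (v x : Module.Basis (Fin (d + 1)) ℂ V)

theorem cn_fin (i : Fin (d + 1)) (w : V) : cn v i w = v.repr w i := by
  rw [cn, dif_pos i.2]; rfl

theorem vn_fin (i : Fin (d + 1)) : vn v i = v i := by
  rw [vn, dif_pos i.2]

theorem cn_gt {i : ℕ} (hi : d < i) (w : V) : cn v i w = 0 := by
  simp [cn, show ¬ i < d + 1 by omega]

theorem cn_vn {i : ℕ} (hi : i ≤ d) (j : ℕ) : cn v i (vn v j) = if i = j then 1 else 0 := by
  have hi' : i < d + 1 := by omega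
  unfold cn vn
  rw [dif_pos hi']
  split_ifs with h1 h2 h2
  · subst h2; simp
  · simp only [Module.Basis.coord_apply, Module.Basis.repr_self]
    rw [Finsupp.single_apply, if_neg]
    simpa [Fin.ext_iff] using Ne.symm h2
  · omega
  · simp

theorem cn_ext {w w' : V} (h : ∀ i ≤ d, cn v i w = cn v i w') : w = w' := by
  apply v.repr.injective
  ext i
  have := h i (by omega)
  simpa [cn_fin] using this

theorem sum_cn (w : V) : ∑ j ∈ range (d + 1), cn v j w • vn v j = w := by
  rw [Finset.sum_range (fun j => cn v j w • vn v j)]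
  simp only [cn_fin, vn_fin]
  exact v.sum_repr w

theorem cn_map (f : Module.End ℂ V) (i : ℕ) (w : V) :
    cn v i (f w) = ∑ j ∈ range (d + 1), cn v j w * cn v i (f (vn v j)) := by
  conv_lhs => rw [← sum_cn v w]
  simp [map_sum]

variable {v x}

/-- `v` is an eigenbasis of `X` for the eigenvalues `c`. -/
def Eig (X : Module.End ℂ V) (v : Module.Basis (Fin (d + 1)) ℂ V) (c : ℕ → ℂ) : Prop :=
  ∀ i : Fin (d + 1), X (v i) = c i • v i

theorem Eig.vn {X : Module.End ℂ V} {c : ℕ → ℂ} (h : Eig X v c) (i : ℕ) :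
    X (vn v i) = c i • vn v i := by
  unfold LeonardBethe.vn
  split_ifs with hi
  · exact h ⟨i, hi⟩
  · simp

theorem Eig.cn {X : Module.End ℂ V} {c : ℕ → ℂ} (h : Eig X v c) (i : ℕ) (w : V) :
    cn v i (X w) = c i * cn v i w := by
  rcases Nat.lt_or_ge d i with hi | hi
  · simp [cn_gt v hi]
  rw [cn_map]
  rw [Finset.sum_eq_single i]
  · rw [h.vn, map_smul, cn_vn v hi]; simp; ring
  · intro j _ hj
    rw [h.vn, map_smul, cn_vn v hi, if_neg hj.symm]; simp
  · intro hi'; simp at hi'; omega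

theorem Eig.eq_smul {X : Module.End ℂ V} {c : ℕ → ℂ} (h : Eig X v c) {i : ℕ} (hi : i ≤ d)
    (hc : ∀ j ≤ d, j ≠ i → c j - c i ≠ 0) {w : V} (hw : X w = c i • w) :
    w = LeonardBethe.cn v i w • LeonardBethe.vn v i := by
  apply cn_ext v
  intro j hj
  rw [map_smul, cn_vn v hj]
  split_ifs with hji
  · subst hji; simp
  · have := h.cn j w
    rw [hw, map_smul, smul_eq_mul] at this
    have h2 : (c j - c i) * LeonardBethe.cn v j w = 0 := by linear_combination -this
    simpa using (mul_eq_zero.mp h2).resolve_left (hc j hj hji)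

/-- `Y` is tridiagonal in the basis `v`. -/
def Tri (Y : Module.End ℂ V) (v : Module.Basis (Fin (d + 1)) ℂ V) : Prop :=
  ∀ i j : ℕ, i + 1 < j ∨ j + 1 < i → cn v i (Y (vn v j)) = 0

/-- The subdiagonal entries of `Y` in the basis `v`. -/
noncomputable def sub (Y : Module.End ℂ V) (v : Module.Basis (Fin (d + 1)) ℂ V) (n : ℕ) : ℂ :=
  cn v (n + 1) (Y (vn v n))

theorem Tri.cn_gt {Y : Module.End ℂ V} (h : Tri Y v) {m : ℕ} {w : V}
    (hw : ∀ i, m < i → cn v i w = 0) {i : ℕ} (hi : m + 1 < i) : cn v i (Y w) = 0 := by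
  rw [cn_map]
  refine Finset.sum_eq_zero fun j _ => ?_
  rcases Nat.lt_or_ge m j with hj | hj
  · rw [hw j hj, zero_mul]
  · rw [h i j (by omega), mul_zero]

theorem Tri.cn_succ {Y : Module.End ℂ V} (h : Tri Y v) {m : ℕ} {w : V}
    (hw : ∀ i, m < i → cn v i w = 0) : cn v (m + 1) (Y w) = sub Y v m * cn v m w := by
  rw [cn_map, Finset.sum_eq_single m]
  · rw [sub, mul_comm]
  · intro j _ hj
    rcases Nat.lt_or_ge m j with hj' | hj'
    · rw [hw j hj', zero_mul]
    · rw [h (m + 1) j (by omega), mul_zero]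
  · intro hm
    simp only [mem_range, not_lt] at hm
    rw [LeonardBethe.cn_gt v (by omega), zero_mul]

theorem Tri.cn_lt {Y : Module.End ℂ V} (h : Tri Y v) {m : ℕ} {w : V}
    (hw : ∀ i, i < m + 1 → cn v i w = 0) {i : ℕ} (hi : i < m) : cn v i (Y w) = 0 := by
  rw [cn_map]
  refine Finset.sum_eq_zero fun j _ => ?_
  rcases Nat.lt_or_ge j (m + 1) with hj | hj
  · rw [hw j hj, zero_mul]
  · rw [h i j (by omega), mul_zero]

/-! ### Newton-type strings of vectors -/

/-- `(Y - c_{n-1}) ⋯ (Y - c_0) w`. -/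
noncomputable def str (Y : Module.End ℂ V) (c : ℕ → ℂ) (w : V) : ℕ → V
  | 0 => w
  | n + 1 => Y (str Y c w n) - c n • str Y c w n

theorem apply_str (Y : Module.End ℂ V) (c : ℕ → ℂ) (w : V) (n : ℕ) :
    Y (str Y c w n) = c n • str Y c w n + str Y c w (n + 1) := by
  simp [str]

theorem Eig.cn_str {Y : Module.End ℂ V} {c : ℕ → ℂ} (h : Eig Y x c) (e : ℕ → ℂ) (w : V) (n i : ℕ) :
    LeonardBethe.cn x i (str Y e w n) = (∏ k ∈ range n, (c i - e k)) * LeonardBethe.cn x i w := by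
  induction n with
  | zero => simp [str]
  | succ n ih =>
    rw [str, map_sub, h.cn, map_smul, ih, prod_range_succ]
    simp; ring

theorem Tri.cn_str_gt {Y : Module.End ℂ V} (h : Tri Y v) (e : ℕ → ℂ) {m : ℕ} {w : V}
    (hw : ∀ i, m < i → cn v i w = 0) (n : ℕ) {i : ℕ} (hi : m + n < i) :
    cn v i (str Y e w n) = 0 := by
  induction n generalizing i with
  | zero => exact hw i hi
  | succ n ih =>
    rw [str, map_sub, map_smul, ih (by omega), h.cn_gt (m := m + n) (fun j hj => ih hj) (by omega)]
    simp

theorem Tri.cn_str {Y : Module.End ℂ V} (h : Tri Y v) (e : ℕ → ℂ) {m : ℕ} {w : V}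
    (hw : ∀ i, m < i → cn v i w = 0) (n : ℕ) :
    cn v (m + n) (str Y e w n) = (∏ k ∈ range n, sub Y v (m + k)) * cn v m w := by
  induction n with
  | zero => simp [str]
  | succ n ih =>
    rw [str, map_sub, map_smul, h.cn_str_gt e hw n (by omega), ← add_assoc,
      h.cn_succ (m := m + n) (fun j hj => h.cn_str_gt e hw n hj), ih, prod_range_succ]
    simp; ring

/-- A vector in the span of `v_0, …, v_{m-1}` and of `x_m, …, x_d` is zero. -/
theorem eq_zero_of_flags {Y : Module.End ℂ V} {c : ℕ → ℂ} (hx : Eig Y x c) (hv : Tri Y v)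
    (hs : ∀ n < d, sub Y v n ≠ 0) {m : ℕ} (hm : m ≤ d) {w : V}
    (h1 : ∀ i, m ≤ i → cn v i w = 0) (h2 : ∀ i, i < m → cn x i w = 0) : w = 0 := by
  by_contra hw
  have hex : ∃ j, cn v j w ≠ 0 := by
    by_contra! hc
    exact hw (cn_ext v fun i _ => by rw [hc i, map_zero])
  have hbd : ∀ j, cn v j w ≠ 0 → j < m := fun j hj => by
    by_contra hc
    exact hj (h1 j (by omega))
  classical
  obtain ⟨j, hj, hmax⟩ : ∃ j, cn v j w ≠ 0 ∧ ∀ i, j < i → cn v i w = 0 := by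
    refine ⟨Nat.findGreatest (fun j => cn v j w ≠ 0) d, ?_, ?_⟩
    · obtain ⟨j, hj⟩ := hex
      exact Nat.findGreatest_spec (P := fun j => cn v j w ≠ 0) (m := j)
        (by have := hbd j hj; omega) hj
    · intro i hi
      rcases Nat.lt_or_ge d i with hd | hd
      · exact cn_gt v hd w
      · simpa using Nat.findGreatest_is_greatest hi hd
  have hjm := hbd j hj
  set n := d + 1 - m with hn
  have hz : str Y (fun k => c (m + k)) w n = 0 := by
    apply cn_ext x
    intro i hi
    rw [hx.cn_str, map_zero]
    rcases Nat.lt_or_ge i m with him | him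
    · rw [h2 i him, mul_zero]
    · rw [Finset.prod_eq_zero (i := i - m), zero_mul]
      · simp; omega
      · rw [show m + (i - m) = i by omega, sub_self]
  have := hv.cn_str (fun k => c (m + k)) hmax n
  rw [hz, map_zero] at this
  refine mul_ne_zero (Finset.prod_ne_zero_iff.mpr fun k hk => hs _ ?_) hj this.symm
  simp at hk
  omega

/-- A vector in the span of `v_0, …, v_m` and of `x_m, …, x_d` is a multiple of any vector of
this type which has a nonzero coordinate on `v_m`. -/
theorem eq_smul_of_flags {Y : Module.End ℂ V} {c : ℕ → ℂ} (hx : Eig Y x c) (hv : Tri Y v)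
    (hs : ∀ n < d, sub Y v n ≠ 0) {m : ℕ} (hm : m ≤ d) {w u : V}
    (h1 : ∀ i, m < i → cn v i w = 0) (h2 : ∀ i, i < m → cn x i w = 0)
    (h1' : ∀ i, m < i → cn v i u = 0) (h2' : ∀ i, i < m → cn x i u = 0) (hu : cn v m u ≠ 0) :
    w = (cn v m w / cn v m u) • u := by
  rw [← sub_eq_zero]
  refine eq_zero_of_flags hx hv hs hm ?_ ?_
  · intro i hi
    rw [map_sub, map_smul, smul_eq_mul]
    rcases Nat.eq_or_lt_of_le hi with rfl | hi
    · field_simp; simp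
    · rw [h1 i hi, h1' i hi]; simp
  · intro i hi
    rw [map_sub, map_smul, h2 i hi, h2' i hi]; simp

end Coordinates

end LeonardBethe

namespace LeonardBethe

open Finset

variable {q r : ℂ} {d : ℕ} {s t z : ℂ}

/-! ### Leonard pairs of q-Racah type: split decomposition -/

section Pairs

variable {V : Type*} [AddCommGroup V] [Module ℂ V]

/-- The Askey-Wilson relation which is quadratic in `Y`. -/
def AWRel (q r ω : ℂ) (X Y : Module.End ℂ V) : Prop :=
  ∃ η : ℂ, Y * Y * X - (q ^ 2 + (q ^ 2)⁻¹) • (Y * X * Y) + X * Y * Y =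
    (-(q ^ 2 - (q ^ 2)⁻¹) ^ 2 / r ^ 2) • X + ω • Y + η • 1

theorem AWRel.apply {ω : ℂ} {X Y : Module.End ℂ V} (h : AWRel q r ω X Y) :
    ∃ η : ℂ, ∀ w, Y (Y (X w)) - (q ^ 2 + (q ^ 2)⁻¹) • Y (X (Y w)) + X (Y (Y w)) =
      (-(q ^ 2 - (q ^ 2)⁻¹) ^ 2 / r ^ 2) • X w + ω • Y w + η • w := by
  obtain ⟨η, h⟩ := h
  exact ⟨η, fun w => by simpa using LinearMap.congr_fun h w⟩

/-- The left side is the factor by which the Askey-Wilson relation multiplies the (i, j) entry of X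
in an eigenbasis of Y. The factorization shows that it can vanish only for |i - j| = 1 or for
excluded values of t². -/
theorem th_quad (hq : q ≠ 0) (ht : t ≠ 0) (hr : r ≠ 0) (i j : ℕ) :
    th q r t i ^ 2 - (q ^ 2 + (q ^ 2)⁻¹) * (th q r t i * th q r t j) + th q r t j ^ 2
      + (q ^ 2 - (q ^ 2)⁻¹) ^ 2 / r ^ 2 =
    ((q ^ 2) ^ i - (q ^ 2) ^ (j + 1)) * ((q ^ 2) ^ (i + 1) - (q ^ 2) ^ j) *
      (t ^ 2 * (q ^ 2) ^ (i + j + 1) - 1) * (t ^ 2 * (q ^ 2) ^ (i + j) - q ^ 2) /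
      (q ^ 4 * t ^ 2 * ((q ^ 2) ^ i * (q ^ 2) ^ j) ^ 2 * r ^ 2) := by
  have h1 : (q ^ 2) ^ i ≠ 0 := pow_ne_zero _ (pow_ne_zero _ hq)
  have h2 : (q ^ 2) ^ j ≠ 0 := pow_ne_zero _ (pow_ne_zero _ hq)
  unfold th
  simp only [pow_add, pow_one]
  generalize (q ^ 2) ^ i = x at *
  generalize (q ^ 2) ^ j = y at *
  field_simp
  ring

theorem AWRel.tri {ω : ℂ} {X Y : Module.End ℂ V} (h : AWRel q r ω X Y) (hg : Gen q r d s t z)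
    {x : Module.Basis (Fin (d + 1)) ℂ V} (hx : Eig Y x (th q r t)) : Tri X x := by
  obtain ⟨η, h⟩ := h.apply
  intro i j hij
  rcases Nat.lt_or_ge d i with hi | hi
  · exact LeonardBethe.cn_gt x hi _
  rcases Nat.lt_or_ge d j with hj | hj
  · rw [vn, dif_neg (by omega)]; simp
  have h1 := congrArg (cn x i) (h (vn x j))
  simp only [map_add, map_sub, map_smul, hx.vn, hx.cn, cn_vn x hi, smul_eq_mul,
    if_neg (show i ≠ j by omega), mul_zero, add_zero] at h1
  have h2 : (th q r t i ^ 2 - (q ^ 2 + (q ^ 2)⁻¹) * (th q r t i * th q r t j) + th q r t j ^ 2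
      + (q ^ 2 - (q ^ 2)⁻¹) ^ 2 / r ^ 2) * cn x i (X (vn x j)) = 0 := by
    linear_combination h1
  refine (mul_eq_zero.mp h2).resolve_left ?_
  rw [th_quad hg.q0 hg.t0 hg.r0]
  refine div_ne_zero (mul_ne_zero (mul_ne_zero (mul_ne_zero (hg.pow_sub_ne (by omega))
    (hg.pow_sub_ne (by omega))) ?_) ?_) ?_
  · intro hc
    exact hg.ht (i + j + 1) (by omega) (by linear_combination -hc)
  · intro hc
    apply hg.ht (i + j - 1) (by omega)
    have e : (q ^ 2) ^ (i + j) = (q ^ 2) ^ (i + j - 1) * q ^ 2 := by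
      rw [← pow_succ]; congr 1; omega
    rw [e] at hc
    apply mul_right_cancel₀ (pow_ne_zero 2 hg.q0)
    linear_combination -hc
  · have := hg.q0
    have := hg.t0
    have := hg.r0
    have := hg.Q0 i
    have := hg.Q0 j
    positivity

/-- A pair `X, Y` with eigenbases `v, x` of q-Racah type satisfying the Askey-Wilson relations, such
that the subdiagonal entries of `Y` in `v` do not vanish. -/
structure Sys (q r : ℂ) (d : ℕ) (s t z : ℂ) (X Y : Module.End ℂ V)
    (v x : Module.Basis (Fin (d + 1)) ℂ V) : Prop where
  gen : Gen q r d s t z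
  eigX : Eig X v (th q r s)
  eigY : Eig Y x (th q r t)
  relX : AWRel q r (omg q r d s t z) X Y
  relY : AWRel q r (omg q r d s t z) Y X
  sub_ne : ∀ n < d, sub Y v n ≠ 0

variable {X Y : Module.End ℂ V} {v x : Module.Basis (Fin (d + 1)) ℂ V}

theorem Sys.triX (h : Sys q r d s t z X Y v x) : Tri X x := h.relX.tri h.gen h.eigY

theorem Sys.triY (h : Sys q r d s t z X Y v x) : Tri Y v := h.relY.tri h.gen.swap h.eigX

/-- The split basis. -/
noncomputable def spl (q r t : ℂ) (Y : Module.End ℂ V) (v : Module.Basis (Fin (d + 1)) ℂ V) (n : ℕ) :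
    V := str Y (th q r t) (vn v 0) n

theorem cn_vn_zero_gt (v : Module.Basis (Fin (d + 1)) ℂ V) (i : ℕ) (hi : 0 < i) :
    cn v i (vn v 0) = 0 := by
  rcases Nat.lt_or_ge d i with hd | hd
  · exact cn_gt v hd _
  · rw [cn_vn v hd, if_neg (by omega)]

theorem Tri.cn_spl_gt (h : Tri Y v) (e : ℕ → ℂ) {n i : ℕ} (hi : n < i) :
    LeonardBethe.cn v i (str Y e (vn v 0) n) = 0 :=
  h.cn_str_gt e (m := 0) (cn_vn_zero_gt v) n (by omega)

theorem Tri.cn_spl (h : Tri Y v) (e : ℕ → ℂ) (n : ℕ) :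
    LeonardBethe.cn v n (str Y e (vn v 0) n) = ∏ k ∈ range n, sub Y v k := by
  have := h.cn_str e (m := 0) (cn_vn_zero_gt v) n
  simpa [cn_vn v (Nat.zero_le d)] using this

theorem Sys.prod_sub_ne (h : Sys q r d s t z X Y v x) {n : ℕ} (hn : n ≤ d) :
    ∏ k ∈ range n, sub Y v k ≠ 0 :=
  prod_ne_zero_iff.mpr fun k hk => h.sub_ne k (by simp at hk; omega)

theorem Sys.cn_x_spl (h : Sys q r d s t z X Y v x) (n i : ℕ) :
    cn x i (spl q r t Y v n) =
      (∏ k ∈ range n, (th q r t i - th q r t k)) * cn x i (vn v 0) :=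
  h.eigY.cn_str _ _ n i

theorem Sys.cn_x_spl_lt (h : Sys q r d s t z X Y v x) {n i : ℕ} (hi : i < n) :
    cn x i (spl q r t Y v n) = 0 := by
  rw [h.cn_x_spl, prod_eq_zero (i := i), zero_mul] <;> simp [hi]

theorem Sys.spl_succ (h : Sys q r d s t z X Y v x) : spl q r t Y v (d + 1) = 0 := by
  apply cn_ext x
  intro i hi
  rw [h.cn_x_spl_lt (by omega), map_zero]

/-- The vector (X - θ_n) spl_n has no v-component of index ≥ n, because θ_n is cancelled. It has no
x-component of index < n - 1, because X is tridiagonal in x. These two flags meet in the line of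
spl_{n-1}. -/
theorem Sys.split_exists (h : Sys q r d s t z X Y v x) : ∃ φ : ℕ → ℂ, φ 0 = 0 ∧ φ (d + 1) = 0 ∧
    ∀ n ≤ d + 1, X (spl q r t Y v n) = th q r s n • spl q r t Y v n + φ n • spl q r t Y v (n - 1) := by
  have key : ∀ n, 1 ≤ n → n ≤ d → ∃ φ : ℂ,
      X (spl q r t Y v n) = th q r s n • spl q r t Y v n + φ • spl q r t Y v (n - 1) := by
    intro n h1 hn
    refine ⟨cn v (n - 1) (X (spl q r t Y v n) - th q r s n • spl q r t Y v n) /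
      cn v (n - 1) (spl q r t Y v (n - 1)), ?_⟩
    rw [← eq_smul_of_flags (w := X (spl q r t Y v n) - th q r s n • spl q r t Y v n)
      h.eigY h.triY h.sub_ne (m := n - 1) (by omega)]
    · abel
    · intro i hi
      rw [map_sub, h.eigX.cn, map_smul, smul_eq_mul, ← sub_mul]
      rcases Nat.eq_or_lt_of_le (show n ≤ i by omega) with rfl | hi
      · simp
      · rw [spl, h.triY.cn_spl_gt _ hi, mul_zero]
    · intro i hi
      rw [map_sub, map_smul, h.triX.cn_lt (m := n - 1) (fun j hj => h.cn_x_spl_lt (by omega)) hi,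
        h.cn_x_spl_lt (by omega)]
      simp
    · intro i hi
      exact h.triY.cn_spl_gt _ hi
    · intro i hi
      exact h.cn_x_spl_lt hi
    · rw [spl, h.triY.cn_spl]
      exact h.prod_sub_ne (by omega)
  choose φ hφ using key
  -- The value 0 is correct at n = 0, where v_0 is an eigenvector of X, and at n = d + 1, where the
  -- split vector is zero.
  refine ⟨fun n => if hn : 1 ≤ n ∧ n ≤ d then φ n hn.1 hn.2 else 0, by simp, by simp, ?_⟩
  intro n hn
  by_cases h1 : 1 ≤ n ∧ n ≤ d
  · simp only [dif_pos h1]; exact hφ n h1.1 h1.2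
  · simp only [dif_neg h1]
    rcases Nat.eq_zero_or_pos n with rfl | h0
    · simp [spl, str, h.eigX.vn]
    · obtain rfl : n = d + 1 := by omega
      simp [h.spl_succ]

/-- A solution starting at 0 is proportional to q^{2n} - q^{-2n}, and this does not vanish at n = d
+ 1 since q is not a root of unity. -/
theorem eq_zero_of_rec (hg : Gen q r d s t z) {D : ℕ → ℂ} (h0 : D 0 = 0) (h1 : D (d + 1) = 0)
    (hrec : ∀ n < d, D (n + 2) - (q ^ 2 + (q ^ 2)⁻¹) * D (n + 1) + D n = 0) {n : ℕ}
    (hn : n ≤ d + 1) : D n = 0 := by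
  have hq := hg.q0
  have hq1 : q ^ 2 - (q ^ 2)⁻¹ ≠ 0 := by
    have := hg.qr 2 (by norm_num)
    intro hc
    apply this
    field_simp at hc
    linear_combination hc
  have key : ∀ n, (n ≤ d + 1 →
      D n * (q ^ 2 - (q ^ 2)⁻¹) = D 1 * ((q ^ 2) ^ n - ((q ^ 2) ^ n)⁻¹)) ∧
      (n + 1 ≤ d + 1 →
      D (n + 1) * (q ^ 2 - (q ^ 2)⁻¹) = D 1 * ((q ^ 2) ^ (n + 1) - ((q ^ 2) ^ (n + 1))⁻¹)) := by
    intro n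
    induction n with
    | zero => simp [h0]
    | succ n ih =>
      refine ⟨ih.2, fun hn => ?_⟩
      have e1 := ih.1 (by omega)
      have e2 := ih.2 (by omega)
      have e3 := hrec n (by omega)
      have hQ := hg.Q0 n
      have : D (n + 2) * (q ^ 2 - (q ^ 2)⁻¹) =
          (q ^ 2 + (q ^ 2)⁻¹) * (D 1 * ((q ^ 2) ^ (n + 1) - ((q ^ 2) ^ (n + 1))⁻¹))
            - D 1 * ((q ^ 2) ^ n - ((q ^ 2) ^ n)⁻¹) := by
        linear_combination (q ^ 2 - (q ^ 2)⁻¹) * e3 - e1 + (q ^ 2 + (q ^ 2)⁻¹) * e2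
      rw [show n + 1 + 1 = n + 2 from rfl, this]
      simp only [pow_add, pow_one]
      generalize (q ^ 2) ^ n = y at *
      field_simp
      ring
  have hd := (key (d + 1)).1 le_rfl
  rw [h1, zero_mul] at hd
  have hD1 : D 1 = 0 := by
    refine (mul_eq_zero.mp hd.symm).resolve_right ?_
    have hne := hg.qr (2 * (d + 1)) (by omega)
    have hQ := hg.Q0 (d + 1)
    intro hc
    apply hne
    rw [show 2 * (d + 1) = (d + 1) + (d + 1) by ring, pow_add]
    generalize (q ^ 2) ^ (d + 1) = y at *
    field_simp at hc
    linear_combination hc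
  have := (key n).1 hn
  rw [hD1, zero_mul] at this
  exact (mul_eq_zero.mp this).resolve_right hq1

/-- Applied to spl_n and read at v_{n+1}, the Askey-Wilson relation gives for φ the recursion of
`Gen.ph_rec`: the terms along spl_{n+2} cancel by `th_rec`, and those along spl_n and lower do not
contribute. The difference of φ and `ph` is thus homogeneous and vanishes at both ends. -/
theorem Sys.split (h : Sys q r d s t z X Y v x) {n : ℕ} (hn : n ≤ d + 1) :
    X (spl q r t Y v n) =
      th q r s n • spl q r t Y v n + ph q r d s t z n • spl q r t Y v (n - 1) := by
  obtain ⟨φ, h0, h1, hφ⟩ := h.split_exists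
  have hX := fun n (hn : n ≤ d) => hφ (n + 1) (by omega)
  simp only [Nat.add_sub_cancel] at hX
  suffices hD : φ n - ph q r d s t z n = 0 by rw [hφ n hn, sub_eq_zero.mp hD]
  refine eq_zero_of_rec (D := fun n => φ n - ph q r d s t z n) h.gen ?_ ?_ ?_ hn
  · simp [h0, ph_zero]
  · simp [h1, h.gen.ph_succ]
  intro n hn
  obtain ⟨η, hrel⟩ := h.relX.apply
  have hY : ∀ n, Y (spl q r t Y v n) = th q r t n • spl q r t Y v n + spl q r t Y v (n + 1) :=
    fun n => apply_str Y _ _ n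
  have hgt : ∀ k i, k < i → cn v i (spl q r t Y v k) = 0 := fun k i hi => h.triY.cn_spl_gt _ hi
  have hπ : cn v (n + 1) (spl q r t Y v (n + 1)) ≠ 0 := by
    rw [spl, h.triY.cn_spl]; exact h.prod_sub_ne (by omega)
  have e := congrArg (cn v (n + 1)) (hrel (spl q r t Y v n))
  rw [hφ n (by omega)] at e
  simp only [map_add, map_smul, hY, hX n (by omega), hX (n + 1) (by omega), map_sub,
    hgt n (n + 1) (by omega), hgt (n - 1) (n + 1) (by omega), smul_eq_mul, mul_zero, add_zero,
    zero_add, smul_add, hφ n (by omega)] at e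
  -- For n = 0 the truncated subtraction makes n - 1 + 1 differ from n; the factor φ 0 = 0 absorbs
  -- the discrepancy here and in the next fact.
  have hc0 : φ n * cn v (n + 1) (spl q r t Y v (n - 1 + 1)) = 0 := by
    rcases Nat.eq_zero_or_pos n with rfl | hp
    · rw [h0, zero_mul]
    · rw [hgt _ _ (by omega), mul_zero]
  have hc1 : φ n * cn v (n + 1) (spl q r t Y v (n - 1 + 1 + 1)) =
      φ n * cn v (n + 1) (spl q r t Y v (n + 1)) := by
    rcases Nat.eq_zero_or_pos n with rfl | hp
    · rw [h0, zero_mul, zero_mul]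
    · rw [Nat.sub_add_cancel hp]
  have h3 := th_rec (q := q) (r := r) (t := s) h.gen.q0 n
  have h4 := h.gen.ph_rec n
  apply mul_right_cancel₀ hπ
  rw [zero_mul]
  linear_combination e - h3 * cn v (n + 1) (spl q r t Y v (n + 2)) 
    - h4 * cn v (n + 1) (spl q r t Y v (n + 1))
    + ((q ^ 2 + (q ^ 2)⁻¹) * th q r t n - th q r t (n - 1) - th q r t (n - 1 + 1)) * hc0 - hc1

end Pairs

end LeonardBethe

/-! ### q-Racah polynomials and overlaps of the two eigenbases -/

namespace LeonardBethe

open Finset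

variable {q r : ℂ} {d : ℕ} {s t z : ℂ}

section Pairs

variable {V : Type*} [AddCommGroup V] [Module ℂ V]
variable {X Y : Module.End ℂ V} {v x : Module.Basis (Fin (d + 1)) ℂ V}

/-- The `q`-Racah polynomial, as a terminating sum over the split basis. -/
noncomputable def Rg (q r : ℂ) (d : ℕ) (s t z : ℂ) (M N : ℕ) : ℂ :=
  ∑ n ∈ range (d + 1), ∏ j ∈ range n,
    ((th q r s M - th q r s j) * (th q r t N - th q r t j) / ph q r d s t z (j + 1))

/-- Transition coefficients between the eigenbases are `q`-Racah polynomials. -/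
theorem Sys.racah (h : Sys q r d s t z X Y v x) {M : ℕ} (hM : M ≤ d) (N : ℕ) :
    (∏ j ∈ range M, (sub Y v j * (th q r s M - th q r s j) / ph q r d s t z (j + 1))) *
      cn x N (vn v M) = Rg q r d s t z M N * cn x N (vn v 0) := by
  set p : ℕ → ℂ := fun n => ∏ j ∈ range n, ((th q r s M - th q r s j) / ph q r d s t z (j + 1))
    with hp
  -- The coefficients p are chosen so that the partial sums telescope: they satisfy the eigenvalue
  -- equation for θ_M up to a multiple of the last split vector.
  have hpart : ∀ m ≤ d, X (∑ n ∈ range (m + 1), p n • spl q r t Y v n) =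
      th q r s M • ∑ n ∈ range (m + 1), p n • spl q r t Y v n +
        (p m * (th q r s m - th q r s M)) • spl q r t Y v m := by
    intro m
    induction m with
    | zero =>
      intro _
      have := h.split (n := 0) (by omega)
      rw [ph_zero, zero_smul, add_zero] at this
      simp only [zero_add, sum_range_one, map_smul, this]
      module
    | succ m ih =>
      intro hm
      rw [sum_range_succ, map_add, ih (by omega), map_smul, h.split (by omega),
        Nat.add_sub_cancel]
      have e : p (m + 1) * ph q r d s t z (m + 1) = p m * (th q r s M - th q r s m) := by
        have := h.gen.ph_ne (n := m + 1) (by omega) hm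
        rw [hp]
        simp only [prod_range_succ]
        field_simp
      rw [smul_add, smul_smul (p (m + 1)) (ph _ _ _ _ _ _ _), e]
      module
  have hz : ∀ n, M < n → p n = 0 := by
    intro n hn
    exact prod_eq_zero (i := M) (by simp [hn]) (by simp)
  have hW := hpart d le_rfl
  -- The remainder vanishes at m = d: either M = d, or p_d contains the factor θ_M - θ_M.
  have hlast : p d * (th q r s d - th q r s M) = 0 := by
    rcases Nat.eq_or_lt_of_le hM with rfl | hlt
    · simp
    · rw [hz d hlt, zero_mul]
  rw [hlast, zero_smul, add_zero] at hW
  set W := ∑ n ∈ range (d + 1), p n • spl q r t Y v n with hWdef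
  have hWM := h.eigX.eq_smul hM (fun j hj hne => h.gen.swap.th_sub_ne hne (by omega)) hW
  have h1 : cn v M W = p M * ∏ k ∈ range M, sub Y v k := by
    rw [hWdef, map_sum, sum_eq_single M]
    · rw [map_smul, spl, h.triY.cn_spl, smul_eq_mul]
    · intro n _ hn
      rcases Nat.lt_or_ge M n with hlt | hge
      · rw [hz n hlt]; simp
      · rw [map_smul, spl, h.triY.cn_spl_gt _ (by omega), smul_zero]
    · intro hc
      simp at hc; omega
  have h2 : cn x N W = Rg q r d s t z M N * cn x N (vn v 0) := by
    rw [hWdef, map_sum, Rg, sum_mul]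
    refine sum_congr rfl fun n _ => ?_
    rw [map_smul, h.cn_x_spl, hp, smul_eq_mul, ← mul_assoc, ← prod_mul_distrib]
    congr 1
    refine prod_congr rfl fun j _ => ?_
    ring
  rw [← h2, hWM, map_smul, h1, smul_eq_mul, hp, ← prod_mul_distrib]
  congr 1
  refine prod_congr rfl fun j _ => ?_
  ring

/-- The M-th coordinate of `Sys.split` is a first-order recursion in n, started at the leading
coordinate n = M. -/
theorem Sys.cn_v_spl (h : Sys q r d s t z X Y v x) {M n : ℕ} (hM : M ≤ n) (hn : n ≤ d) :
    cn v M (spl q r t Y v n) = (∏ k ∈ range M, sub Y v k) *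
      ∏ k ∈ Ico M n, (ph q r d s t z (k + 1) / (th q r s M - th q r s (k + 1))) := by
  induction n, hM using Nat.le_induction with
  | base => simp [spl, h.triY.cn_spl]
  | succ n hMn ih =>
    have e := congrArg (cn v M) (h.split (n := n + 1) (by omega))
    rw [h.eigX.cn, map_add, map_smul, map_smul, Nat.add_sub_cancel, ih (by omega)] at e
    have hne := h.gen.swap.th_sub_ne (i := M) (j := n + 1) (by omega) (by omega)
    rw [prod_Ico_succ_top hMn]
    simp only [smul_eq_mul] at e
    rw [← mul_assoc, mul_div_assoc', eq_div_iff hne]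
    linear_combination e

/-- The last split vector is annihilated by all coordinates of x except x_d, hence is a multiple of
x_d; its v-coordinates are known from `Sys.cn_v_spl`. -/
theorem Sys.overlap_last (h : Sys q r d s t z X Y v x) {M : ℕ} (hM : M ≤ d) :
    cn v M (vn x d) * cn x d (vn v 0) * ∏ k ∈ range d, (th q r t d - th q r t k) =
      (∏ k ∈ range M, sub Y v k) *
        ∏ k ∈ Ico M d, (ph q r d s t z (k + 1) / (th q r s M - th q r s (k + 1))) := by
  rw [← h.cn_v_spl hM le_rfl]
  have : spl q r t Y v d = cn x d (spl q r t Y v d) • vn x d := by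
    apply cn_ext x
    intro i hi
    rw [map_smul, cn_vn x hi]
    split_ifs with hid
    · subst hid; simp
    · rw [h.cn_x_spl_lt (by omega)]; simp
  conv_rhs => rw [this]
  rw [map_smul, h.cn_x_spl, smul_eq_mul]
  ring

theorem cn_rev (x : Module.Basis (Fin (d + 1)) ℂ V) {i : ℕ} (hi : i ≤ d) (w : V) :
    cn (x.reindex Fin.revPerm) i w = cn x (d - i) w := by
  have := cn_fin (x.reindex Fin.revPerm) ⟨i, by omega⟩ w
  rw [Fin.val_mk] at this
  rw [this]
  have h2 := cn_fin x (Fin.rev ⟨i, by omega⟩) w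
  rw [Fin.val_rev] at h2
  simp only [Nat.add_sub_add_right] at h2
  rw [h2]
  simp

theorem vn_rev (x : Module.Basis (Fin (d + 1)) ℂ V) {i : ℕ} (hi : i ≤ d) :
    vn (x.reindex Fin.revPerm) i = vn x (d - i) := by
  have := vn_fin (x.reindex Fin.revPerm) ⟨i, by omega⟩
  rw [Fin.val_mk] at this
  rw [this]
  have h2 := vn_fin x (Fin.rev ⟨i, by omega⟩)
  rw [Fin.val_rev] at h2
  simp only [Nat.add_sub_add_right] at h2
  rw [h2]
  simp

theorem Eig.rev (hq : q ≠ 0) (ht : t ≠ 0) (h : Eig Y x (th q r t)) :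
    Eig Y (x.reindex Fin.revPerm) (th q r (t * (q ^ 2) ^ d)⁻¹) := by
  intro i
  rw [th_rev hq ht (by omega), ← vn_fin, vn_rev x (by omega)]
  exact h.vn _

theorem Sys.rev (h : Sys q r d s t z X Y v x) :
    Sys q r d s (t * (q ^ 2) ^ d)⁻¹ z X Y v (x.reindex Fin.revPerm) where
  gen := h.gen.rev
  eigX := h.eigX
  eigY := h.eigY.rev h.gen.q0 h.gen.t0
  relX := by rw [omg_rev h.gen.q0 h.gen.t0]; exact h.relX
  relY := by rw [omg_rev h.gen.q0 h.gen.t0]; exact h.relY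
  sub_ne := h.sub_ne

/-- The overlaps of the eigenvectors `v_M` with `x_0`, divided by the product of the subdiagonal
entries. -/
noncomputable def ovl (q r : ℂ) (d : ℕ) (s t z : ℂ) (M : ℕ) : ℂ :=
  (∏ k ∈ Ico M d, (ph q r d s (t * (q ^ 2) ^ d)⁻¹ z (k + 1) / (th q r s M - th q r s (k + 1)))) /
    ∏ k ∈ range d, (th q r t 0 - th q r t (k + 1))

theorem Gen.prod_th_ne (h : Gen q r d s t z) : ∏ k ∈ range d, (th q r t 0 - th q r t (k + 1)) ≠ 0 :=
  prod_ne_zero_iff.mpr fun k hk => h.th_sub_ne (by omega) (by simp at hk; omega)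

theorem Gen.ovl_ne (h : Gen q r d s t z) {M : ℕ} : ovl q r d s t z M ≠ 0 := by
  refine div_ne_zero (prod_ne_zero_iff.mpr fun k hk => ?_) h.prod_th_ne
  simp at hk
  exact div_ne_zero (h.rev.ph_ne (by omega) (by omega)) (h.swap.th_sub_ne (by omega) (by omega))

/-- This is `Sys.overlap_last` for the reversed basis of Y. The product on the left is insensitive
to the scaling of x_0, and the scaling of v is carried entirely by its subdiagonal entries. -/
theorem Sys.overlap (h : Sys q r d s t z X Y v x) {M : ℕ} (hM : M ≤ d) :
    cn v M (vn x 0) * cn x 0 (vn v 0) = (∏ k ∈ range M, sub Y v k) * ovl q r d s t z M := by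
  have := h.rev.overlap_last hM
  rw [vn_rev x le_rfl, cn_rev x le_rfl, Nat.sub_self] at this
  rw [ovl, mul_div_assoc', ← this, eq_div_iff h.gen.prod_th_ne]
  congr 1
  rw [← prod_range_reflect]
  refine prod_congr rfl fun k hk => ?_
  simp only [mem_range] at hk
  rw [th_rev h.gen.q0 h.gen.t0 le_rfl, th_rev h.gen.q0 h.gen.t0 (by omega), Nat.sub_self]
  congr 2
  omega

theorem Sys.overlap_zero_ne (h : Sys q r d s t z X Y v x) :
    cn v 0 (vn x 0) ≠ 0 ∧ cn x 0 (vn v 0) ≠ 0 := by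
  have := h.overlap (Nat.zero_le d)
  have h2 := h.gen.ovl_ne (M := 0)
  rw [prod_range_zero, one_mul] at this
  rw [← this] at h2
  exact ⟨left_ne_zero_of_mul h2, right_ne_zero_of_mul h2⟩

end Pairs

end LeonardBethe

namespace LeonardBethe

open Finset

variable {q r : ℂ} {d : ℕ} {s t z : ℂ}

/-! ### The third member of a Leonard triple -/

/-- The factor common to the split sequence of `(A, A*)` and to the expansion of the string of
`A⋄` in the split basis. -/
noncomputable def gfac (q : ℂ) (d : ℕ) (s t z : ℂ) (k : ℕ) : ℂ :=
  (1 - (q ^ 2) ^ (k + 1)) * (1 - (q ^ 2) ^ k / (q ^ 2) ^ d) *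
    (1 + s * t * z * (q ^ 2) ^ d * (q ^ 2) ^ k * q)

/-- The coefficient of the `k`-th split vector of `(A, A*)` in the `(m+k)`-th string vector
of `A⋄`. -/
noncomputable def gco (q r : ℂ) (d : ℕ) (s t z : ℂ) (m k : ℕ) : ℂ :=
  (∏ j ∈ range (m + k), gfac q d s t z j) / ((∏ j ∈ range k, gfac q d s t z j) *
    ∏ j ∈ range m, (1 - (q ^ 2) ^ (j + 1))) /
    (s ^ (m + k) * q ^ (m ^ 2 + 4 * m * k + k ^ 2) * (t * r) ^ m)

theorem Gen.gfac_ne (h : Gen q r d s t z) {k : ℕ} (hk : k < d) : gfac q d s t z k ≠ 0 := by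
  have hq := h.q0
  refine mul_ne_zero (mul_ne_zero ?_ ?_) ?_
  · intro hc
    exact h.qr (k + 1) (by omega) (by linear_combination -hc)
  · have := h.pow_sub_ne (i := d) (j := k) (by omega)
    have hD := h.Q0 d
    intro hc
    apply this
    field_simp at hc
    linear_combination hc
  · have := h.k0 (k + 1) (by omega) (by omega)
    convert this using 2
    rw [pow_succ (q ^ 2) k]
    field_simp

theorem Gen.gfac_prod_ne (h : Gen q r d s t z) {k : ℕ} (hk : k ≤ d) :
    ∏ j ∈ range k, gfac q d s t z j ≠ 0 :=
  prod_ne_zero_iff.mpr fun j hj => h.gfac_ne (by simp at hj; omega)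

theorem Gen.qfac_ne (h : Gen q r d s t z) (m : ℕ) : 1 - (q ^ 2) ^ (m + 1) ≠ 0 := fun hc =>
  h.qr (m + 1) (by omega) (by linear_combination -hc)

/-- The string is lengthened with k fixed; `Gen.gco_shift` instead keeps m + k fixed. Both let
neighbouring coefficients be expressed through a single one. -/
theorem Gen.gco_succ (h : Gen q r d s t z) {m k : ℕ} (hk : k ≤ d) :
    gco q r d s t z (m + 1) k = gco q r d s t z m k * gfac q d s t z (m + k) /
      ((1 - (q ^ 2) ^ (m + 1)) * (s * t * r * q * (q ^ 2) ^ m * ((q ^ 2) ^ k) ^ 2)) := by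
  have h1 := h.gfac_prod_ne hk
  have h2 := h.qfac_ne m
  have h3 : ∏ j ∈ range m, (1 - (q ^ 2) ^ (j + 1)) ≠ 0 :=
    prod_ne_zero_iff.mpr fun j _ => h.qfac_ne j
  obtain ⟨hq, hr, hs, ht⟩ : q ≠ 0 ∧ r ≠ 0 ∧ s ≠ 0 ∧ t ≠ 0 := ⟨h.q0, h.r0, h.s0, h.t0⟩
  have e : q ^ ((m + 1) ^ 2 + 4 * (m + 1) * k + k ^ 2) =
      q ^ (m ^ 2 + 4 * m * k + k ^ 2) * (q * (q ^ 2) ^ m * ((q ^ 2) ^ k) ^ 2) := by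
    simp only [← pow_mul, ← pow_succ', ← pow_add]
    congr 1; ring
  unfold gco
  rw [show m + 1 + k = m + k + 1 by ring, prod_range_succ _ (m + k), prod_range_succ _ m, e,
    pow_succ s, pow_succ (t * r)]
  field_simp

theorem Gen.gco_shift (h : Gen q r d s t z) {m k : ℕ} (hk : k + 1 ≤ d) :
    gco q r d s t z (m + 1) k = gco q r d s t z m (k + 1) * gfac q d s t z k * (q ^ 2) ^ m /
      ((1 - (q ^ 2) ^ (m + 1)) * ((q ^ 2) ^ k * t * r)) := by
  have h1 := h.gfac_prod_ne (k := k) (by omega)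
  have h1' := h.gfac_ne (k := k) (by omega)
  have h2 := h.qfac_ne m
  have h3 : ∏ j ∈ range m, (1 - (q ^ 2) ^ (j + 1)) ≠ 0 :=
    prod_ne_zero_iff.mpr fun j _ => h.qfac_ne j
  obtain ⟨hq, hr, hs, ht⟩ : q ≠ 0 ∧ r ≠ 0 ∧ s ≠ 0 ∧ t ≠ 0 := ⟨h.q0, h.r0, h.s0, h.t0⟩
  have e : q ^ ((m + 1) ^ 2 + 4 * (m + 1) * k + k ^ 2) * (q ^ 2) ^ m =
      q ^ (m ^ 2 + 4 * m * (k + 1) + (k + 1) ^ 2) * (q ^ 2) ^ k := by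
    simp only [← pow_mul, ← pow_add]
    congr 1; ring
  unfold gco
  rw [show m + 1 + k = m + (k + 1) by ring, prod_range_succ _ k, prod_range_succ _ m,
    pow_succ (t * r)]
  generalize ∏ j ∈ range (m + (k + 1)), gfac q d s t z j = A
  have e1 : q ^ ((m + 1) ^ 2 + 4 * (m + 1) * k + k ^ 2) ≠ 0 := pow_ne_zero _ hq
  have e2 : q ^ (m ^ 2 + 4 * m * (k + 1) + (k + 1) ^ 2) ≠ 0 := pow_ne_zero _ hq
  have e3 := h.Q0 m
  have e4 := h.Q0 k
  generalize q ^ ((m + 1) ^ 2 + 4 * (m + 1) * k + k ^ 2) = a at *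
  generalize q ^ (m ^ 2 + 4 * m * (k + 1) + (k + 1) ^ 2) = b at *
  generalize (q ^ 2) ^ m = qm at *
  generalize (q ^ 2) ^ k = qk at *
  field_simp
  linear_combination -A * e

/-- The diagonal entries of `A⋄` in the split basis of `(A, A*)`. -/
theorem Gen.diag_split (h : Gen q r d s t z) (k : ℕ) :
    r / (q ^ 2 - (q ^ 2)⁻¹) * ((q - q⁻¹) * (th q r s k * th q r t k) + q * ph q r d s t z k
        - q⁻¹ * ph q r d s t z (k + 1))
      + r * omg q r d s t z / ((q - q⁻¹) * (q ^ 2 - (q ^ 2)⁻¹)) =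
    th q r z k + (gfac q d s t z k / ((q ^ 2) ^ k) ^ 2
      - (1 - (q ^ 2) ^ k) * (1 - (q ^ 2) ^ k / (q ^ 2) ^ (d + 1)) *
        (1 + s * t * z * (q ^ 2) ^ d * (q ^ 2) ^ k / q) * q ^ 4 / ((q ^ 2) ^ k) ^ 2) /
      (s * t * r * q * (1 - q ^ 2)) := by
  have hQ := h.Q0 k
  have hE : q ^ d ≠ 0 := pow_ne_zero _ h.q0
  obtain ⟨hq, hr, hs, ht, hz⟩ : q ≠ 0 ∧ r ≠ 0 ∧ s ≠ 0 ∧ t ≠ 0 ∧ z ≠ 0 :=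
    ⟨h.q0, h.r0, h.s0, h.t0, h.z0⟩
  have e : (q ^ 2) ^ d = q ^ d * q ^ d := by rw [← pow_mul, ← pow_add]; congr 1; omega
  have h1 : 1 - q ^ 2 ≠ 0 := by simpa using h.qfac_ne 0
  have h2 : 1 + q ^ 2 ≠ 0 := by
    have := h.qfac_ne 1
    intro hc
    apply this
    linear_combination (1 - q ^ 2) * hc
  have e1 : q - q⁻¹ = -(1 - q ^ 2) / q := by field_simp; ring
  have e2 : q ^ 2 - (q ^ 2)⁻¹ = -(1 - q ^ 2) * (1 + q ^ 2) / q ^ 2 := by field_simp; ring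
  unfold ph omg th gfac
  rw [e1, e2]
  simp only [pow_add, pow_one, e]
  generalize (q ^ 2) ^ k = x at *
  generalize q ^ d = y at *
  field_simp
  ring

theorem Gen.gco_rec_aux (h : Gen q r d s t z) (m k : ℕ) :
    gfac q d s t z (m + k) /
        ((1 - (q ^ 2) ^ (m + 1)) * (s * t * r * q * (q ^ 2) ^ m * ((q ^ 2) ^ k) ^ 2)) =
    (1 - (q ^ 2) ^ k) * (1 - (q ^ 2) ^ k / (q ^ 2) ^ (d + 1)) *
        (1 + s * t * z * (q ^ 2) ^ d * (q ^ 2) ^ k / q) * (q ^ 2) ^ m * q ^ 3 /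
        ((1 - (q ^ 2) ^ (m + 1)) * (((q ^ 2) ^ k) ^ 2 * s * t * r)) +
    (th q r z k + (gfac q d s t z k / ((q ^ 2) ^ k) ^ 2
      - (1 - (q ^ 2) ^ k) * (1 - (q ^ 2) ^ k / (q ^ 2) ^ (d + 1)) *
        (1 + s * t * z * (q ^ 2) ^ d * (q ^ 2) ^ k / q) * q ^ 4 / ((q ^ 2) ^ k) ^ 2) /
      (s * t * r * q * (1 - q ^ 2)) - th q r z (m + k)) +
    (1 - (q ^ 2) ^ m) * (1 + s * t / z * (q ^ 2) ^ k * q) /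
      (r * s * t * q * (q ^ 2) ^ m * ((q ^ 2) ^ k) ^ 2) := by
  have hQ := h.Q0 k
  have hQ' := h.Q0 m
  have hD := h.Q0 d
  obtain ⟨hq, hr, hs, ht, hz⟩ : q ≠ 0 ∧ r ≠ 0 ∧ s ≠ 0 ∧ t ≠ 0 ∧ z ≠ 0 :=
    ⟨h.q0, h.r0, h.s0, h.t0, h.z0⟩
  have h1 : 1 - q ^ 2 ≠ 0 := by simpa using h.qfac_ne 0
  have h2 := h.qfac_ne m
  unfold gfac th
  simp only [pow_add, pow_one] at h2 ⊢
  generalize (q ^ 2) ^ k = x at *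
  generalize (q ^ 2) ^ m = w at *
  generalize (q ^ 2) ^ d = y at *
  field_simp
  ring

end LeonardBethe

namespace LeonardBethe

open Finset

variable {q r : ℂ} {d : ℕ} {s t z : ℂ}

/-- The contribution to the (k+1)-st split vector coming from the k-th one is rewritten as a
multiple of the coefficient at k + 1. With `Gen.gco_down` for the opposite direction, the recursion
for the string becomes a rational identity with a common factor. -/
theorem Gen.gco_up (h : Gen q r d s t z) {m k : ℕ} (hk : k + 1 ≤ d) :
    gco q r d s t z (m + 1) k * (s * (q ^ 2) ^ k * q)⁻¹ =
    gco q r d s t z m (k + 1) *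
      ((1 - (q ^ 2) ^ (k + 1)) * (1 - (q ^ 2) ^ (k + 1) / (q ^ 2) ^ (d + 1)) *
        (1 + s * t * z * (q ^ 2) ^ d * (q ^ 2) ^ (k + 1) / q) * (q ^ 2) ^ m * q ^ 3 /
        ((1 - (q ^ 2) ^ (m + 1)) * (((q ^ 2) ^ (k + 1)) ^ 2 * s * t * r))) := by
  rw [h.gco_shift hk]
  have hQ := h.Q0 k
  have hD := h.Q0 d
  obtain ⟨hq, hr, hs, ht, hz⟩ : q ≠ 0 ∧ r ≠ 0 ∧ s ≠ 0 ∧ t ≠ 0 ∧ z ≠ 0 :=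
    ⟨h.q0, h.r0, h.s0, h.t0, h.z0⟩
  have h2 := h.qfac_ne m
  generalize gco q r d s t z m (k + 1) = A
  generalize (1 - (q ^ 2) ^ (m + 1)) = B at *
  unfold gfac
  rw [pow_succ (q ^ 2) k, pow_succ (q ^ 2) d]
  generalize (q ^ 2) ^ k = x at *
  generalize (q ^ 2) ^ d = y at *
  field_simp

theorem Gen.gco_down (h : Gen q r d s t z) {m k : ℕ} (hk : k + 1 ≤ d) :
    gco q r d s t z m (k + 1) * (ph q r d s t z (k + 1) * q / (t * (q ^ 2) ^ (k + 1))) =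
    gco q r d s t z (m + 1) k * ((1 - (q ^ 2) ^ (m + 1)) * (1 + s * t / z * (q ^ 2) ^ k * q) /
      (r * s * t * q * (q ^ 2) ^ (m + 1) * ((q ^ 2) ^ k) ^ 2)) := by
  rw [h.gco_shift hk]
  have hQ := h.Q0 k
  have hm := h.Q0 m
  have hD := h.Q0 d
  obtain ⟨hq, hr, hs, ht, hz⟩ : q ≠ 0 ∧ r ≠ 0 ∧ s ≠ 0 ∧ t ≠ 0 ∧ z ≠ 0 :=
    ⟨h.q0, h.r0, h.s0, h.t0, h.z0⟩
  have h2 := h.qfac_ne m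
  have e : 1 - (q ^ 2) ^ (m + 1) = 1 - (q ^ 2) ^ m * q ^ 2 := by rw [pow_succ]
  generalize gco q r d s t z m (k + 1) = A
  unfold gfac ph
  simp only [pow_succ (q ^ 2) k, pow_succ (q ^ 2) d, pow_succ (q ^ 2) m] at h2 ⊢
  generalize (q ^ 2) ^ k = x at *
  generalize (q ^ 2) ^ d = y at *
  generalize (q ^ 2) ^ m = w at *
  generalize hB : (1 - w * q ^ 2) = B at *
  field_simp

/-- The recursion satisfied by the coefficients `gco`. -/
theorem Gen.gco_rec (h : Gen q r d s t z) {m k : ℕ} (hk : k ≤ d) :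
    gco q r d s t z (m + 1) k = gco q r d s t z m k *
    ((1 - (q ^ 2) ^ k) * (1 - (q ^ 2) ^ k / (q ^ 2) ^ (d + 1)) *
        (1 + s * t * z * (q ^ 2) ^ d * (q ^ 2) ^ k / q) * (q ^ 2) ^ m * q ^ 3 /
        ((1 - (q ^ 2) ^ (m + 1)) * (((q ^ 2) ^ k) ^ 2 * s * t * r))) +
    gco q r d s t z m k *
    (r / (q ^ 2 - (q ^ 2)⁻¹) * ((q - q⁻¹) * (th q r s k * th q r t k) + q * ph q r d s t z k
        - q⁻¹ * ph q r d s t z (k + 1))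
      + r * omg q r d s t z / ((q - q⁻¹) * (q ^ 2 - (q ^ 2)⁻¹)) - th q r z (m + k)) +
    gco q r d s t z m k * ((1 - (q ^ 2) ^ m) * (1 + s * t / z * (q ^ 2) ^ k * q) /
      (r * s * t * q * (q ^ 2) ^ m * ((q ^ 2) ^ k) ^ 2)) := by
  rw [h.gco_succ hk, h.diag_split, mul_div_assoc, h.gco_rec_aux]
  ring

theorem sum_shift_down {V : Type*} [AddCommGroup V] [Module ℂ V] (n : ℕ) (F G : ℕ → ℂ) (u : ℕ → V)
    (h0 : G 0 = 0) (h : ∀ k < n, F k = G (k + 1)) :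
    ∑ k ∈ range (n + 1), F k • u (k + 1) = ∑ k ∈ range (n + 1), G k • u k + F n • u (n + 1) := by
  rw [sum_range_succ, sum_range_succ' (fun k => G k • u k), h0, zero_smul, add_zero]
  congr 1
  exact sum_congr rfl fun k hk => by rw [h k (by simpa using hk)]

theorem sum_shift_up {V : Type*} [AddCommGroup V] [Module ℂ V] (n : ℕ) (F G : ℕ → ℂ) (u : ℕ → V)
    (h0 : F 0 = 0) (h1 : G n = 0) (h : ∀ k < n, F (k + 1) = G k) :
    ∑ k ∈ range (n + 1), F k • u (k - 1) = ∑ k ∈ range (n + 1), G k • u k := by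
  rw [sum_range_succ', sum_range_succ, h0, h1, zero_smul, zero_smul]
  congr 1
  exact sum_congr rfl fun k hk => by rw [h k (by simpa using hk), Nat.add_sub_cancel]

section Pairs

variable {V : Type*} [AddCommGroup V] [Module ℂ V]
variable {X Y : Module.End ℂ V} {v x : Module.Basis (Fin (d + 1)) ℂ V}

/-- The third member of a Leonard triple, as a function of the first two. -/
noncomputable def third (q r ω : ℂ) (X Y : Module.End ℂ V) : Module.End ℂ V :=
  (r / (q ^ 2 - (q ^ 2)⁻¹)) • (q • (Y * X) - q⁻¹ • (X * Y)) +
    (r * ω / ((q - q⁻¹) * (q ^ 2 - (q ^ 2)⁻¹))) • (1 : Module.End ℂ V)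

theorem Gen.q2_sub_ne (h : Gen q r d s t z) : q ^ 2 - (q ^ 2)⁻¹ ≠ 0 := by
  have hq := h.q0
  have := h.qfac_ne 1
  intro hc
  apply this
  field_simp at hc
  linear_combination -hc

theorem Gen.q_sub_ne (h : Gen q r d s t z) : q - q⁻¹ ≠ 0 := by
  have hq := h.q0
  have := h.qfac_ne 0
  intro hc
  apply this
  field_simp at hc
  linear_combination -hc

theorem th_step_up (hq : q ≠ 0) (hs : s ≠ 0) (hr : r ≠ 0) (hq2 : q ^ 2 - (q ^ 2)⁻¹ ≠ 0) (k : ℕ) :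
    r / (q ^ 2 - (q ^ 2)⁻¹) * (q * th q r s k - q⁻¹ * th q r s (k + 1)) =
      (s * (q ^ 2) ^ k * q)⁻¹ := by
  have hx : (q ^ 2) ^ k ≠ 0 := pow_ne_zero _ (pow_ne_zero _ hq)
  rw [div_mul_eq_mul_div, div_eq_iff hq2]
  unfold th
  rw [pow_succ (q ^ 2) k]
  generalize (q ^ 2) ^ k = x at *
  field_simp
  ring

theorem th_step_down (hq : q ≠ 0) (hs : s ≠ 0) (hr : r ≠ 0) (hq2 : q ^ 2 - (q ^ 2)⁻¹ ≠ 0) (k : ℕ) :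
    r / (q ^ 2 - (q ^ 2)⁻¹) * (q * th q r s (k + 1) - q⁻¹ * th q r s k) =
      s * (q ^ 2) ^ k * q := by
  have hx : (q ^ 2) ^ k ≠ 0 := pow_ne_zero _ (pow_ne_zero _ hq)
  rw [div_mul_eq_mul_div, div_eq_iff hq2]
  unfold th
  rw [pow_succ (q ^ 2) k]
  generalize (q ^ 2) ^ k = x at *
  field_simp
  ring

theorem th_step_down' (hq : q ≠ 0) (hs : s ≠ 0) (hr : r ≠ 0) (hq2 : q ^ 2 - (q ^ 2)⁻¹ ≠ 0) (k : ℕ) :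
    r / (q ^ 2 - (q ^ 2)⁻¹) * (q * th q r s k - q⁻¹ * th q r s (k + 1)) =
      q / (s * (q ^ 2) ^ (k + 1)) := by
  rw [th_step_up hq hs hr hq2, pow_succ (q ^ 2) k]
  have hx : (q ^ 2) ^ k ≠ 0 := pow_ne_zero _ (pow_ne_zero _ hq)
  field_simp

/-- The third operator is tridiagonal in the split basis of the first two. -/
theorem Sys.third_spl (h : Sys q r d s t z X Y v x) {k : ℕ} (hk : k ≤ d) :
    third q r (omg q r d s t z) X Y (spl q r t Y v k) =
    (s * (q ^ 2) ^ k * q)⁻¹ • spl q r t Y v (k + 1) +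
    (r / (q ^ 2 - (q ^ 2)⁻¹) * ((q - q⁻¹) * (th q r s k * th q r t k) + q * ph q r d s t z k
        - q⁻¹ * ph q r d s t z (k + 1))
      + r * omg q r d s t z / ((q - q⁻¹) * (q ^ 2 - (q ^ 2)⁻¹))) • spl q r t Y v k +
    (ph q r d s t z k * q / (t * (q ^ 2) ^ k)) • spl q r t Y v (k - 1) := by
  have hq2 := h.gen.q2_sub_ne
  have hY : ∀ n, Y (spl q r t Y v n) = th q r t n • spl q r t Y v n + spl q r t Y v (n + 1) :=
    fun n => apply_str Y _ _ n
  have e1 : X (Y (spl q r t Y v k)) = th q r t k • (th q r s k • spl q r t Y v k +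
      ph q r d s t z k • spl q r t Y v (k - 1)) + (th q r s (k + 1) • spl q r t Y v (k + 1) +
      ph q r d s t z (k + 1) • spl q r t Y v k) := by
    rw [hY, map_add, map_smul, h.split (by omega), h.split (by omega), Nat.add_sub_cancel]
  have e2 : Y (X (spl q r t Y v k)) = th q r s k • (th q r t k • spl q r t Y v k +
      spl q r t Y v (k + 1)) + ph q r d s t z k • Y (spl q r t Y v (k - 1)) := by
    rw [h.split (by omega), map_add, map_smul, map_smul, hY k]
  simp only [third, LinearMap.add_apply, LinearMap.smul_apply, LinearMap.sub_apply,
    Module.End.mul_apply, Module.End.one_apply]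
  rw [← th_step_up h.gen.q0 h.gen.s0 h.gen.r0 hq2, e1, e2]
  rcases Nat.eq_zero_or_pos k with rfl | hp
  · rw [ph_zero]
    module
  · obtain ⟨j, rfl⟩ : ∃ j, k = j + 1 := ⟨k - 1, by omega⟩
    rw [Nat.add_sub_cancel, hY j, mul_div_assoc (ph q r d s t z (j + 1)) q, ← th_step_down' h.gen.q0 h.gen.t0 h.gen.r0 hq2]
    module

/-- The expansion of the string of `A⋄` in the split basis of `(A, A*)`. -/
theorem Sys.third_str (h : Sys q r d s t z X Y v x) {n : ℕ} (hn : n ≤ d + 1) :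
    str (third q r (omg q r d s t z) X Y) (th q r z) (vn v 0) n =
      ∑ k ∈ range (n + 1), gco q r d s t z (n - k) k • spl q r t Y v k := by
  induction n with
  | zero => simp [str, gco, spl]
  | succ n ih =>
    have hn' : n ≤ d := by omega
    rw [str, ih (by omega), map_sum, smul_sum, ← sum_sub_distrib]
    set T1 : ℕ → ℂ := fun k => gco q r d s t z (n - k) k *
      ((1 - (q ^ 2) ^ k) * (1 - (q ^ 2) ^ k / (q ^ 2) ^ (d + 1)) *
        (1 + s * t * z * (q ^ 2) ^ d * (q ^ 2) ^ k / q) * (q ^ 2) ^ (n - k) * q ^ 3 /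
        ((1 - (q ^ 2) ^ (n - k + 1)) * (((q ^ 2) ^ k) ^ 2 * s * t * r))) with hT1
    set T3 : ℕ → ℂ := fun k => gco q r d s t z (n - k) k *
      ((1 - (q ^ 2) ^ (n - k)) * (1 + s * t / z * (q ^ 2) ^ k * q) /
      (r * s * t * q * (q ^ 2) ^ (n - k) * ((q ^ 2) ^ k) ^ 2)) with hT3
    set b : ℕ → ℂ := fun k => r / (q ^ 2 - (q ^ 2)⁻¹) * ((q - q⁻¹) * (th q r s k * th q r t k)
      + q * ph q r d s t z k - q⁻¹ * ph q r d s t z (k + 1))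
      + r * omg q r d s t z / ((q - q⁻¹) * (q ^ 2 - (q ^ 2)⁻¹)) with hb
    have e1 := sum_shift_down n (fun k => gco q r d s t z (n - k) k * (s * (q ^ 2) ^ k * q)⁻¹) T1
      (spl q r t Y v) (by simp [hT1]) (fun k hk => by
        have := h.gen.gco_up (m := n - (k + 1)) (k := k) (by omega)
        rw [show n - (k + 1) + 1 = n - k by omega] at this
        simp only [hT1]
        rw [this, show n - (k + 1) + 1 = n - k by omega])
    have e3 := sum_shift_up n (fun k => gco q r d s t z (n - k) k *
      (ph q r d s t z k * q / (t * (q ^ 2) ^ k))) T3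
      (spl q r t Y v) (by simp [ph_zero]) (by simp [hT3]) (fun k hk => by
        have := h.gen.gco_down (m := n - (k + 1)) (k := k) (by omega)
        rw [show n - (k + 1) + 1 = n - k by omega] at this
        simp only [hT3]
        rw [this])
    have e4 : ∀ k ∈ range (n + 1), third q r (omg q r d s t z) X Y
        (gco q r d s t z (n - k) k • spl q r t Y v k) -
        th q r z n • gco q r d s t z (n - k) k • spl q r t Y v k =
        (gco q r d s t z (n - k) k * (s * (q ^ 2) ^ k * q)⁻¹) • spl q r t Y v (k + 1) +
        (gco q r d s t z (n - k) k * (b k - th q r z n)) • spl q r t Y v k +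
        (gco q r d s t z (n - k) k * (ph q r d s t z k * q / (t * (q ^ 2) ^ k))) •
          spl q r t Y v (k - 1) := by
      intro k hk
      simp only [mem_range] at hk
      rw [map_smul, h.third_spl (by omega)]
      simp only [hb]
      module
    rw [sum_congr rfl e4, sum_add_distrib, sum_add_distrib, e1, e3, sum_range_succ _ (n + 1)]
    -- At n = d the formula for the new top coefficient may fail, because `gfac` vanishes at d and a
    -- zero denominator appears. It is not needed there: the split vector of index d + 1 is zero.
    have e5 : gco q r d s t z (n - n) n * (s * (q ^ 2) ^ n * q)⁻¹ =
        gco q r d s t z (n + 1 - (n + 1)) (n + 1) ∨ n = d := by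
      rcases Nat.eq_or_lt_of_le hn' with hnd | hlt
      · exact Or.inr hnd
      left
      have h1 := h.gen.gfac_prod_ne (k := n) (by omega)
      have h2 := h.gen.gfac_prod_ne (k := n + 1) (by omega)
      have hq := h.gen.q0
      have hs := h.gen.s0
      rw [Nat.sub_self, Nat.sub_self]
      simp only [gco, zero_add, range_zero, prod_empty, mul_one, pow_zero, div_self h1, div_self h2,
        mul_zero, zero_mul, ne_eq, OfNat.ofNat_ne_zero, not_false_eq_true, zero_pow]
      rw [show q ^ (n + 1) ^ 2 = q ^ n ^ 2 * ((q ^ 2) ^ n * q) by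
        rw [← pow_mul, ← pow_succ, ← pow_add]; congr 1; ring, pow_succ s]
      field_simp
    have e6 : (gco q r d s t z (n - n) n * (s * (q ^ 2) ^ n * q)⁻¹) • spl q r t Y v (n + 1) =
        gco q r d s t z (n + 1 - (n + 1)) (n + 1) • spl q r t Y v (n + 1) := by
      rcases e5 with e5 | rfl
      · rw [e5]
      · rw [h.spl_succ, smul_zero, smul_zero]
    rw [e6]
    have e7 : ∀ k ∈ range (n + 1), gco q r d s t z (n + 1 - k) k • spl q r t Y v k =
        T1 k • spl q r t Y v k + (gco q r d s t z (n - k) k * (b k - th q r z n)) • spl q r t Y v k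
          + T3 k • spl q r t Y v k := by
      intro k hk
      simp only [mem_range] at hk
      have := h.gen.gco_rec (m := n - k) (k := k) (by omega)
      rw [show n - k + 1 = n + 1 - k by omega, show n - k + k = n by omega] at this
      rw [this]
      simp only [hT1, hT3, hb, show n - k + 1 = n + 1 - k by omega]
      module
    rw [sum_congr rfl e7, sum_add_distrib, sum_add_distrib]
    abel

/-- Every coefficient with k ≤ d contains `gfac` at d, which is zero. The conclusion shows that v_0
already satisfies the expected annihilating polynomial of the third operator, the input for
constructing its eigenvectors. -/
theorem Sys.third_str_succ (h : Sys q r d s t z X Y v x) :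
    str (third q r (omg q r d s t z) X Y) (th q r z) (vn v 0) (d + 1) = 0 := by
  rw [h.third_str le_rfl]
  refine sum_eq_zero fun k hk => ?_
  rcases Nat.eq_or_lt_of_le (show k ≤ d + 1 by simpa [Nat.lt_succ_iff] using hk) with rfl | hlt
  · rw [h.spl_succ, smul_zero]
  · rw [gco, show d + 1 - k + k = d + 1 by omega, prod_range_succ, gfac, div_self (h.gen.Q0 d)]
    simp

end Pairs

end LeonardBethe

/-! ### Leonard triples and their Askey-Wilson relations -/

namespace LeonardBethe

open Finset

variable {q r : ℂ} {d : ℕ} {s t z : ℂ}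

section Triples

variable {V : Type*} [AddCommGroup V] [Module ℂ V]
variable {X Y Z : Module.End ℂ V} {v x : Module.Basis (Fin (d + 1)) ℂ V}

theorem third_apply (ω : ℂ) (X Y : Module.End ℂ V) (w : V) : third q r ω X Y w =
    (r / (q ^ 2 - (q ^ 2)⁻¹)) • (q • Y (X w) - q⁻¹ • X (Y w)) +
    (r * ω / ((q - q⁻¹) * (q ^ 2 - (q ^ 2)⁻¹))) • w := by
  simp [third]

theorem AWRel.of_apply {ω η : ℂ} {X Y : Module.End ℂ V} (h : ∀ w,
    Y (Y (X w)) - (q ^ 2 + (q ^ 2)⁻¹) • Y (X (Y w)) + X (Y (Y w)) =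
      (-(q ^ 2 - (q ^ 2)⁻¹) ^ 2 / r ^ 2) • X w + ω • Y w + η • w) : AWRel q r ω X Y :=
  ⟨η, LinearMap.ext fun w => by simpa using h w⟩

/-- Three operators, each one being determined by the other two. -/
structure Triple (q r : ℂ) (d : ℕ) (s t z : ℂ) (X Y Z : Module.End ℂ V) : Prop where
  gen : Gen q r d s t z
  eqZ : Z = third q r (omg q r d s t z) X Y
  eqX : X = third q r (omg q r d t z s) Y Z
  eqY : Y = third q r (omg q r d z s t) Z X

theorem Triple.rot (h : Triple q r d s t z X Y Z) : Triple q r d t z s Y Z X :=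
  ⟨h.gen.rot, h.eqX, h.eqY, h.eqZ⟩

theorem Gen.q_add (h : Gen q r d s t z) : q + q⁻¹ = (q ^ 2 - (q ^ 2)⁻¹) / (q - q⁻¹) := by
  have hq := h.q0
  rw [eq_div_iff h.q_sub_ne]
  field_simp
  ring

/-- Substituting Z, written in X and Y, into the expression of Y in Z and X leaves a relation
between X and Y alone. With `Triple.relZX` and rotations, all six ordered pairs are covered. -/
theorem Triple.relYX (h : Triple q r d s t z X Y Z) : AWRel q r (omg q r d s t z) Y X := by
  have hq := h.gen.q0
  have hr := h.gen.r0
  have h1 := h.gen.q2_sub_ne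
  have h2 := h.gen.q_sub_ne
  refine .of_apply (η := (q + q⁻¹) / r * omg q r d z s t) fun w => ?_
  have eY : Y w = _ := (LinearMap.congr_fun h.eqY w).trans (third_apply _ _ _ _)
  have eZ : ∀ w, Z w = _ := fun w => (LinearMap.congr_fun h.eqZ w).trans (third_apply _ _ _ _)
  have e : (-(q ^ 2 - (q ^ 2)⁻¹) ^ 2 / r ^ 2) • Y w = (-(q ^ 2 - (q ^ 2)⁻¹) ^ 2 / r ^ 2) •
    (r / (q ^ 2 - (q ^ 2)⁻¹)) • (q • X (Z w) - q⁻¹ • Z (X w)) +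
    (-(q ^ 2 - (q ^ 2)⁻¹) ^ 2 / r ^ 2) •
    (r * omg q r d z s t / ((q - q⁻¹) * (q ^ 2 - (q ^ 2)⁻¹))) • w := by
    rw [← smul_add, ← eY]
  rw [eZ, eZ] at e
  simp only [map_add, map_smul, map_sub] at e
  rw [e, h.gen.q_add]
  generalize omg q r d z s t = ω2
  generalize omg q r d s t z = ω1
  generalize q ^ 2 - (q ^ 2)⁻¹ = B at *
  generalize hC : q - q⁻¹ = C at *
  match_scalars <;> field_simp
  · ring
  · rw [← hC]
    field_simp
    ring
  · ring

theorem Triple.relZX (h : Triple q r d s t z X Y Z) : AWRel q r (omg q r d z s t) Z X := by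
  have hq := h.gen.q0
  have hr := h.gen.r0
  have h1 := h.gen.q2_sub_ne
  have h2 := h.gen.q_sub_ne
  refine .of_apply (η := (q + q⁻¹) / r * omg q r d s t z) fun w => ?_
  have eZ : Z w = _ := (LinearMap.congr_fun h.eqZ w).trans (third_apply _ _ _ _)
  have eY : ∀ w, Y w = _ := fun w => (LinearMap.congr_fun h.eqY w).trans (third_apply _ _ _ _)
  have e : (-(q ^ 2 - (q ^ 2)⁻¹) ^ 2 / r ^ 2) • Z w = (-(q ^ 2 - (q ^ 2)⁻¹) ^ 2 / r ^ 2) •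
    (r / (q ^ 2 - (q ^ 2)⁻¹)) • (q • Y (X w) - q⁻¹ • X (Y w)) +
    (-(q ^ 2 - (q ^ 2)⁻¹) ^ 2 / r ^ 2) •
    (r * omg q r d s t z / ((q - q⁻¹) * (q ^ 2 - (q ^ 2)⁻¹))) • w := by
    rw [← smul_add, ← eZ]
  rw [eY, eY] at e
  simp only [map_add, map_smul, map_sub] at e
  rw [e, h.gen.q_add]
  generalize omg q r d z s t = ω2
  generalize omg q r d s t z = ω1
  generalize q ^ 2 - (q ^ 2)⁻¹ = B at *
  generalize hC : q - q⁻¹ = C at *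
  match_scalars <;> field_simp
  · ring
  · rw [← hC]
    field_simp
    ring
  · ring

/-- Two operators satisfying the Askey-Wilson relations belong to a triple. -/
theorem Triple.of_aw (hg : Gen q r d s t z)
    (h1 : qComm q⁻¹ X (qComm q X Y) = (-(q ^ 2 - (q ^ 2)⁻¹) ^ 2 / r ^ 2) • Y
      + omg q r d s t z • X + ((q + q⁻¹) / r * omg q r d z s t) • 1)
    (h2 : qComm q⁻¹ Y (qComm q Y X) = (-(q ^ 2 - (q ^ 2)⁻¹) ^ 2 / r ^ 2) • X
      + omg q r d s t z • Y + ((q + q⁻¹) / r * omg q r d t z s) • 1) :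
    Triple q r d s t z X Y (third q r (omg q r d s t z) X Y) := by
  have hq := hg.q0
  have hr := hg.r0
  have hq1 := hg.q2_sub_ne
  have hq2 := hg.q_sub_ne
  rw [hg.q_add] at h1 h2
  refine ⟨hg, rfl, ?_, ?_⟩
  · ext w
    have e := LinearMap.congr_fun h2 w
    simp only [qComm, LinearMap.add_apply, LinearMap.smul_apply, LinearMap.sub_apply,
      Module.End.mul_apply, Module.End.one_apply, map_sub, map_smul, inv_inv] at e
    rw [third_apply, third_apply, third_apply]
    simp only [map_add, map_smul, map_sub]
    generalize omg q r d t z s = ω3 at *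
    generalize omg q r d s t z = ω1 at *
    generalize q ^ 2 - (q ^ 2)⁻¹ = B at *
    generalize hC : q - q⁻¹ = C at *
    -- The relation is solved for its term ρ X, where ρ = -B²/r² is invertible; the inner
    -- q-commutator is the third operator up to scalars.
    have e2 : X w = (r ^ 2 / B ^ 2) • (ω1 • Y w + (B / C / r * ω3) • w -
        (q⁻¹ • (q • Y (Y (X w)) - q⁻¹ • Y (X (Y w))) - q • (q • Y (X (Y w)) - q⁻¹ • X (Y (Y w))))) := by
      rw [e]
      match_scalars <;> field_simp <;> simp
    conv_lhs => rw [e2]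
    match_scalars <;> field_simp
    · rw [← hC]
      field_simp
    · ring
  · ext w
    have e := LinearMap.congr_fun h1 w
    simp only [qComm, LinearMap.add_apply, LinearMap.smul_apply, LinearMap.sub_apply,
      Module.End.mul_apply, Module.End.one_apply, map_sub, map_smul, inv_inv] at e
    rw [third_apply, third_apply, third_apply]
    simp only [map_add, map_smul, map_sub]
    generalize omg q r d z s t = ω3 at *
    generalize omg q r d s t z = ω1 at *
    generalize q ^ 2 - (q ^ 2)⁻¹ = B at *
    generalize hC : q - q⁻¹ = C at *
    have e2 : Y w = (r ^ 2 / B ^ 2) • (ω1 • X w + (B / C / r * ω3) • w -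
        (q⁻¹ • (q • X (X (Y w)) - q⁻¹ • X (Y (X w))) - q • (q • X (Y (X w)) - q⁻¹ • Y (X (X w))))) := by
      rw [e]
      match_scalars <;> field_simp <;> simp
    conv_lhs => rw [e2]
    match_scalars <;> field_simp
    · rw [← hC]
      field_simp
    · ring

/-! ### Irreducibility and existence of eigenbases -/

/-- A subspace invariant under a diagonalizable operator contains the eigencomponents of its
vectors. -/
theorem component_mem (hX : Eig X v (th q r s)) (hg : Gen q r d s t z) {W : Submodule ℂ V}
    (hW : ∀ w ∈ W, X w ∈ W) {w : V} (hw : w ∈ W) {i : ℕ} (hi : i ≤ d) (h0 : cn v i w ≠ 0) :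
    vn v i ∈ W := by
  -- The product of X - θ_j over j in S preserves W. With S consisting of all indices but i, only
  -- the i-th component survives.
  have key : ∀ S : Finset ℕ, ∃ w' ∈ W, ∀ k,
      cn v k w' = (∏ j ∈ S, (th q r s k - th q r s j)) * cn v k w := by
    intro S
    induction S using Finset.induction_on with
    | empty => exact ⟨w, hw, fun k => by simp⟩
    | insert j S hj ih =>
      obtain ⟨w', hw', e⟩ := ih
      refine ⟨X w' - th q r s j • w', W.sub_mem (hW _ hw') (W.smul_mem _ hw'), fun k => ?_⟩
      rw [map_sub, hX.cn, map_smul, e, prod_insert hj, smul_eq_mul]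
      ring
  obtain ⟨w', hw', e⟩ := key ((range (d + 1)).erase i)
  have hne : cn v i w' ≠ 0 := by
    rw [e]
    refine mul_ne_zero (prod_ne_zero_iff.mpr fun j hj => ?_) h0
    simp at hj
    exact hg.swap.th_sub_ne (Ne.symm hj.1) (by omega)
  have : w' = cn v i w' • vn v i := by
    apply cn_ext v
    intro k hk
    rw [map_smul, cn_vn v hk]
    split_ifs with hki
    · subst hki; simp
    · rw [e, prod_eq_zero (i := k) (by simp; omega) (by simp)]; simp
  rw [this] at hw'
  exact (W.smul_mem_iff hne).mp hw'

/-- From one eigenvector of X in W, the nonzero superdiagonal entries of Y lead down to v_0 and the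
nonzero subdiagonal entries lead up to every v_j. -/
theorem eq_top_of_invariant (hX : Eig X v (th q r s)) (hg : Gen q r d s t z)
    (hlow : ∀ n < d, cn v (n + 1) (Y (vn v n)) ≠ 0) (hup : ∀ n < d, cn v n (Y (vn v (n + 1))) ≠ 0)
    {W : Submodule ℂ V} (hWX : ∀ w ∈ W, X w ∈ W) (hWY : ∀ w ∈ W, Y w ∈ W) {w : V} (hw : w ∈ W)
    (h0 : w ≠ 0) : W = ⊤ := by
  obtain ⟨i, hi, hwi⟩ : ∃ i ≤ d, cn v i w ≠ 0 := by
    by_contra! hc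
    exact h0 (cn_ext v fun i hi => by rw [hc i hi, map_zero])
  have hi' := component_mem hX hg hWX hw hi hwi
  have hzero : vn v 0 ∈ W := by
    clear hwi
    induction i with
    | zero => exact hi'
    | succ i ih =>
      exact ih (by omega) (component_mem hX hg hWX (hWY _ hi') (by omega) (hup i (by omega)))
  have hall : ∀ j ≤ d, vn v j ∈ W := by
    intro j
    induction j with
    | zero => exact fun _ => hzero
    | succ j ih =>
      exact fun hj => component_mem hX hg hWX (hWY _ (ih (by omega))) hj (hlow j (by omega))
  rw [eq_top_iff]
  intro y _
  rw [← sum_cn v y]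
  exact W.sum_mem fun j hj => W.smul_mem _ (hall j (by simp at hj; omega))

/-- The matrix of `Y` in an eigenbasis of the third operator is irreducible. -/
theorem Triple.sub_ne (h : Triple q r d s t z X Y Z) (hX : Eig X v (th q r s))
    (hlow : ∀ n < d, cn v (n + 1) (Y (vn v n)) ≠ 0) (hup : ∀ n < d, cn v n (Y (vn v (n + 1))) ≠ 0)
    (hZ : Eig Z x (th q r z)) {N : ℕ} (hN : N < d) : sub Y x N ≠ 0 := by
  intro hc
  have htri : Tri Y x := h.rot.rot.relZX.tri h.gen.rot hZ
  -- If the entry vanished, the span of x_0, …, x_N would be stable under Y and Z, hence under X,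
  -- which is an expression in Y and Z. This contradicts irreducibility since N < d.
  let W : Submodule ℂ V :=
    { carrier := {w | ∀ i, N < i → cn x i w = 0}
      add_mem' := fun {a b} ha hb i hi => by rw [map_add, ha i hi, hb i hi, add_zero]
      zero_mem' := fun i _ => map_zero _
      smul_mem' := fun c a ha i hi => by rw [map_smul, ha i hi, smul_zero] }
  have hWY : ∀ w ∈ W, Y w ∈ W := by
    intro w hw i hi
    rcases Nat.eq_or_lt_of_le hi with rfl | hi
    · rw [Nat.succ_eq_add_one, htri.cn_succ hw, hc, zero_mul]
    · exact htri.cn_gt hw hi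
  have hWZ : ∀ w ∈ W, Z w ∈ W := by
    intro w hw i hi
    rw [hZ.cn, hw i hi, mul_zero]
  have hWX : ∀ w ∈ W, X w ∈ W := by
    intro w hw
    rw [h.eqX, third_apply]
    exact W.add_mem (W.smul_mem _ (W.sub_mem (W.smul_mem _ (hWZ _ (hWY _ hw)))
      (W.smul_mem _ (hWY _ (hWZ _ hw))))) (W.smul_mem _ hw)
  have h0 : vn x 0 ∈ W := fun i hi => cn_vn_zero_gt x i (by omega)
  have hne : vn x 0 ≠ 0 := by
    intro h0
    have := cn_vn x (Nat.zero_le d) 0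
    rw [h0] at this
    simp at this
  have htop := eq_top_of_invariant hX h.gen hlow hup hWX hWY h0 hne
  have hmem : vn x (N + 1) ∈ W := by rw [htop]; trivial
  have := hmem (N + 1) (by omega)
  rw [cn_vn x (by omega)] at this
  simp at this

/-- Z is bidiagonal on the string of v_0, so an eigenvector for c_N is built from the N-th string
vector by successive corrections. Each pushes the error one step along the string, and the error
dies at d + 1. The leading v-coordinate keeps the vector nonzero. -/
theorem exists_eigenvector {c : ℕ → ℂ} (hZ : Tri Z v) (hs : ∀ n < d, sub Z v n ≠ 0)
    (hc : ∀ i j, i ≤ d → j ≤ d → i ≠ j → c i - c j ≠ 0) (h0 : str Z c (vn v 0) (d + 1) = 0)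
    {N : ℕ} (hN : N ≤ d) : ∃ y, y ≠ 0 ∧ Z y = c N • y := by
  have key : ∀ k, N + k ≤ d → ∃ (y : V) (a : ℂ), a ≠ 0 ∧
      Z y = c N • y + a • str Z c (vn v 0) (N + k + 1) ∧ (∀ i, N + k < i → cn v i y = 0) ∧
      cn v (N + k) y ≠ 0 := by
    intro k
    induction k with
    | zero =>
      intro _
      refine ⟨str Z c (vn v 0) N, 1, one_ne_zero, ?_, fun i hi => hZ.cn_spl_gt c hi, ?_⟩
      · rw [one_smul, apply_str, add_zero]
      · rw [add_zero, hZ.cn_spl]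
        exact prod_ne_zero_iff.mpr fun k hk => hs k (by simp at hk; omega)
    | succ k ih =>
      intro hk
      obtain ⟨y, a, ha, e, hgt, -⟩ := ih (by omega)
      have hne := hc N (N + k + 1) hN hk (by omega)
      have ha' : a / (c N - c (N + k + 1)) ≠ 0 := div_ne_zero ha hne
      refine ⟨y + (a / (c N - c (N + k + 1))) • str Z c (vn v 0) (N + k + 1),
        a / (c N - c (N + k + 1)), ha', ?_, ?_, ?_⟩
      · rw [map_add, map_smul, apply_str, e, show N + (k + 1) + 1 = N + k + 1 + 1 by ring]
        match_scalars <;> field_simp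
        ring
      · intro i hi
        rw [map_add, map_smul, hgt i (by omega), hZ.cn_spl_gt c (by omega)]
        simp
      · rw [map_add, map_smul, hgt _ (by omega), ← add_assoc, hZ.cn_spl, zero_add]
        exact mul_ne_zero ha' (prod_ne_zero_iff.mpr fun k hk => hs k (by simp at hk; omega))
  obtain ⟨y, a, -, e, -, hne⟩ := key (d - N) (by omega)
  refine ⟨y, ?_, ?_⟩
  · rintro rfl
    exact hne (map_zero _)
  · rw [e, show N + (d - N) + 1 = d + 1 by omega, h0, smul_zero, add_zero]

theorem exists_eigenbasis (v : Module.Basis (Fin (d + 1)) ℂ V) {c : ℕ → ℂ}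
    (hc : ∀ i j, i ≤ d → j ≤ d → i ≠ j → c i - c j ≠ 0)
    (h : ∀ N ≤ d, ∃ y, y ≠ 0 ∧ Z y = c N • y) :
    ∃ x : Module.Basis (Fin (d + 1)) ℂ V, Eig Z x c := by
  choose! y hy0 hy using h
  have hlin : LinearIndependent ℂ (fun i : Fin (d + 1) => y i) := by
    refine Module.End.eigenvectors_linearIndependent' Z (fun i : Fin (d + 1) => c i) ?_ _ ?_
    · intro i j hij
      by_contra hne
      exact hc i j (by omega) (by omega) (by simpa [Fin.ext_iff] using hne) (sub_eq_zero.mpr hij)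
    · intro i
      exact ⟨Module.End.mem_eigenspace_iff.mpr (hy i (by omega)), hy0 i (by omega)⟩
  have hcard : Fintype.card (Fin (d + 1)) = Module.finrank ℂ V := by
    rw [Module.finrank_eq_card_basis v]
  refine ⟨basisOfLinearIndependentOfCardEqFinrank hlin hcard, fun i => ?_⟩
  rw [coe_basisOfLinearIndependentOfCardEqFinrank]
  exact hy i (by omega)

/-- Rescaling an eigenbasis to prescribe the subdiagonal entries of `Y`. -/
theorem exists_rescale {c : ℕ → ℂ} (hv : Eig X v c) (hs : ∀ n < d, sub Y v n ≠ 0) {τ : ℕ → ℂ}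
    (hτ : ∀ n < d, τ n ≠ 0) {e : ℂ} (he : e ≠ 0) :
    ∃ v' : Module.Basis (Fin (d + 1)) ℂ V, Eig X v' c ∧ (∀ n < d, sub Y v' n = τ n) ∧
      vn v' 0 = e • vn v 0 := by
  -- Scaling v_i by λ_i multiplies the n-th subdiagonal entry by λ_n/λ_{n+1}; requiring the result
  -- to be τ_n fixes all λ_i from λ_0 = e.
  have hu : ∀ i : Fin (d + 1), IsUnit (e * ∏ k ∈ range i, (sub Y v k / τ k)) := fun i =>
    isUnit_iff_ne_zero.mpr (mul_ne_zero he (prod_ne_zero_iff.mpr fun k hk =>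
      div_ne_zero (hs k (by simp at hk; omega)) (hτ k (by simp at hk; omega))))
  have hvn : ∀ i ≤ d, vn (v.isUnitSMul hu) i =
      (e * ∏ k ∈ range i, (sub Y v k / τ k)) • vn v i := by
    intro i hi
    have := vn_fin (v.isUnitSMul hu) ⟨i, by omega⟩
    rw [Fin.val_mk] at this
    rw [this, Module.Basis.isUnitSMul_apply, ← vn_fin]
  refine ⟨v.isUnitSMul hu, ?_, ?_, ?_⟩
  · intro i
    rw [Module.Basis.isUnitSMul_apply, map_smul, hv i, smul_comm]
  · intro n hn
    have hcn : ∀ w, (e * ∏ k ∈ range (n + 1), (sub Y v k / τ k)) * cn (v.isUnitSMul hu) (n + 1) w =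
        cn v (n + 1) w := by
      intro w
      conv_rhs => rw [← sum_cn (v.isUnitSMul hu) w]
      rw [map_sum, sum_eq_single (n + 1)]
      · rw [map_smul, hvn _ hn, map_smul, cn_vn v hn]; simp; ring
      · intro j hj hne
        simp at hj
        rw [map_smul, hvn j (by omega), map_smul, cn_vn v hn, if_neg (Ne.symm hne)]; simp
      · intro hc
        simp at hc; omega
    have hne := (hu ⟨n, by omega⟩).ne_zero
    have hne' := (hu ⟨n + 1, by omega⟩).ne_zero
    have hsn := hs n hn
    have hτn := hτ n hn
    apply mul_left_cancel₀ hne'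
    simp only
    rw [sub, hcn, hvn n hn.le, map_smul, map_smul, prod_range_succ, smul_eq_mul,
      show cn v (n + 1) (Y (vn v n)) = sub Y v n from rfl]
    field_simp
  · rw [hvn 0 (Nat.zero_le d)]
    simp

end Triples

end LeonardBethe

namespace LeonardBethe

open Finset

variable {q r : ℂ} {d : ℕ} {s t z : ℂ}

/-! ### Product formulas -/

theorem prod_shift_double (f : ℕ → ℂ) (M : ℕ) :
    (∏ j ∈ range (M + 1), f (M + 1 + j)) * f M =
      (∏ j ∈ range M, f (M + j)) * f (2 * M) * f (2 * M + 1) := by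
  have h1 : ∏ j ∈ range (M + 2), f (M + j) = (∏ j ∈ range (M + 1), f (M + 1 + j)) * f M := by
    rw [prod_range_succ']
    congr 1
    exact prod_congr rfl fun j _ => by rw [show M + (j + 1) = M + 1 + j by ring]
  rw [← h1, prod_range_succ, prod_range_succ, show M + M = 2 * M by ring,
    show M + (M + 1) = 2 * M + 1 by ring]

theorem prod_shift_tail (f : ℕ → ℂ) (m n : ℕ) :
    (∏ j ∈ range n, f (m + 2 + j)) * (f m * f (m + 1)) =
      (∏ j ∈ range (n + 1), f (m + j)) * f (m + 1 + n) := by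
  have h1 : ∏ j ∈ range (n + 2), f (m + j) =
      (∏ j ∈ range n, f (m + 2 + j)) * (f m * f (m + 1)) := by
    rw [prod_range_succ', prod_range_succ', mul_assoc, mul_comm (f _) (f (m + 0))]
    congr 1
    exact prod_congr rfl fun j _ => by rw [show m + (j + 1 + 1) = m + 2 + j by ring]
  rw [← h1, prod_range_succ, show m + (n + 1) = m + 1 + n by ring]

theorem Gen.s_ne (h : Gen q r d s t z) {M : ℕ} (hM : M ≤ 2 * d) : s ^ 2 * (q ^ 2) ^ M - 1 ≠ 0 :=
  fun hc => h.hs M hM (by linear_combination -hc)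

/-- By `th_sub_th` each difference is (q^{2i} - q^{2j}) f(i + j). Raising M shifts the arguments of
f, so all but three of its values cancel. -/
theorem Gen.prod_lower (h : Gen q r d s t z) {M : ℕ} (hM : M + 1 ≤ d) :
    ∏ j ∈ range (M + 1), (th q r s (M + 1) - th q r s j) =
    (∏ j ∈ range M, (th q r s M - th q r s j)) *
      (((q ^ 2) ^ (M + 1) - 1) * (s ^ 2 * ((q ^ 2) ^ M) ^ 2 - 1) *
        (s ^ 2 * ((q ^ 2) ^ M) ^ 2 * q ^ 2 - 1) /
        ((s ^ 2 * (q ^ 2) ^ M - 1) * (s * r * ((q ^ 2) ^ M) ^ 2 * q ^ 2))) := by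
  have hQ := h.Q0 M
  obtain ⟨hq, hr, hs⟩ : q ≠ 0 ∧ r ≠ 0 ∧ s ≠ 0 := ⟨h.q0, h.r0, h.s0⟩
  have hsM := h.s_ne (M := M) (by omega)
  set f : ℕ → ℂ := fun i => (s ^ 2 * (q ^ 2) ^ i - 1) / (s * (q ^ 2) ^ i * r) with hf
  have e : ∀ i j, th q r s i - th q r s j = ((q ^ 2) ^ i - (q ^ 2) ^ j) * f (i + j) := by
    intro i j
    rw [th_sub_th hq hs, hf, mul_div_assoc]
  simp only [e, prod_mul_distrib]
  have e1 : ∏ j ∈ range (M + 1), ((q ^ 2) ^ (M + 1) - (q ^ 2) ^ j) =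
      (∏ j ∈ range M, ((q ^ 2) ^ M - (q ^ 2) ^ j)) * (q ^ 2) ^ M * ((q ^ 2) ^ (M + 1) - 1) := by
    rw [prod_range_succ', pow_zero]
    congr 1
    rw [show (q ^ 2) ^ M = ∏ _j ∈ range M, q ^ 2 by simp, ← prod_mul_distrib]
    exact prod_congr rfl fun j _ => by simp only [prod_const, card_range]; ring
  have e2 := prod_shift_double f M
  have hfM : f M = (s ^ 2 * (q ^ 2) ^ M - 1) / (s * (q ^ 2) ^ M * r) := rfl
  have hfM1 : f (2 * M) = (s ^ 2 * ((q ^ 2) ^ M) ^ 2 - 1) / (s * ((q ^ 2) ^ M) ^ 2 * r) := by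
    rw [hf, ← pow_mul (q ^ 2) M 2, mul_comm M 2]
  have hfM2 : f (2 * M + 1) = (s ^ 2 * ((q ^ 2) ^ M) ^ 2 * q ^ 2 - 1) /
      (s * (((q ^ 2) ^ M) ^ 2 * q ^ 2) * r) := by
    rw [hf, ← pow_mul (q ^ 2) M 2, mul_comm M 2]
    simp only [pow_succ (q ^ 2) (2 * M)]
    rw [← mul_assoc (s ^ 2)]
  have hfM0 : f M ≠ 0 := by
    rw [hfM]; exact div_ne_zero hsM (mul_ne_zero (mul_ne_zero hs hQ) hr)
  rw [e1, ← eq_div_iff hfM0] at *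
  rw [e2, hfM, hfM1, hfM2]
  generalize ∏ j ∈ range M, f (M + j) = A
  generalize ∏ j ∈ range M, ((q ^ 2) ^ M - (q ^ 2) ^ j) = B
  generalize (q ^ 2) ^ (M + 1) = y
  generalize (q ^ 2) ^ M = x at *
  field_simp

theorem Gen.prod_upper (h : Gen q r d s t z) {M : ℕ} (hM : M + 1 ≤ d) :
    ∏ k ∈ Ico (M + 1) d, (th q r s (M + 1) - th q r s (k + 1)) =
    (∏ k ∈ Ico M d, (th q r s M - th q r s (k + 1))) *
      (s * r * ((q ^ 2) ^ M) ^ 2 * q ^ 2 * (s ^ 2 * (q ^ 2) ^ M * (q ^ 2) ^ d * q ^ 2 - 1) /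
        (((q ^ 2) ^ M - (q ^ 2) ^ d) * (s ^ 2 * ((q ^ 2) ^ M) ^ 2 * q ^ 2 - 1) *
          (s ^ 2 * ((q ^ 2) ^ M) ^ 2 * q ^ 4 - 1))) := by
  have hQ := h.Q0 M
  obtain ⟨hq, hr, hs⟩ : q ≠ 0 ∧ r ≠ 0 ∧ s ≠ 0 := ⟨h.q0, h.r0, h.s0⟩
  obtain ⟨n, rfl⟩ : ∃ n, d = M + 1 + n := ⟨d - (M + 1), by omega⟩
  set f : ℕ → ℂ := fun i => (s ^ 2 * (q ^ 2) ^ i - 1) / (s * (q ^ 2) ^ i * r) with hf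
  have e : ∀ i j, th q r s i - th q r s j = ((q ^ 2) ^ i - (q ^ 2) ^ j) * f (i + j) := by
    intro i j
    rw [th_sub_th hq hs, hf, mul_div_assoc]
  simp only [e, prod_mul_distrib, prod_Ico_eq_prod_range, show M + 1 + n - (M + 1) = n by omega,
    show M + 1 + n - M = n + 1 by omega]
  have hne := h.pow_sub_ne (i := M) (j := M + 1 + n) (by omega)
  have e1 : (∏ k ∈ range n, ((q ^ 2) ^ (M + 1) - (q ^ 2) ^ (M + 1 + k + 1))) =
      (∏ k ∈ range (n + 1), ((q ^ 2) ^ M - (q ^ 2) ^ (M + k + 1))) * (q ^ 2) ^ n /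
        ((q ^ 2) ^ M - (q ^ 2) ^ (M + 1 + n)) := by
    rw [eq_div_iff hne, prod_range_succ, show M + n + 1 = M + 1 + n by ring,
      mul_right_comm]
    congr 1
    rw [show (q ^ 2) ^ n = ∏ _j ∈ range n, q ^ 2 by simp, ← prod_mul_distrib]
    exact prod_congr rfl fun j _ => by ring
  have e2 : (∏ j ∈ range n, f (2 * M + 1 + 2 + j)) * (f (2 * M + 1) * f (2 * M + 1 + 1)) =
      (∏ j ∈ range (n + 1), f (2 * M + 1 + j)) * f (2 * M + 1 + 1 + n) :=
    prod_shift_tail f (2 * M + 1) n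
  have hfM1 : f (2 * M + 1) = (s ^ 2 * ((q ^ 2) ^ M) ^ 2 * q ^ 2 - 1) /
      (s * (((q ^ 2) ^ M) ^ 2 * q ^ 2) * r) := by
    simp only [hf]
    rw [show (q ^ 2) ^ (2 * M + 1) = ((q ^ 2) ^ M) ^ 2 * q ^ 2 by ring]
    ring_nf
  have hfM2 : f (2 * M + 1 + 1) = (s ^ 2 * ((q ^ 2) ^ M) ^ 2 * q ^ 4 - 1) /
      (s * (((q ^ 2) ^ M) ^ 2 * q ^ 4) * r) := by
    simp only [hf]
    rw [show (q ^ 2) ^ (2 * M + 1 + 1) = ((q ^ 2) ^ M) ^ 2 * q ^ 4 by ring]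
    ring_nf
  have hfM3 : f (2 * M + 1 + 1 + n) = (s ^ 2 * (q ^ 2) ^ M * (q ^ 2) ^ (M + 1 + n) * q ^ 2 - 1) /
      (s * ((q ^ 2) ^ M * (q ^ 2) ^ (M + 1 + n) * q ^ 2) * r) := by
    simp only [hf]
    rw [show (q ^ 2) ^ (2 * M + 1 + 1 + n) = (q ^ 2) ^ M * (q ^ 2) ^ (M + 1 + n) * q ^ 2 by ring]
    ring_nf
  have h1 : s ^ 2 * ((q ^ 2) ^ M) ^ 2 * q ^ 2 - 1 ≠ 0 := by
    have := h.s_ne (M := 2 * M + 1) (by omega)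
    convert this using 1
    ring
  have h2 : s ^ 2 * ((q ^ 2) ^ M) ^ 2 * q ^ 4 - 1 ≠ 0 := by
    have := h.s_ne (M := 2 * M + 1 + 1) (by omega)
    convert this using 1
    ring
  have hff : f (2 * M + 1) * f (2 * M + 1 + 1) ≠ 0 := by
    rw [hfM1, hfM2]
    have := pow_ne_zero 2 hq
    have := pow_ne_zero 4 hq
    have := pow_ne_zero 2 hQ
    simp [*]
  rw [e1]
  have e3 : ∏ k ∈ range n, f (M + 1 + (M + 1 + k + 1)) =
      (∏ j ∈ range (n + 1), f (2 * M + 1 + j)) * f (2 * M + 1 + 1 + n) /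
        (f (2 * M + 1) * f (2 * M + 1 + 1)) := by
    rw [← e2, mul_div_assoc, div_self hff, mul_one]
    exact prod_congr rfl fun j _ => by rw [show M + 1 + (M + 1 + j + 1) = 2 * M + 1 + 2 + j by ring]
  have e4 : ∏ k ∈ range (n + 1), f (M + (M + k + 1)) = ∏ j ∈ range (n + 1), f (2 * M + 1 + j) :=
    prod_congr rfl fun j _ => by rw [show M + (M + j + 1) = 2 * M + 1 + j by ring]
  rw [e3, e4, hfM1, hfM2, hfM3]
  have e5 : (q ^ 2) ^ (M + 1 + n) = (q ^ 2) ^ M * q ^ 2 * (q ^ 2) ^ n := by ring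
  have hn := h.Q0 n
  rw [e5] at hne ⊢
  generalize ∏ j ∈ range (n + 1), f (2 * M + 1 + j) = A
  generalize ∏ k ∈ range (n + 1), ((q ^ 2) ^ M - (q ^ 2) ^ (M + k + 1)) = B
  generalize (q ^ 2) ^ M = x at *
  generalize (q ^ 2) ^ n = y at *
  generalize hE : (s ^ 2 * x ^ 2 * q ^ 2 - 1) = E at *
  generalize hF : (s ^ 2 * x ^ 2 * q ^ 4 - 1) = F at *
  generalize hG : (x - x * q ^ 2 * y) = G at *
  generalize (s ^ 2 * x * (x * q ^ 2 * y) * q ^ 2 - 1) = H at *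
  field_simp

/-- The recursion satisfied by the overlaps. -/
theorem Gen.ovl_succ (h : Gen q r d s t z) {M : ℕ} (hM : M + 1 ≤ d) :
    ovl q r d s t z (M + 1) = ovl q r d s t z M * (((q ^ 2) ^ M - (q ^ 2) ^ d) *
      (s ^ 2 * ((q ^ 2) ^ M) ^ 2 * q ^ 2 - 1) * (s ^ 2 * ((q ^ 2) ^ M) ^ 2 * q ^ 4 - 1) /
      (s * r * ((q ^ 2) ^ M) ^ 2 * q ^ 2 * (s ^ 2 * (q ^ 2) ^ M * (q ^ 2) ^ d * q ^ 2 - 1)) /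
      ph q r d s (t * (q ^ 2) ^ d)⁻¹ z (M + 1)) := by
  have h1 := h.rev.ph_ne (n := M + 1) (by omega) hM
  have hup := h.prod_upper hM
  have hne : ∀ K, ∏ k ∈ Ico K d, (th q r s K - th q r s (k + 1)) ≠ 0 := fun K =>
    prod_ne_zero_iff.mpr fun k hk => by
      simp at hk
      exact h.swap.th_sub_ne (by omega) (by omega)
  have h2 := hne M
  have h3 := hne (M + 1)
  have hP := h.prod_th_ne
  unfold ovl
  rw [prod_div_distrib, prod_div_distrib, prod_eq_prod_Ico_succ_bot (show M < d by omega)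
    (fun k => ph q r d s (t * (q ^ 2) ^ d)⁻¹ z (k + 1))]
  rw [hup] at h3 ⊢
  have h4 := right_ne_zero_of_mul h3
  obtain ⟨h5, h6⟩ := div_ne_zero_iff.mp h4
  generalize ∏ k ∈ Ico (M + 1) d, ph q r d s (t * (q ^ 2) ^ d)⁻¹ z (k + 1) = A
  generalize ∏ k ∈ Ico M d, (th q r s M - th q r s (k + 1)) = B at *
  generalize ∏ k ∈ range d, (th q r t 0 - th q r t (k + 1)) = C at *
  generalize ph q r d s (t * (q ^ 2) ^ d)⁻¹ z (M + 1) = E at *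
  generalize (s * r * ((q ^ 2) ^ M) ^ 2 * q ^ 2 *
    (s ^ 2 * (q ^ 2) ^ M * (q ^ 2) ^ d * q ^ 2 - 1)) = F at *
  generalize ((q ^ 2) ^ M - (q ^ 2) ^ d) *
      (s ^ 2 * ((q ^ 2) ^ M) ^ 2 * q ^ 2 - 1) * (s ^ 2 * ((q ^ 2) ^ M) ^ 2 * q ^ 4 - 1) = G at *
  field_simp

end LeonardBethe

/-! ### The q-Racah weight as a normalized overlap -/

namespace LeonardBethe

open Finset

variable {q r : ℂ} {d : ℕ} {s t z : ℂ}

/-- The weight of the `q`-Racah polynomials, in multiplicative parameters. -/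
noncomputable def kk (q : ℂ) (d : ℕ) (s t z : ℂ) (M : ℕ) : ℂ :=
  (poch q (-(s * t * z * (q ^ 2) ^ d * q)) M * poch q (-(s * t / z * q)) M * poch q (s ^ 2) M
    * poch q ((q ^ 2) ^ d)⁻¹ M) /
  (poch q (q ^ 2) M * poch q (-(s * z / t * q)) M * poch q (-(s / (t * z) * q / (q ^ 2) ^ d)) M
    * poch q (s ^ 2 * (q ^ 2) ^ d * q ^ 2) M)
  * ((1 - s ^ 2 * ((q ^ 2) ^ M) ^ 2) / ((t ^ 2) ^ M * (1 - s ^ 2)))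

/-- The normalization constant of the `q`-Racah weight, in multiplicative parameters. -/
noncomputable def nn (q : ℂ) (d : ℕ) (s t z : ℂ) : ℂ :=
  (poch q (t ^ 2 * q ^ 2) d * poch q (s ^ 2 * q ^ 2) d) /
  ((-(s * t * z * (q ^ 2) ^ d * q)) ^ d
    * (poch q (-(t / (s * z) * q / (q ^ 2) ^ d)) d
      * poch q (-(s / (t * z) * q / (q ^ 2) ^ d)) d))

theorem poch_succ (q x : ℂ) (n : ℕ) : poch q x (n + 1) = poch q x n * (1 - x * (q ^ 2) ^ n) :=
  prod_range_succ _ _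

theorem poch_zero (q x : ℂ) : poch q x 0 = 1 := rfl

theorem Gen.poch_ne1 (h : Gen q r d s t z) {M : ℕ} (hM : M ≤ d) :
    poch q (-(s * z / t * q)) M ≠ 0 :=
  prod_ne_zero_iff.mpr fun k hk => by
    simp at hk
    have := h.kt (k + 1) (by omega) (by omega)
    have hq := h.q0
    convert this using 1
    rw [pow_succ (q ^ 2) k]
    field_simp
    ring

theorem Gen.poch_ne2 (h : Gen q r d s t z) {M : ℕ} (hM : M ≤ d) :
    poch q (-(s / (t * z) * q / (q ^ 2) ^ d)) M ≠ 0 :=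
  prod_ne_zero_iff.mpr fun k hk => by
    simp at hk
    have := h.rev.kz (k + 1) (by omega) (by omega)
    obtain ⟨hq, ht, hz, hD⟩ : q ≠ 0 ∧ t ≠ 0 ∧ z ≠ 0 ∧ (q ^ 2) ^ d ≠ 0 := ⟨h.q0, h.t0, h.z0, h.Q0 d⟩
    convert this using 1
    rw [pow_succ (q ^ 2) k]
    field_simp
    ring

theorem Gen.poch_ne3 (h : Gen q r d s t z) {M : ℕ} (hM : M ≤ d) :
    poch q (s ^ 2 * (q ^ 2) ^ d * q ^ 2) M ≠ 0 :=
  prod_ne_zero_iff.mpr fun k hk => by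
    simp at hk
    have := h.hs (d + k + 1) (by omega)
    convert this using 1
    ring

theorem Gen.poch_ne4 (h : Gen q r d s t z) (M : ℕ) : poch q (q ^ 2) M ≠ 0 :=
  prod_ne_zero_iff.mpr fun k _ => by
    rw [← pow_succ']
    exact h.qfac_ne k

theorem ph_succ_eq (hq : q ≠ 0) (M : ℕ) :
    ph q r d s t z (M + 1) = (1 - q ^ 2 * (q ^ 2) ^ M) * (1 - ((q ^ 2) ^ d)⁻¹ * (q ^ 2) ^ M)
      * (1 - -(s * t / z * q) * (q ^ 2) ^ M) * (1 - -(s * t * z * (q ^ 2) ^ d * q) * (q ^ 2) ^ M) /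
      (r ^ 2 * s * t * ((q ^ 2) ^ M) ^ 2 * q ^ 2) := by
  unfold ph
  rw [pow_succ (q ^ 2) M, pow_succ (q ^ 2) d]
  have hx : (q ^ 2) ^ M ≠ 0 := pow_ne_zero _ (pow_ne_zero _ hq)
  have hy : (q ^ 2) ^ d ≠ 0 := pow_ne_zero _ (pow_ne_zero _ hq)
  generalize (q ^ 2) ^ M = x at *
  generalize (q ^ 2) ^ d = y at *
  have e1 : x * q ^ 2 / (y * q ^ 2) = y⁻¹ * x := by field_simp
  have e2 : s * t / z * (x * q ^ 2) / q = s * t / z * q * x := by field_simp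
  have e3 : s * t * z * y * (x * q ^ 2) / q = s * t * z * y * q * x := by field_simp
  rw [e1, e2, e3]
  field_simp
  ring

theorem ph_rev_succ_eq (hq : q ≠ 0) (ht : t ≠ 0) (M : ℕ) :
    ph q r d s (t * (q ^ 2) ^ d)⁻¹ z (M + 1) = (1 - q ^ 2 * (q ^ 2) ^ M)
      * (1 - ((q ^ 2) ^ d)⁻¹ * (q ^ 2) ^ M)
      * (1 - -(s / (t * z) * q / (q ^ 2) ^ d) * (q ^ 2) ^ M) * (1 - -(s * z / t * q) * (q ^ 2) ^ M) *
      (t * (q ^ 2) ^ d) / (r ^ 2 * s * ((q ^ 2) ^ M) ^ 2 * q ^ 2) := by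
  rw [ph_succ_eq hq]
  have hx : (q ^ 2) ^ M ≠ 0 := pow_ne_zero _ (pow_ne_zero _ hq)
  have hy : (q ^ 2) ^ d ≠ 0 := pow_ne_zero _ (pow_ne_zero _ hq)
  generalize (q ^ 2) ^ M = x at *
  generalize (q ^ 2) ^ d = y at *
  have e1 : s * (t * y)⁻¹ / z * q = s / (t * z) * q / y := by field_simp
  have e2 : s * (t * y)⁻¹ * z * y * q = s * z / t * q := by field_simp
  rw [e1, e2]
  field_simp

/-- The weight as a ratio of overlaps. -/
theorem Gen.ovl_eq_kk (h : Gen q r d s t z) {M : ℕ} (hM : M ≤ d) :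
    ovl q r d s t z M = ovl q r d s t z 0 * (kk q d s t z M *
      ((∏ j ∈ range M, (th q r s M - th q r s j)) / ∏ j ∈ range M, ph q r d s t z (j + 1))) := by
  have hs1 : 1 - s ^ 2 ≠ 0 := by simpa using h.hs 0 (by omega)
  induction M with
  | zero => simp [kk, poch_zero, hs1]
  | succ M ih =>
    rw [h.ovl_succ hM, ih (by omega), h.prod_lower hM, prod_range_succ _ M]
    have hE : ∏ j ∈ range M, ph q r d s t z (j + 1) ≠ 0 :=
      prod_ne_zero_iff.mpr fun k hk => by
        simp at hk
        exact h.ph_ne (by omega) (by omega)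
    obtain ⟨hq, hr, hs, ht, hz⟩ : q ≠ 0 ∧ r ≠ 0 ∧ s ≠ 0 ∧ t ≠ 0 ∧ z ≠ 0 :=
      ⟨h.q0, h.r0, h.s0, h.t0, h.z0⟩
    have hD := h.Q0 d
    have hQ := h.Q0 M
    have a1 := h.poch_ne1 (M := M + 1) hM
    have a2 := h.poch_ne2 (M := M + 1) hM
    have a3 := h.poch_ne3 (M := M + 1) hM
    have a4 := h.poch_ne4 (M + 1)
    have a5 := h.ph_ne (n := M + 1) (by omega) hM
    have a6 := h.rev.ph_ne (n := M + 1) (by omega) hM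
    have a7 := h.s_ne (M := M) (by omega)
    have a8 : s ^ 2 * ((q ^ 2) ^ M) ^ 2 * q ^ 2 - 1 ≠ 0 := by
      have := h.s_ne (M := 2 * M + 1) (by omega)
      convert this using 1
      ring
    have a9 : s ^ 2 * ((q ^ 2) ^ M) ^ 2 - 1 ≠ 0 := by
      have := h.s_ne (M := 2 * M) (by omega)
      convert this using 1
      ring
    unfold kk
    simp only [poch_succ, mul_ne_zero_iff] at a1 a2 a3 a4 ⊢
    obtain ⟨b1, c1⟩ := a1
    obtain ⟨b2, c2⟩ := a2
    obtain ⟨b3, c3⟩ := a3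
    obtain ⟨b4, c4⟩ := a4
    generalize ovl q r d s t z 0 = O
    generalize ∏ j ∈ range M, (th q r s M - th q r s j) = L
    generalize ∏ j ∈ range M, ph q r d s t z (j + 1) = E at *
    generalize poch q (-(s * z / t * q)) M = P1 at *
    generalize poch q (-(s / (t * z) * q / (q ^ 2) ^ d)) M = P2 at *
    generalize poch q (s ^ 2 * (q ^ 2) ^ d * q ^ 2) M = P3 at *
    generalize poch q (q ^ 2) M = P4 at *
    generalize poch q (-(s * t * z * (q ^ 2) ^ d * q)) M = P5
    generalize poch q (-(s * t / z * q)) M = P6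
    generalize poch q (s ^ 2) M = P7
    generalize poch q ((q ^ 2) ^ d)⁻¹ M = P8
    have p1 : ph q r d s t z (M + 1) = (1 - q ^ 2 * (q ^ 2) ^ M) * (1 - ((q ^ 2) ^ d)⁻¹ * (q ^ 2) ^ M)
        * (1 - -(s * t / z * q) * (q ^ 2) ^ M) * (1 - -(s * t * z * (q ^ 2) ^ d * q) * (q ^ 2) ^ M) /
        (r ^ 2 * s * t * ((q ^ 2) ^ M) ^ 2 * q ^ 2) := ph_succ_eq h.q0 M
    have p2 : ph q r d s (t * (q ^ 2) ^ d)⁻¹ z (M + 1) = (1 - q ^ 2 * (q ^ 2) ^ M)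
        * (1 - ((q ^ 2) ^ d)⁻¹ * (q ^ 2) ^ M)
        * (1 - -(s / (t * z) * q / (q ^ 2) ^ d) * (q ^ 2) ^ M) * (1 - -(s * z / t * q) * (q ^ 2) ^ M) *
        (t * (q ^ 2) ^ d) / (r ^ 2 * s * ((q ^ 2) ^ M) ^ 2 * q ^ 2) := ph_rev_succ_eq h.q0 ht M
    rw [p1] at a5
    rw [p2] at a6
    rw [p1, p2]
    have e1 : (q ^ 2) ^ M - (q ^ 2) ^ d = -(q ^ 2) ^ d * (1 - ((q ^ 2) ^ d)⁻¹ * (q ^ 2) ^ M) := by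
      field_simp; ring
    have e2 : (q ^ 2) ^ (M + 1) - 1 = -(1 - q ^ 2 * (q ^ 2) ^ M) := by ring
    have e3 : s ^ 2 * (q ^ 2) ^ M * (q ^ 2) ^ d * q ^ 2 - 1 =
      -(1 - s ^ 2 * (q ^ 2) ^ d * q ^ 2 * (q ^ 2) ^ M) := by ring
    have e4 : 1 - s ^ 2 * ((q ^ 2) ^ (M + 1)) ^ 2 = -(s ^ 2 * ((q ^ 2) ^ M) ^ 2 * q ^ 4 - 1) := by ring
    have e5 : 1 - s ^ 2 * (q ^ 2) ^ M = -(s ^ 2 * (q ^ 2) ^ M - 1) := by ring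
    have e6 : 1 - s ^ 2 * ((q ^ 2) ^ M) ^ 2 = -(s ^ 2 * ((q ^ 2) ^ M) ^ 2 - 1) := by ring
    rw [e1, e2, e3, e4, e5, e6]
    have b5 := (mul_ne_zero_iff.mp (mul_ne_zero_iff.mp (mul_ne_zero_iff.mp
      (div_ne_zero_iff.mp a5).1).1).1).2
    have b6 := (mul_ne_zero_iff.mp (div_ne_zero_iff.mp a5).1).2
    have b7 := (mul_ne_zero_iff.mp (mul_ne_zero_iff.mp (div_ne_zero_iff.mp a5).1).1).2
    generalize 1 - -(s * t / z * q) * (q ^ 2) ^ M = F3 at *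
    generalize 1 - -(s * t * z * (q ^ 2) ^ d * q) * (q ^ 2) ^ M = F4 at *
    generalize 1 - -(s / (t * z) * q / (q ^ 2) ^ d) * (q ^ 2) ^ M = F5 at *
    generalize 1 - -(s * z / t * q) * (q ^ 2) ^ M = F6 at *
    generalize 1 - s ^ 2 * (q ^ 2) ^ d * q ^ 2 * (q ^ 2) ^ M = F7 at *
    generalize 1 - q ^ 2 * (q ^ 2) ^ M = F1 at *
    generalize 1 - ((q ^ 2) ^ d)⁻¹ * (q ^ 2) ^ M = F2 at *
    generalize s ^ 2 * ((q ^ 2) ^ M) ^ 2 * q ^ 4 - 1 = F8 at *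
    generalize s ^ 2 * (q ^ 2) ^ M - 1 = F9 at *
    generalize s ^ 2 * ((q ^ 2) ^ M) ^ 2 - 1 = F10 at *
    generalize s ^ 2 * ((q ^ 2) ^ M) ^ 2 * q ^ 2 - 1 = F11 at *
    generalize 1 - s ^ 2 = F12 at *
    generalize (q ^ 2) ^ M = x at *
    generalize (q ^ 2) ^ d = y at *
    rw [pow_succ (t ^ 2)]
    have := pow_ne_zero M (pow_ne_zero 2 ht)
    generalize (t ^ 2) ^ M = T at *
    clear e1 e2 e3 e4 e5 e6 p1 p2 a5 a6 ih
    field_simp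

end LeonardBethe

/-! ### Overlaps at index zero and the sequences f, h -/

namespace LeonardBethe

open Finset

variable {q r : ℂ} {d : ℕ} {s t z : ℂ}

theorem pow_reflect (hq : q ≠ 0) {k : ℕ} (hk : k < d) :
    (q ^ 2) ^ (d - 1 - k) = (q ^ 2) ^ d / (q ^ 2 * (q ^ 2) ^ k) := by
  rw [eq_div_iff (mul_ne_zero (pow_ne_zero _ hq) (pow_ne_zero _ (pow_ne_zero _ hq))),
    ← pow_succ', ← pow_add]
  congr 1; omega

theorem poch_reflect (hq : q ≠ 0) (x : ℂ) :
    poch q x d = ∏ k ∈ range d, (1 - x * ((q ^ 2) ^ d / (q ^ 2 * (q ^ 2) ^ k))) := by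
  unfold poch
  rw [← prod_range_reflect]
  exact prod_congr rfl fun k hk => by rw [pow_reflect hq (by simpa using hk)]

theorem prod_pow_eq (q : ℂ) (d : ℕ) : ∏ k ∈ range d, (q * (q ^ 2) ^ k) = q ^ d ^ 2 := by
  induction d with
  | zero => simp
  | succ d ih => rw [prod_range_succ, ih]; ring

theorem th_zero_sub (hq : q ≠ 0) (ht : t ≠ 0) (k : ℕ) : th q r t 0 - th q r t (k + 1) =
    -((1 - q ^ 2 * (q ^ 2) ^ k) * (1 - t ^ 2 * q ^ 2 * (q ^ 2) ^ k) /
      (t * (q ^ 2 * (q ^ 2) ^ k) * r)) := by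
  rw [th_sub_th hq ht, zero_add, pow_succ' (q ^ 2) k]
  ring

theorem Gen.poch_shift_ne (h : Gen q r d s t z) : poch q (s ^ 2 * q ^ 2) d ≠ 0 :=
  prod_ne_zero_iff.mpr fun k hk => by
    simp at hk
    have := h.hs (k + 1) (by omega)
    convert this using 1
    ring

theorem Gen.poch_ne5 (h : Gen q r d s t z) : poch q (-(q * s * t / z)) d ≠ 0 :=
  prod_ne_zero_iff.mpr fun k hk => by
    simp at hk
    have := h.kz (k + 1) (by omega) (by omega)
    obtain ⟨hq, hz⟩ : q ≠ 0 ∧ z ≠ 0 := ⟨h.q0, h.z0⟩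
    convert this using 1
    rw [pow_succ (q ^ 2) k]
    field_simp
    ring

/-- After reflecting k ↦ d - 1 - k in the symbols whose argument carries q^{-2d} and needs it, both
factors are products over the same range and cancel term by term. -/
theorem Gen.ovl_zero (h : Gen q r d s t z) : ovl q r d s t z 0 * nn q d s t z = 1 := by
  obtain ⟨hq, hr, hs, ht, hz⟩ : q ≠ 0 ∧ r ≠ 0 ∧ s ≠ 0 ∧ t ≠ 0 ∧ z ≠ 0 :=
    ⟨h.q0, h.r0, h.s0, h.t0, h.z0⟩
  have hD := h.Q0 d
  have e1 : ∏ k ∈ range d, (1 - ((q ^ 2) ^ d)⁻¹ * (q ^ 2) ^ k) =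
      ∏ k ∈ range d, (1 - ((q ^ 2) ^ d)⁻¹ * ((q ^ 2) ^ d / (q ^ 2 * (q ^ 2) ^ k))) :=
    poch_reflect hq _
  have e2 := poch_reflect (d := d) hq (-(t / (s * z) * q / (q ^ 2) ^ d))
  unfold ovl nn
  rw [e2, ← range_eq_Ico]
  have e3 : ∏ k ∈ range d, ph q r d s (t * (q ^ 2) ^ d)⁻¹ z (k + 1) =
    (∏ k ∈ range d, (1 - ((q ^ 2) ^ d)⁻¹ * ((q ^ 2) ^ d / (q ^ 2 * (q ^ 2) ^ k)))) *
    ∏ k ∈ range d, ((1 - q ^ 2 * (q ^ 2) ^ k)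
      * (1 - -(s / (t * z) * q / (q ^ 2) ^ d) * (q ^ 2) ^ k) * (1 - -(s * z / t * q) * (q ^ 2) ^ k) *
      (t * (q ^ 2) ^ d) / (r ^ 2 * s * ((q ^ 2) ^ k) ^ 2 * q ^ 2)) := by
    rw [← e1, ← prod_mul_distrib]
    refine prod_congr rfl fun k _ => ?_
    rw [ph_rev_succ_eq hq ht]
    ring
  rw [prod_div_distrib, e3]
  rw [show (-(s * t * z * (q ^ 2) ^ d * q)) ^ d = ∏ _k ∈ range d, (-(s * t * z * (q ^ 2) ^ d * q)) by
    simp]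
  unfold poch
  simp only [← prod_mul_distrib, ← prod_div_distrib]
  refine prod_eq_one fun k hk => ?_
  simp only [mem_range] at hk
  rw [th_zero_sub hq hs, th_zero_sub hq ht]
  have hQ := h.Q0 k
  have f1 : 1 - q ^ 2 * (q ^ 2) ^ k ≠ 0 := by rw [← pow_succ']; exact h.qfac_ne k
  have f2 : 1 - s ^ 2 * q ^ 2 * (q ^ 2) ^ k ≠ 0 := prod_ne_zero_iff.mp h.poch_shift_ne k (by simpa)
  have f3 : 1 - t ^ 2 * q ^ 2 * (q ^ 2) ^ k ≠ 0 :=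
    prod_ne_zero_iff.mp h.swap.poch_shift_ne k (by simpa)
  have f4 : 1 - -(s / (t * z) * q / (q ^ 2) ^ d) * (q ^ 2) ^ k ≠ 0 :=
    prod_ne_zero_iff.mp (h.poch_ne2 le_rfl) k (by simpa)
  have f5 : 1 - -(s * z / t * q) * (q ^ 2) ^ k ≠ 0 :=
    prod_ne_zero_iff.mp (h.poch_ne1 le_rfl) k (by simpa)
  have g1 : 1 - ((q ^ 2) ^ d)⁻¹ * ((q ^ 2) ^ d / (q ^ 2 * (q ^ 2) ^ k)) =
      -(1 - q ^ 2 * (q ^ 2) ^ k) / (q ^ 2 * (q ^ 2) ^ k) := by field_simp; ring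
  have g2 : 1 - -(t / (s * z) * q / (q ^ 2) ^ d) * ((q ^ 2) ^ d / (q ^ 2 * (q ^ 2) ^ k)) =
      (1 - -(s * z / t * q) * (q ^ 2) ^ k) * (t / (s * z * q * (q ^ 2) ^ k)) := by field_simp; ring
  rw [g1, g2]
  generalize 1 - q ^ 2 * (q ^ 2) ^ k = F1 at *
  generalize 1 - s ^ 2 * q ^ 2 * (q ^ 2) ^ k = F2 at *
  generalize 1 - t ^ 2 * q ^ 2 * (q ^ 2) ^ k = F3 at *
  generalize 1 - -(s / (t * z) * q / (q ^ 2) ^ d) * (q ^ 2) ^ k = F4 at *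
  generalize 1 - -(s * z / t * q) * (q ^ 2) ^ k = F5 at *
  generalize (q ^ 2) ^ k = x at *
  generalize (q ^ 2) ^ d = y at *
  clear e1 e2 e3 g1 g2
  field_simp

/-- The trace of the product of three primitive idempotents. -/
theorem Gen.triple_overlap (h : Gen q r d s t z) :
    ovl q r d s t z 0 * gco q r d s t (z * (q ^ 2) ^ d)⁻¹ d 0 /
        (∏ k ∈ range d, (th q r z 0 - th q r z (k + 1))) *
      ((-1) ^ d * (∏ k ∈ range d, (q ^ 2) ^ k) *
        ((poch q (s ^ 2 * q ^ 2) d * poch q (z ^ 2 * q ^ 2) d * poch q (t ^ 2 * q ^ 2) d) /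
          (poch q (-(q * s * z / t)) d * poch q (-(q * s * t / z)) d
            * poch q (-(q * z * t / s)) d))) = 1 := by
  obtain ⟨hq, hr, hs, ht, hz⟩ : q ≠ 0 ∧ r ≠ 0 ∧ s ≠ 0 ∧ t ≠ 0 ∧ z ≠ 0 :=
    ⟨h.q0, h.r0, h.s0, h.t0, h.z0⟩
  have hD := h.Q0 d
  rw [eq_one_div_of_mul_eq_one_left h.ovl_zero]
  have e1 : ∏ k ∈ range d, (1 - ((q ^ 2) ^ d)⁻¹ * (q ^ 2) ^ k) =
      ∏ k ∈ range d, (1 - ((q ^ 2) ^ d)⁻¹ * ((q ^ 2) ^ d / (q ^ 2 * (q ^ 2) ^ k))) :=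
    poch_reflect hq _
  have e2 := poch_reflect (d := d) hq (-(t / (s * z) * q / (q ^ 2) ^ d))
  have e3 := poch_reflect (d := d) hq (-(s / (t * z) * q / (q ^ 2) ^ d))
  have e4 : ∏ j ∈ range d, gfac q d s t (z * (q ^ 2) ^ d)⁻¹ j =
      (∏ k ∈ range d, (1 - ((q ^ 2) ^ d)⁻¹ * ((q ^ 2) ^ d / (q ^ 2 * (q ^ 2) ^ k)))) *
      ∏ k ∈ range d, ((1 - q ^ 2 * (q ^ 2) ^ k) * (1 - -(q * s * t / z) * (q ^ 2) ^ k)) := by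
    rw [← e1, ← prod_mul_distrib]
    refine prod_congr rfl fun k _ => ?_
    unfold gfac
    rw [pow_succ (q ^ 2) k]
    field_simp
    ring
  have e5 : q ^ d ^ 2 * q ^ d ^ 2 = ∏ _k ∈ range d, (q ^ 2) ^ d := by
    simp only [prod_const, card_range, ← pow_mul, ← pow_add]
    congr 1; ring
  -- The power q^{d²} in `gco` is spread over the range so that each index k can be treated
  -- separately.
  have e6 : q ^ d ^ 2 = (∏ _k ∈ range d, (q ^ 2) ^ d) / ∏ k ∈ range d, (q * (q ^ 2) ^ k) := by
    rw [prod_pow_eq, ← e5, mul_div_assoc, div_self (pow_ne_zero _ hq), mul_one]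
  unfold gco nn
  simp only [one_div_div, add_zero, range_zero, prod_empty, one_mul, mul_zero, ne_eq,
    OfNat.ofNat_ne_zero, not_false_eq_true, zero_pow]
  rw [e2, e3, e4, e6]
  rw [show (-(s * t * z * (q ^ 2) ^ d * q)) ^ d = ∏ _k ∈ range d, (-(s * t * z * (q ^ 2) ^ d * q)) by
    simp, show s ^ d = ∏ _k ∈ range d, s by simp, show (t * r) ^ d = ∏ _k ∈ range d, (t * r) by simp,
    show (-1 : ℂ) ^ d = ∏ _k ∈ range d, (-1 : ℂ) by simp]
  unfold poch
  simp only [← prod_mul_distrib, ← prod_div_distrib]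
  refine prod_eq_one fun k hk => ?_
  simp only [mem_range] at hk
  rw [th_zero_sub hq hz]
  have hQ := h.Q0 k
  have f1 : 1 - q ^ 2 * (q ^ 2) ^ k ≠ 0 := by rw [← pow_succ']; exact h.qfac_ne k
  have f2 : 1 - s ^ 2 * q ^ 2 * (q ^ 2) ^ k ≠ 0 := prod_ne_zero_iff.mp h.poch_shift_ne k (by simpa)
  have f3 : 1 - t ^ 2 * q ^ 2 * (q ^ 2) ^ k ≠ 0 :=
    prod_ne_zero_iff.mp h.swap.poch_shift_ne k (by simpa)
  have f4 : 1 - z ^ 2 * q ^ 2 * (q ^ 2) ^ k ≠ 0 :=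
    prod_ne_zero_iff.mp h.rot.rot.poch_shift_ne k (by simpa)
  have f5 : 1 - -(q * s * z / t) * (q ^ 2) ^ k ≠ 0 := by
    have := prod_ne_zero_iff.mp (h.rot.rot.poch_ne5) k (by simpa)
    rwa [mul_right_comm q z s] at this
  have f6 : 1 - -(q * s * t / z) * (q ^ 2) ^ k ≠ 0 :=
    prod_ne_zero_iff.mp (h.poch_ne5) k (by simpa)
  have f7 : 1 - -(q * z * t / s) * (q ^ 2) ^ k ≠ 0 := by
    have := prod_ne_zero_iff.mp (h.rot.poch_ne5) k (by simpa)
    rwa [mul_right_comm q t z] at this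
  have g1 : 1 - ((q ^ 2) ^ d)⁻¹ * ((q ^ 2) ^ d / (q ^ 2 * (q ^ 2) ^ k)) =
      -(1 - q ^ 2 * (q ^ 2) ^ k) / (q ^ 2 * (q ^ 2) ^ k) := by field_simp; ring
  have g2 : 1 - -(t / (s * z) * q / (q ^ 2) ^ d) * ((q ^ 2) ^ d / (q ^ 2 * (q ^ 2) ^ k)) =
      (1 - -(q * s * z / t) * (q ^ 2) ^ k) * (t / (s * z * q * (q ^ 2) ^ k)) := by field_simp; ring
  have g3 : 1 - -(s / (t * z) * q / (q ^ 2) ^ d) * ((q ^ 2) ^ d / (q ^ 2 * (q ^ 2) ^ k)) =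
      (1 - -(q * z * t / s) * (q ^ 2) ^ k) * (s / (t * z * q * (q ^ 2) ^ k)) := by field_simp; ring
  rw [g1, g2, g3, pow_succ' (q ^ 2) k]
  generalize 1 - q ^ 2 * (q ^ 2) ^ k = F1 at *
  generalize 1 - s ^ 2 * q ^ 2 * (q ^ 2) ^ k = F2 at *
  generalize 1 - t ^ 2 * q ^ 2 * (q ^ 2) ^ k = F3 at *
  generalize 1 - z ^ 2 * q ^ 2 * (q ^ 2) ^ k = F4 at *
  generalize 1 - -(q * s * z / t) * (q ^ 2) ^ k = F5 at *
  generalize 1 - -(q * s * t / z) * (q ^ 2) ^ k = F6 at *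
  generalize 1 - -(q * z * t / s) * (q ^ 2) ^ k = F7 at *
  generalize (q ^ 2) ^ k = x at *
  generalize (q ^ 2) ^ d = y at *
  clear e1 e2 e3 e4 e5 e6 g1 g2 g3
  field_simp

/-- The normalization coefficient of the eigenbases, in multiplicative parameters. -/
noncomputable def lw (q r : ℂ) (d : ℕ) (s t z : ℂ) (j : ℕ) : ℂ :=
  q ^ 2 / (q ^ 2) ^ d * ((1 - (q ^ 2) ^ (j + 1)) * (s⁻¹ - s * ((q ^ 2) ^ (j + 1) * (q ^ 2) ^ d)) *
    (t * z * ((q ^ 2) ^ d / q) + s * (q ^ 2) ^ j) * (s⁻¹ * z⁻¹ * q⁻¹ + t⁻¹ * (q ^ 2) ^ j)) /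
    ((s⁻¹ - s * ((q ^ 2) ^ j * (q ^ 2) ^ (j + 1))) * (s⁻¹ - s * ((q ^ 2) ^ (j + 1)) ^ 2)) / r

theorem mul_step {A a O b O' B c : ℂ} (e : A * O = O' * B) (h : a * b = c) :
    A * a * (O * b) = O' * (B * c) := by
  linear_combination a * b * e + O' * B * h

/-- The factor (s q^{2k+1})⁻¹ turns the prescribed entry of A* into the subdiagonal entry of A⋄ in
the eigenbasis of A (`Triple.sub_third`). The left side is thus the overlap of (A, A⋄), and f is its
normalized ratio. -/
theorem Gen.f_step (h : Gen q r d s t z) {M : ℕ} (hM : M ≤ d) :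
    (∏ k ∈ range M, ((s * (q ^ 2) ^ k * q)⁻¹ * lw q r d s t z k)) * ovl q r d s z t M =
      ovl q r d s z t 0 * ∏ k ∈ range M, (((s * (q ^ 2) ^ k * q ^ 2)⁻¹ + q⁻¹ * t⁻¹ * z) /
        (s * (q ^ 2) ^ k + q⁻¹ * t⁻¹ * z)) := by
  induction M with
  | zero => simp
  | succ M ih =>
    obtain ⟨hq, hr, hs, ht, hz⟩ : q ≠ 0 ∧ r ≠ 0 ∧ s ≠ 0 ∧ t ≠ 0 ∧ z ≠ 0 :=
      ⟨h.q0, h.r0, h.s0, h.t0, h.z0⟩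
    have hQ := h.Q0 M
    have hD := h.Q0 d
    have hg := h.rot.rot.swap
    rw [hg.ovl_succ hM, prod_range_succ, prod_range_succ]
    have e := ih (by omega)
    refine mul_step e ?_
    have a6 := hg.rev.ph_ne (n := M + 1) (by omega) hM
    rw [ph_rev_succ_eq hq hz] at a6 ⊢
    obtain ⟨a7, -⟩ := div_ne_zero_iff.mp a6
    simp only [mul_ne_zero_iff] at a7
    obtain ⟨⟨⟨⟨b1, b2⟩, b3⟩, b4⟩, -⟩ := a7
    have c1 : s ^ 2 * ((q ^ 2) ^ M) ^ 2 * q ^ 2 - 1 ≠ 0 := by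
      have := h.s_ne (M := 2 * M + 1) (by omega)
      convert this using 1
      ring
    have c2 : s ^ 2 * ((q ^ 2) ^ M) ^ 2 * q ^ 4 - 1 ≠ 0 := by
      have := h.s_ne (M := 2 * M + 2) (by omega)
      convert this using 1
      ring
    have c3 : s ^ 2 * (q ^ 2) ^ M * (q ^ 2) ^ d * q ^ 2 - 1 ≠ 0 := by
      have := h.s_ne (M := M + d + 1) (by omega)
      convert this using 1
      ring
    unfold lw
    have e1 : (q ^ 2) ^ M - (q ^ 2) ^ d = -(q ^ 2) ^ d * (1 - ((q ^ 2) ^ d)⁻¹ * (q ^ 2) ^ M) := by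
      field_simp; ring
    have e2 : 1 - (q ^ 2) ^ (M + 1) = (1 - q ^ 2 * (q ^ 2) ^ M) := by ring
    have e3 : s⁻¹ - s * ((q ^ 2) ^ (M + 1) * (q ^ 2) ^ d) =
      -(s ^ 2 * (q ^ 2) ^ M * (q ^ 2) ^ d * q ^ 2 - 1) / s := by field_simp; ring
    have e4 : s⁻¹ - s * ((q ^ 2) ^ M * (q ^ 2) ^ (M + 1)) =
      -(s ^ 2 * ((q ^ 2) ^ M) ^ 2 * q ^ 2 - 1) / s := by field_simp; ring
    have e5 : s⁻¹ - s * ((q ^ 2) ^ (M + 1)) ^ 2 =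
      -(s ^ 2 * ((q ^ 2) ^ M) ^ 2 * q ^ 4 - 1) / s := by field_simp; ring
    have e6 : t * z * ((q ^ 2) ^ d / q) + s * (q ^ 2) ^ M =
      (1 - -(s / (z * t) * q / (q ^ 2) ^ d) * (q ^ 2) ^ M) * (t * z * (q ^ 2) ^ d / q) := by
      field_simp; ring
    have e7 : (s * (q ^ 2) ^ M + q⁻¹ * t⁻¹ * z) =
      (1 - -(s * t / z * q) * (q ^ 2) ^ M) * (z / (t * q)) := by
      field_simp; ring
    have e8 : s⁻¹ * z⁻¹ * q⁻¹ + t⁻¹ * (q ^ 2) ^ M =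
      ((s * (q ^ 2) ^ M * q ^ 2)⁻¹ + q⁻¹ * t⁻¹ * z) * (q * (q ^ 2) ^ M / z) := by field_simp
    rw [e1, e2, e3, e4, e5, e6, e7, e8]
    generalize (s * (q ^ 2) ^ M * q ^ 2)⁻¹ + q⁻¹ * t⁻¹ * z = F0 at *
    generalize 1 - q ^ 2 * (q ^ 2) ^ M = F1 at *
    generalize 1 - ((q ^ 2) ^ d)⁻¹ * (q ^ 2) ^ M = F2 at *
    generalize (1 - -(s / (z * t) * q / (q ^ 2) ^ d) * (q ^ 2) ^ M) = F3 at *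
    generalize (1 - -(s * t / z * q) * (q ^ 2) ^ M) = F4 at *
    generalize (s ^ 2 * (q ^ 2) ^ M * (q ^ 2) ^ d * q ^ 2 - 1) = F5 at *
    generalize (s ^ 2 * ((q ^ 2) ^ M) ^ 2 * q ^ 2 - 1) = F6 at *
    generalize (s ^ 2 * ((q ^ 2) ^ M) ^ 2 * q ^ 4 - 1) = F7 at *
    generalize (q ^ 2) ^ M = x at *
    generalize (q ^ 2) ^ d = y at *
    clear e1 e2 e3 e4 e5 e6 e7 e8 ih e a6
    field_simp

end LeonardBethe

namespace LeonardBethe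

open Finset

variable {q r : ℂ} {d : ℕ} {s t z : ℂ}

/-- The overlaps of x_N with w_0 and with v_0 carry the subdiagonal entries of Y and of X in x,
which differ by z q^{2k+1} (`Triple.sub_first`). What remains of their ratio is h. -/
theorem Gen.h_step (h : Gen q r d s t z) {N : ℕ} (hN : N ≤ d) :
    ovl q r d z t s N * (ovl q r d z s t 0 * ∏ k ∈ range N, (((q ^ 2) ^ k) ^ 2 * z ^ 2 *
      (((z * (q ^ 2) ^ k)⁻¹ + q * t⁻¹ * s) / (z * (q ^ 2) ^ k + q⁻¹ * t⁻¹ * s)))) =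
    ovl q r d z t s 0 * (ovl q r d z s t N * ∏ k ∈ range N, (z * (q ^ 2) ^ k * q)) := by
  induction N with
  | zero => simp
  | succ N ih =>
    obtain ⟨hq, hr, hs, ht, hz⟩ : q ≠ 0 ∧ r ≠ 0 ∧ s ≠ 0 ∧ t ≠ 0 ∧ z ≠ 0 :=
      ⟨h.q0, h.r0, h.s0, h.t0, h.z0⟩
    have hQ := h.Q0 N
    have hD := h.Q0 d
    have hg1 := h.rot.rot
    have hg2 := h.rot.swap
    have a1 := hg1.rev.ph_ne (n := N + 1) (by omega) hN
    have a2 := hg2.rev.ph_ne (n := N + 1) (by omega) hN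
    have e := ih (by omega)
    rw [hg1.ovl_succ hN, hg2.ovl_succ hN, prod_range_succ, prod_range_succ]
    have key : ((q ^ 2) ^ N) ^ 2 * z ^ 2 *
      (((z * (q ^ 2) ^ N)⁻¹ + q * t⁻¹ * s) / (z * (q ^ 2) ^ N + q⁻¹ * t⁻¹ * s)) /
        ph q r d z (t * (q ^ 2) ^ d)⁻¹ s (N + 1) =
      z * (q ^ 2) ^ N * q / ph q r d z (s * (q ^ 2) ^ d)⁻¹ t (N + 1) := by
      rw [ph_rev_succ_eq hq hs] at a1 ⊢
      rw [ph_rev_succ_eq hq ht] at a2 ⊢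
      obtain ⟨a3, -⟩ := div_ne_zero_iff.mp a2
      obtain ⟨a4, -⟩ := div_ne_zero_iff.mp a1
      simp only [mul_ne_zero_iff] at a3 a4
      obtain ⟨⟨⟨⟨b1, b2⟩, b3⟩, b4⟩, -⟩ := a3
      obtain ⟨⟨⟨⟨-, -⟩, -⟩, b5⟩, -⟩ := a4
      have e1 : (z * (q ^ 2) ^ N)⁻¹ + q * t⁻¹ * s =
        (1 - -(z * s / t * q) * (q ^ 2) ^ N) / (z * (q ^ 2) ^ N) := by field_simp; ring
      have e2 : z * (q ^ 2) ^ N + q⁻¹ * t⁻¹ * s =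
        (1 - -(z * t / s * q) * (q ^ 2) ^ N) * (s / (t * q)) := by field_simp; ring
      rw [e1, e2, mul_comm t s]
      rw [mul_comm t s] at b3
      generalize 1 - q ^ 2 * (q ^ 2) ^ N = F1 at *
      generalize 1 - ((q ^ 2) ^ d)⁻¹ * (q ^ 2) ^ N = F2 at *
      generalize (1 - -(z / (s * t) * q / (q ^ 2) ^ d) * (q ^ 2) ^ N) = F3 at *
      generalize (1 - -(z * s / t * q) * (q ^ 2) ^ N) = F4 at *
      generalize (1 - -(z * t / s * q) * (q ^ 2) ^ N) = F5 at *
      generalize (q ^ 2) ^ N = x at *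
      generalize (q ^ 2) ^ d = y at *
      clear e1 e2 e ih a1 a2
      field_simp
    generalize ((q ^ 2) ^ N) ^ 2 * z ^ 2 *
      (((z * (q ^ 2) ^ N)⁻¹ + q * t⁻¹ * s) / (z * (q ^ 2) ^ N + q⁻¹ * t⁻¹ * s)) = a at *
    generalize ((q ^ 2) ^ N - (q ^ 2) ^ d) *
      (z ^ 2 * ((q ^ 2) ^ N) ^ 2 * q ^ 2 - 1) * (z ^ 2 * ((q ^ 2) ^ N) ^ 2 * q ^ 4 - 1) /
      (z * r * ((q ^ 2) ^ N) ^ 2 * q ^ 2 * (z ^ 2 * (q ^ 2) ^ N * (q ^ 2) ^ d * q ^ 2 - 1)) = G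
    rw [div_eq_mul_inv] at key ⊢
    rw [div_eq_mul_inv] at key ⊢
    linear_combination (a * G * (ph q r d z (t * (q ^ 2) ^ d)⁻¹ s (N + 1))⁻¹) * e +
      (ovl q r d z t s 0 * ovl q r d z s t N * (∏ k ∈ range N, (z * (q ^ 2) ^ k * q)) * G) * key

/-- The four upper parameters pair off into the differences of eigenvalues, and the four lower
symbols, including the one from n!, are the factors of the split sequence. -/
theorem Gen.rg_term (h : Gen q r d s t z) (M N : ℕ) {n : ℕ} (hn : n ≤ d) :
    (poch q ((q ^ 2) ^ M)⁻¹ n * poch q (s ^ 2 * (q ^ 2) ^ M) n * poch q ((q ^ 2) ^ N)⁻¹ n *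
      poch q (t ^ 2 * (q ^ 2) ^ N) n) /
    (poch q (-(s * t / z * q)) n * poch q (-(s * t * z * (q ^ 2) ^ d * q)) n *
      poch q ((q ^ 2) ^ d)⁻¹ n * poch q (q ^ 2) n) * (q ^ 2) ^ n =
    ∏ j ∈ range n,
      ((th q r s M - th q r s j) * (th q r t N - th q r t j) / ph q r d s t z (j + 1)) := by
  obtain ⟨hq, hr, hs, ht, hz⟩ : q ≠ 0 ∧ r ≠ 0 ∧ s ≠ 0 ∧ t ≠ 0 ∧ z ≠ 0 :=
    ⟨h.q0, h.r0, h.s0, h.t0, h.z0⟩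
  rw [show (q ^ 2) ^ n = ∏ _k ∈ range n, q ^ 2 by simp]
  unfold poch
  simp only [← prod_mul_distrib, ← prod_div_distrib]
  refine prod_congr rfl fun j hj => ?_
  simp only [mem_range] at hj
  have a1 := h.ph_ne (n := j + 1) (by omega) (by omega)
  rw [th_sub_th hq hs, th_sub_th hq ht, pow_add, pow_add]
  rw [ph_succ_eq hq] at a1 ⊢
  obtain ⟨a2, -⟩ := div_ne_zero_iff.mp a1
  simp only [mul_ne_zero_iff] at a2
  obtain ⟨⟨⟨b1, b2⟩, b3⟩, b4⟩ := a2
  have h1 := h.Q0 M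
  have h2 := h.Q0 N
  have h3 := h.Q0 j
  generalize 1 - q ^ 2 * (q ^ 2) ^ j = F1 at *
  generalize 1 - ((q ^ 2) ^ d)⁻¹ * (q ^ 2) ^ j = F2 at *
  generalize 1 - -(s * t / z * q) * (q ^ 2) ^ j = F3 at *
  generalize 1 - -(s * t * z * (q ^ 2) ^ d * q) * (q ^ 2) ^ j = F4 at *
  generalize (q ^ 2) ^ M = x at *
  generalize (q ^ 2) ^ N = y at *
  generalize (q ^ 2) ^ j = w at *
  field_simp
  ring

theorem ph_swap (n : ℕ) : ph q r d s t z n = ph q r d t s z n := by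
  unfold ph
  rw [mul_comm s t, mul_assoc _ s t, mul_comm s t, ← mul_assoc]

theorem Rg_swap (M N : ℕ) : Rg q r d s t z M N = Rg q r d t s z N M := by
  unfold Rg
  refine sum_congr rfl fun n _ => prod_congr rfl fun j _ => ?_
  rw [ph_swap, mul_comm (th q r s M - _)]

theorem Rg_eq_sum {M : ℕ} (hM : M ≤ d) (N : ℕ) : Rg q r d s t z M N =
    ∑ n ∈ range (M + 1), ∏ j ∈ range n,
    ((th q r s M - th q r s j) * (th q r t N - th q r t j) / ph q r d s t z (j + 1)) := by
  unfold Rg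
  symm
  refine sum_subset (by simpa using hM) fun n _ hn => ?_
  simp only [mem_range, not_lt] at hn
  exact prod_eq_zero (i := M) (by simpa using hn) (by simp)

/-- Replacing z by (z q^{2d})⁻¹ exchanges two symbols in the numerator and two in the denominator.
-/
theorem kk_reverse (hq : q ≠ 0) (hz : z ≠ 0) (M : ℕ) :
    kk q d s t (z * (q ^ 2) ^ d)⁻¹ M = kk q d s t z M := by
  have hD : (q ^ 2) ^ d ≠ 0 := pow_ne_zero _ (pow_ne_zero _ hq)
  unfold kk
  generalize (q ^ 2) ^ d = y at *
  rw [show s * t * (z * y)⁻¹ * y * q = s * t / z * q by field_simp,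
    show s * t / (z * y)⁻¹ * q = s * t * z * y * q by field_simp,
    show s * (z * y)⁻¹ / t * q = s / (t * z) * q / y by field_simp,
    show s / (t * (z * y)⁻¹) * q / y = s * z / t * q by field_simp]
  ring

/-! ### The parameters of the triple in multiplicative form -/

open Idx

namespace Params

variable (p : Params)

/-- The multiplicative parameter `r₀ 𝖻ᵃ`. -/
noncomputable def B (a : Idx) : ℂ := p.r0 * p.b a

end Params

end LeonardBethe

namespace LeonardBethe

open Finset

variable {q r : ℂ} {d : ℕ} {s t z : ℂ}

open Idx

theorem zpow_two_mul_cast (q : ℂ) (n : ℕ) : q ^ (2 * (n : ℤ)) = (q ^ 2) ^ n := by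
  rw [zpow_mul, zpow_natCast]; norm_cast

theorem zpow_four_mul_cast (q : ℂ) (n : ℕ) : q ^ (4 * (n : ℤ)) = ((q ^ 2) ^ n) ^ 2 := by
  rw [zpow_mul, zpow_natCast, ← pow_mul, ← pow_mul]
  norm_cast
  rw [← pow_mul]
  congr 1
  ring

namespace Params

variable {p : Params}

theorem Admissible.b_ne (hp : p.Admissible) (a : Idx) : p.b a ≠ 0 := fun h0 => by
  have := hp.b_mul_c a
  rw [h0, zero_mul] at this
  exact inv_ne_zero (pow_ne_zero 2 hp.r0_ne_zero) this.symm

theorem Admissible.B_ne (hp : p.Admissible) (a : Idx) : p.B a ≠ 0 :=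
  mul_ne_zero hp.r0_ne_zero (hp.b_ne a)

theorem Admissible.b_eq (hp : p.Admissible) (a : Idx) : p.b a = p.B a / p.r0 := by
  rw [B, mul_div_cancel_left₀ _ hp.r0_ne_zero]

theorem Admissible.c_eq (hp : p.Admissible) (a : Idx) : p.c a = (p.r0 * p.B a)⁻¹ := by
  have h1 := hp.r0_ne_zero
  have h2 := hp.b_ne a
  have h3 := hp.b_mul_c a
  rw [B]
  field_simp at h3 ⊢
  linear_combination h3

theorem Admissible.theta_eq (hp : p.Admissible) (a : Idx) (M : ℕ) :
    p.theta a M = th p.q p.r0 (p.B a) M := by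
  unfold theta th
  rw [hp.b_eq, hp.c_eq, zpow_neg, zpow_two_mul_cast, mul_inv, mul_inv]
  ring

theorem Admissible.omega_eq (hp : p.Admissible) (a b c : Idx) :
    p.omega a b c = omg p.q p.r0 p.d (p.B a) (p.B b) (p.B c) := by
  have h1 := hp.r0_ne_zero
  have h : ∀ a, p.thetaMid a = (p.B a * p.q ^ p.d + (p.B a * p.q ^ p.d)⁻¹) / p.r0 := by
    intro a
    unfold thetaMid
    rw [hp.b_eq, hp.c_eq, zpow_neg, zpow_natCast, mul_inv, mul_inv]
    ring
  unfold omega omg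
  rw [h, h, h, show -(p.d : ℤ) - 1 = -((p.d + 1 : ℕ) : ℤ) by push_cast; ring, zpow_neg,
    show (p.d : ℤ) + 1 = ((p.d + 1 : ℕ) : ℤ) by push_cast; ring, zpow_natCast]
  field_simp

theorem Admissible.one_sub_ne (hp : p.Admissible) (a : Idx) {M : ℕ} (hM : M ≤ 2 * p.d) :
    1 - p.B a ^ 2 * (p.q ^ 2) ^ M ≠ 0 := by
  intro h0
  have hQ : (p.q ^ 2) ^ M ≠ 0 := pow_ne_zero _ (pow_ne_zero _ hp.q_ne_zero)
  have h1 := hp.r0_ne_zero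
  have h2 := hp.B_ne a
  refine hp.cond_i a M hM ?_
  rw [zpow_neg, zpow_two_mul_cast, hp.b_eq, hp.c_eq]
  field_simp
  linear_combination -h0

/-- The conditions `k0`, `ks`, `kt`, `kz` are `cond_ii₃`, `cond_ii₂`, `cond_ii₁`, `cond_ii₄`
respectively, with the index reflected to d + 1 - M for `cond_ii₂`. -/
theorem Admissible.gen (hp : p.Admissible) :
    Gen p.q p.r0 p.d (p.B pt) (p.B st) (p.B di) := by
  have hq := hp.q_ne_zero
  have h1 := hp.r0_ne_zero
  have hs := hp.B_ne pt
  have ht := hp.B_ne st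
  have hz := hp.B_ne di
  have hQ : ∀ n, (p.q ^ 2) ^ n ≠ 0 := fun n => pow_ne_zero _ (pow_ne_zero _ hq)
  refine ⟨hq, fun n hn => ?_, h1, hs, ht, hz, fun M => hp.one_sub_ne pt, fun M => hp.one_sub_ne st,
    fun M => hp.one_sub_ne di, ?_, ?_, ?_, ?_⟩
  · rw [← pow_mul]
    exact hp.q_not_root _ (by omega)
  · intro M hM hM' h0
    refine hp.cond_ii₃ M hM hM' ?_
    rw [zpow_sub₀ hq, zpow_add₀ hq, zpow_two_mul_cast, zpow_two_mul_cast, zpow_one,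
      hp.b_eq, hp.b_eq, hp.c_eq]
    have := hQ M
    have := hQ p.d
    generalize (p.q ^ 2) ^ M = x at *
    generalize (p.q ^ 2) ^ p.d = y at *
    field_simp at h0 ⊢
    linear_combination h0
  · intro M hM hM' h0
    refine hp.cond_ii₂ (p.d + 1 - M) (by omega) (by omega) ?_
    rw [zpow_add₀ hq, zpow_add₀ hq, zpow_neg, zpow_two_mul_cast, zpow_two_mul_cast, zpow_one,
      hp.b_eq, hp.b_eq, hp.b_eq]
    have e : (p.q ^ 2) ^ (p.d + 1 - M) * (p.q ^ 2) ^ M = (p.q ^ 2) ^ p.d * p.q ^ 2 := by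
      rw [← pow_add, ← pow_succ]; congr 1; omega
    have h3 := hQ M
    have h4 := hQ p.d
    have h5 := hQ (p.d + 1 - M)
    generalize (p.q ^ 2) ^ M = x at *
    generalize (p.q ^ 2) ^ p.d = y at *
    generalize (p.q ^ 2) ^ (p.d + 1 - M) = w at *
    field_simp at h0 ⊢
    have e2 : w * x * (p.B pt * p.q + p.B st * p.B di * x) = 0 := by
      rw [mul_comm (p.B pt)]; linear_combination w * x * h0
    apply mul_left_cancel₀ (mul_ne_zero h3 hq)
    linear_combination e2 - x * p.B st * p.B di * e
  · intro M hM hM' h0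
    refine hp.cond_ii₁ M hM hM' ?_
    rw [zpow_add₀ hq, zpow_neg, zpow_two_mul_cast, zpow_one,
      hp.c_eq, hp.c_eq, hp.c_eq]
    have := hQ M
    generalize (p.q ^ 2) ^ M = x at *
    field_simp at h0 ⊢
    linear_combination h0
  · intro M hM hM' h0
    refine hp.cond_ii₄ M hM hM' ?_
    rw [zpow_sub₀ hq, zpow_two_mul_cast, zpow_one,
      hp.b_eq, hp.c_eq, hp.c_eq]
    have := hQ M
    generalize (p.q ^ 2) ^ M = x at *
    field_simp at h0 ⊢
    linear_combination h0

theorem lowAux_eq (hq : p.q ≠ 0) (h1 : p.r0 ≠ 0) (hs : s ≠ 0) (ht : t ≠ 0) (hz : z ≠ 0) (j : ℕ) :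
    p.lowAux (s / p.r0) (p.r0 * s)⁻¹ (t / p.r0) (p.r0 * t)⁻¹ (z / p.r0) (p.r0 * z)⁻¹ (j + 1) =
      lw p.q p.r0 p.d s t z j := by
  have hQ : ∀ n, (p.q ^ 2) ^ n ≠ 0 := fun n => pow_ne_zero _ (pow_ne_zero _ hq)
  have e2 : p.q ^ (2 : ℤ) = p.q ^ 2 := by norm_cast
  have e3 : p.q ^ (2 * ((j + 1 : ℕ) : ℤ) - 2) = (p.q ^ 2) ^ j := by
    rw [← zpow_two_mul_cast]; congr 1; push_cast; ring
  have e4 : p.q ^ (4 * ((j + 1 : ℕ) : ℤ) - 2) = (p.q ^ 2) ^ j * (p.q ^ 2) ^ (j + 1) := by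
    rw [← zpow_two_mul_cast, ← zpow_two_mul_cast, ← zpow_add₀ hq]
    congr 1; push_cast; ring
  unfold lowAux lw
  rw [e3, e4, zpow_sub₀ hq, zpow_sub₀ hq, zpow_add₀ hq, zpow_four_mul_cast, zpow_two_mul_cast,
    zpow_two_mul_cast, zpow_one, e2, pow_succ (p.q ^ 2) j]
  have := hQ j
  have := hQ p.d
  generalize (p.q ^ 2) ^ j = x at *
  generalize (p.q ^ 2) ^ p.d = y at *
  rw [show ((p.r0 * s)⁻¹ - s / p.r0 * (x * (x * p.q ^ 2))) =
    ((s)⁻¹ - s * (x * (x * p.q ^ 2))) / p.r0 by field_simp,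
    show ((p.r0 * s)⁻¹ - s / p.r0 * (x * p.q ^ 2) ^ 2) =
    ((s)⁻¹ - s * (x * p.q ^ 2) ^ 2) / p.r0 by field_simp,
    show ((p.r0 * s)⁻¹ - s / p.r0 * (x * p.q ^ 2 * y)) =
    ((s)⁻¹ - s * (x * p.q ^ 2 * y)) / p.r0 by field_simp]
  generalize ((s)⁻¹ - s * (x * (x * p.q ^ 2))) = F1
  generalize ((s)⁻¹ - s * (x * p.q ^ 2) ^ 2) = F2
  generalize ((s)⁻¹ - s * (x * p.q ^ 2 * y)) = F3
  generalize (1 - x * p.q ^ 2) = F4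
  simp only [div_eq_mul_inv, mul_inv, inv_inv]
  generalize F1⁻¹ = G1
  generalize F2⁻¹ = G2
  field_simp

theorem Admissible.c_mul (hp : p.Admissible) (a : Idx) :
    p.c a * p.q ^ (-(2 * (p.d : ℤ))) = (p.B a * (p.q ^ 2) ^ p.d)⁻¹ / p.r0 := by
  rw [zpow_neg, zpow_two_mul_cast, hp.c_eq, mul_inv, mul_inv]
  ring

theorem Admissible.b_mul (hp : p.Admissible) (a : Idx) :
    p.b a * p.q ^ (2 * (p.d : ℤ)) = (p.r0 * (p.B a * (p.q ^ 2) ^ p.d)⁻¹)⁻¹ := by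
  rw [zpow_two_mul_cast, hp.b_eq, mul_inv, inv_inv]
  ring

theorem Admissible.reverse_ne (hp : p.Admissible) (a : Idx) : (p.B a * (p.q ^ 2) ^ p.d)⁻¹ ≠ 0 :=
  inv_ne_zero (mul_ne_zero (hp.B_ne a) (pow_ne_zero _ (pow_ne_zero _ hp.q_ne_zero)))

theorem Admissible.lowBA_eq (hp : p.Admissible) (a b c : Idx) (j : ℕ) :
    p.lowBA a b c (j + 1) = lw p.q p.r0 p.d (p.B a) (p.B b) (p.B c) j := by
  rw [lowBA, hp.b_eq, hp.b_eq, hp.b_eq, hp.c_eq, hp.c_eq, hp.c_eq]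
  exact lowAux_eq hp.q_ne_zero hp.r0_ne_zero (hp.B_ne a) (hp.B_ne b) (hp.B_ne c) j

theorem Admissible.lowAB_eq (hp : p.Admissible) (a b c : Idx) (j : ℕ) :
    p.lowAB a b c (j + 1) =
      lw p.q p.r0 p.d (p.B b) (p.B a) (p.B c * (p.q ^ 2) ^ p.d)⁻¹ j := by
  rw [lowAB, hp.c_mul, hp.b_mul, hp.b_eq, hp.b_eq, hp.c_eq, hp.c_eq]
  exact lowAux_eq hp.q_ne_zero hp.r0_ne_zero (hp.B_ne b) (hp.B_ne a) (hp.reverse_ne c) j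

theorem kAux_eq (hq : p.q ≠ 0) (h1 : p.r0 ≠ 0) (hs : s ≠ 0) (ht : t ≠ 0) (hz : z ≠ 0) (N : ℕ) :
    p.kAux (t / p.r0) (p.r0 * t)⁻¹ (s / p.r0) (p.r0 * s)⁻¹ (z / p.r0) (p.r0 * z)⁻¹ N =
      kk p.q p.d s t z N := by
  have e2 : p.q ^ (2 : ℤ) = p.q ^ 2 := by norm_cast
  have hD : (p.q ^ 2) ^ p.d ≠ 0 := pow_ne_zero _ (pow_ne_zero _ hq)
  unfold kAux kk
  rw [zpow_sub₀ hq, zpow_add₀ hq, zpow_add₀ hq, zpow_neg, zpow_four_mul_cast, zpow_two_mul_cast,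
    zpow_one, e2]
  generalize (p.q ^ 2) ^ p.d = y at *
  rw [show -(s / p.r0 * (z / p.r0) / (p.r0 * t)⁻¹) * p.r0 * (y * p.q) = -(s * t * z * y * p.q) by
      field_simp,
    show -(t / p.r0 * (p.r0 * z)⁻¹ / (p.r0 * s)⁻¹) * p.r0 * p.q = -(s * t / z * p.q) by field_simp,
    show s / p.r0 / (p.r0 * s)⁻¹ = s ^ 2 by field_simp,
    show t / p.r0 / (p.r0 * t)⁻¹ = t ^ 2 by field_simp,
    show -(s / p.r0 * (z / p.r0) / (t / p.r0)) * p.r0 * p.q = -(s * z / t * p.q) by field_simp,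
    show -((p.r0 * t)⁻¹ * (p.r0 * z)⁻¹ / (p.r0 * s)⁻¹) * p.r0 * (p.q / y) =
      -(s / (t * z) * p.q / y) by field_simp, ← mul_assoc (s ^ 2) y]

theorem Admissible.kABC_eq (hp : p.Admissible) (a b c : Idx) (N : ℕ) :
    p.kABC a b c N = kk p.q p.d (p.B b) (p.B a) (p.B c) N := by
  rw [kABC, hp.b_eq, hp.b_eq, hp.b_eq, hp.c_eq, hp.c_eq, hp.c_eq]
  exact kAux_eq hp.q_ne_zero hp.r0_ne_zero (hp.B_ne b) (hp.B_ne a) (hp.B_ne c) N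

theorem Admissible.kBAC_eq (hp : p.Admissible) (a b c : Idx) (M : ℕ) :
    p.kBAC a b c M = kk p.q p.d (p.B a) (p.B b) (p.B c) M := by
  rw [kBAC, hp.c_mul, hp.b_mul, hp.b_eq, hp.b_eq, hp.c_eq, hp.c_eq,
    kAux_eq hp.q_ne_zero hp.r0_ne_zero (hp.B_ne a) (hp.B_ne b) (hp.reverse_ne c) M,
    kk_reverse hp.q_ne_zero (hp.B_ne c)]

theorem Admissible.nu0_eq (hp : p.Admissible) (a b c : Idx) :
    p.nu0 a b c = nn p.q p.d (p.B b) (p.B a) (p.B c) := by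
  have hq := hp.q_ne_zero
  have hr := hp.r0_ne_zero
  have ha := hp.B_ne a
  have hb := hp.B_ne b
  have hc := hp.B_ne c
  have hD : (p.q ^ 2) ^ p.d ≠ 0 := pow_ne_zero _ (pow_ne_zero _ hq)
  unfold nu0 nn
  rw [zpow_sub₀ hq, zpow_add₀ hq, zpow_two_mul_cast, zpow_one, hp.b_eq, hp.b_eq, hp.b_eq,
    hp.c_eq, hp.c_eq, hp.c_eq]
  generalize (p.q ^ 2) ^ p.d = y at *
  generalize p.B a = t at *
  generalize p.B b = s at *
  generalize p.B c = z at *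
  rw [show -(s / p.r0 * (z / p.r0) / (p.r0 * t)⁻¹) * p.r0 * (y * p.q) = -(s * t * z * y * p.q) by
      field_simp,
    show s / p.r0 / (p.r0 * s)⁻¹ = s ^ 2 by field_simp,
    show t / p.r0 / (p.r0 * t)⁻¹ = t ^ 2 by field_simp,
    show -(t / p.r0 * (p.r0 * z)⁻¹ / (s / p.r0)) * p.r0 * (p.q / y) =
      -(t / (s * z) * p.q / y) by field_simp,
    show -((p.r0 * t)⁻¹ * (p.r0 * z)⁻¹ / (p.r0 * s)⁻¹) * p.r0 * (p.q / y) =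
      -(s / (t * z) * p.q / y) by field_simp]

theorem Admissible.racahR_eq (hp : p.Admissible) {a b c : Idx}
    (hg : Gen p.q p.r0 p.d (p.B a) (p.B b) (p.B c)) {M : ℕ} (hM : M ≤ p.d) (N : ℕ) :
    p.racahR a b c M N = Rg p.q p.r0 p.d (p.B a) (p.B b) (p.B c) M N := by
  rw [Rg_eq_sum hM]
  unfold racahR
  refine sum_congr rfl fun n hn => ?_
  simp only [mem_range] at hn
  rw [← hg.rg_term M N (by omega)]
  have hq := hp.q_ne_zero
  have hr := hp.r0_ne_zero
  have ha := hp.B_ne a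
  have hb := hp.B_ne b
  have hc := hp.B_ne c
  have hD : (p.q ^ 2) ^ p.d ≠ 0 := pow_ne_zero _ (pow_ne_zero _ hq)
  rw [zpow_add₀ hq, zpow_neg, zpow_neg, zpow_neg, zpow_two_mul_cast, zpow_two_mul_cast,
    zpow_two_mul_cast, zpow_one, hp.b_eq, hp.b_eq, hp.b_eq, hp.c_eq, hp.c_eq, hp.c_eq]
  generalize (p.q ^ 2) ^ p.d = y at *
  generalize p.B a = s at *
  generalize p.B b = t at *
  generalize p.B c = z at *
  rw [show -(t / p.r0 * (z / p.r0) / (p.r0 * s)⁻¹) * p.r0 * (y * p.q) = -(s * t * z * y * p.q) by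
      field_simp,
    show -(s / p.r0 * (p.r0 * z)⁻¹ / (p.r0 * t)⁻¹) * p.r0 * p.q = -(s * t / z * p.q) by field_simp,
    show s / p.r0 / (p.r0 * s)⁻¹ = s ^ 2 by field_simp,
    show t / p.r0 / (p.r0 * t)⁻¹ = t ^ 2 by field_simp]

theorem Admissible.fSeq_eq (hp : p.Admissible) (f0 : ℂ) (M : ℕ) : p.fSeq f0 M =
    f0 * ∏ k ∈ range M, (((p.B pt * (p.q ^ 2) ^ k * p.q ^ 2)⁻¹ + p.q⁻¹ * (p.B st)⁻¹ * p.B di) /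
        (p.B pt * (p.q ^ 2) ^ k + p.q⁻¹ * (p.B st)⁻¹ * p.B di)) := by
  have hq := hp.q_ne_zero
  have hr := hp.r0_ne_zero
  have hs := hp.B_ne pt
  have ht := hp.B_ne st
  have hz := hp.B_ne di
  have e2 : p.q ^ (2 : ℤ) = p.q ^ 2 := by norm_cast
  unfold fSeq
  congr 1
  refine prod_congr rfl fun k _ => ?_
  rw [zpow_sub₀ hq, zpow_neg, zpow_two_mul_cast, e2, hp.b_eq, hp.b_eq, hp.c_eq, hp.c_eq]
  have hQ : (p.q ^ 2) ^ k ≠ 0 := pow_ne_zero _ (pow_ne_zero _ hq)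
  generalize (p.q ^ 2) ^ k = y at *
  rw [← mul_div_mul_left _ _ hr]
  congr 1 <;> field_simp

theorem Admissible.hSeq_eq (hp : p.Admissible) (h0 : ℂ) (M : ℕ) : p.hSeq h0 M =
    h0 * ∏ k ∈ range M, (((p.q ^ 2) ^ k) ^ 2 * p.B di ^ 2 *
      (((p.B di * (p.q ^ 2) ^ k)⁻¹ + p.q * (p.B st)⁻¹ * p.B pt) /
        (p.B di * (p.q ^ 2) ^ k + p.q⁻¹ * (p.B st)⁻¹ * p.B pt))) := by
  have hq := hp.q_ne_zero
  have hr := hp.r0_ne_zero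
  have hs := hp.B_ne pt
  have ht := hp.B_ne st
  have hz := hp.B_ne di
  unfold hSeq
  congr 1
  refine prod_congr rfl fun k _ => ?_
  rw [zpow_neg, zpow_four_mul_cast, zpow_two_mul_cast, hp.b_eq, hp.b_eq, hp.c_eq, hp.c_eq]
  have hQ : (p.q ^ 2) ^ k ≠ 0 := pow_ne_zero _ (pow_ne_zero _ hq)
  generalize (p.q ^ 2) ^ k = y at *
  rw [show p.B di / p.r0 / (p.r0 * p.B di)⁻¹ = p.B di ^ 2 by field_simp]
  congr 1
  rw [← mul_div_mul_left _ _ hr]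
  congr 1 <;> field_simp

variable {V : Type*} [AddCommGroup V] [Module ℂ V] {A As : Module.End ℂ V}

theorem Admissible.Adiam_eq (hp : p.Admissible) : p.Adiam A As =
    third p.q p.r0 (omg p.q p.r0 p.d (p.B pt) (p.B st) (p.B di)) A As := by
  rw [Adiam, third, hp.omega_eq, qComm]

end Params

theorem IsLeonardPair.triple {p : Params} {V : Type*} [AddCommGroup V] [Module ℂ V]
    {A As : Module.End ℂ V} (hA : IsLeonardPair p A As) (hp : p.Admissible) :
    Triple p.q p.r0 p.d (p.B pt) (p.B st) (p.B di) A As (p.Adiam A As) := by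
  rw [hp.Adiam_eq]
  refine .of_aw hp.gen ?_ ?_
  · have := hA.aw₁
    rwa [Params.rho, Params.om, Params.eta, hp.omega_eq, hp.omega_eq,
      omg_swap (s := p.B pt) (t := p.B di)] at this
  · have := hA.aw₂
    rwa [Params.rho, Params.om, Params.etaStar, hp.omega_eq, hp.omega_eq] at this



end LeonardBethe

/-! ### Products of overlaps in a Leonard triple -/

namespace LeonardBethe

open Finset

variable {q r : ℂ} {d : ℕ} {s t z : ℂ}

variable {V : Type*} [AddCommGroup V] [Module ℂ V]
variable {X Y Z : Module.End ℂ V} {v w x : Module.Basis (Fin (d + 1)) ℂ V}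

theorem Gen.reverse_third (h : Gen q r d s t z) : Gen q r d s t (z * (q ^ 2) ^ d)⁻¹ :=
  h.rot.rev.rot.rot

theorem omg_reverse_third (hq : q ≠ 0) (hz : z ≠ 0) :
    omg q r d s t (z * (q ^ 2) ^ d)⁻¹ = omg q r d s t z := by
  have h1 : q ^ d ≠ 0 := pow_ne_zero _ hq
  unfold omg
  rw [show (q ^ 2) ^ d = q ^ d * q ^ d by rw [← pow_mul, ← pow_add]; congr 1; omega]
  have : (z * (q ^ d * q ^ d))⁻¹ * q ^ d = (z * q ^ d)⁻¹ := by field_simp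
  rw [this, inv_inv, add_comm (z * q ^ d)⁻¹]

theorem Gen.lw_ne (h : Gen q r d s t z) {j : ℕ} (hj : j < d) : lw q r d s t z j ≠ 0 := by
  obtain ⟨hq, hr, hs, ht, hz⟩ : q ≠ 0 ∧ r ≠ 0 ∧ s ≠ 0 ∧ t ≠ 0 ∧ z ≠ 0 :=
    ⟨h.q0, h.r0, h.s0, h.t0, h.z0⟩
  have hQ := h.Q0 j
  have hD := h.Q0 d
  have inv_sub : ∀ M ≤ 2 * d, s⁻¹ - s * (q ^ 2) ^ M ≠ 0 := fun M hM h0 => h.hs M hM (by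
    field_simp at h0
    linear_combination h0)
  have h1 : 1 - (q ^ 2) ^ (j + 1) ≠ 0 := fun h0 =>
    h.qr (j + 1) (by omega) (sub_eq_zero.mp h0).symm
  have h2 := inv_sub (j + 1 + d) (by omega)
  have h3 := inv_sub (j + (j + 1)) (by omega)
  have h4 := inv_sub ((j + 1) * 2) (by omega)
  rw [pow_add] at h2 h3
  rw [pow_mul] at h4
  have h5 : t * z * ((q ^ 2) ^ d / q) + s * (q ^ 2) ^ j ≠ 0 := by
    intro h0
    refine h.ks (d - j) (by omega) (by omega) ?_
    have e : (q ^ 2) ^ d = (q ^ 2) ^ (d - j) * (q ^ 2) ^ j := by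
      rw [← pow_add]; congr 1; omega
    rw [e] at h0
    field_simp at h0 ⊢
    apply mul_left_cancel₀ hQ
    linear_combination h0
  have h6 : s⁻¹ * z⁻¹ * q⁻¹ + t⁻¹ * (q ^ 2) ^ j ≠ 0 := by
    intro h0
    refine h.kt (j + 1) (by omega) (by omega) ?_
    rw [pow_succ (q ^ 2) j]
    field_simp at h0 ⊢
    linear_combination h0
  unfold lw
  have hq2 : q ^ 2 ≠ 0 := pow_ne_zero _ hq
  exact div_ne_zero (div_ne_zero (mul_ne_zero (div_ne_zero hq2 hD)
    (mul_ne_zero (mul_ne_zero (mul_ne_zero h1 h2) h5) h6)) (mul_ne_zero h3 h4)) hr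

/-- Eigenbases of the three operators of a triple, on the first and the third of which the second
operator acts with nonzero subdiagonal entries. -/
structure Bases (q r : ℂ) (d : ℕ) (s t z : ℂ) (X Y Z : Module.End ℂ V)
    (v w x : Module.Basis (Fin (d + 1)) ℂ V) : Prop where
  triple : Triple q r d s t z X Y Z
  eigX : Eig X v (th q r s)
  eigY : Eig Y w (th q r t)
  eigZ : Eig Z x (th q r z)
  sub_v_ne : ∀ n < d, sub Y v n ≠ 0
  sub_x_ne : ∀ n < d, sub Y x n ≠ 0

/-- On eigenvectors of X the q-commutator multiplies the entry of Y by q θ_n - q⁻¹ θ_{n+1}, in which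
only one of the two exponentials survives. -/
theorem Triple.sub_third (h : Triple q r d s t z X Y Z) (hX : Eig X v (th q r s)) (n : ℕ) :
    sub Z v n = (s * (q ^ 2) ^ n * q)⁻¹ * sub Y v n := by
  rcases Nat.lt_or_ge n d with hn | hn
  · rw [← th_step_up h.gen.q0 h.gen.s0 h.gen.r0 h.gen.q2_sub_ne, sub, sub, h.eqZ, third_apply,
      map_add, map_smul, map_smul, map_sub, map_smul, map_smul, hX.cn, hX.vn, map_smul, map_smul,
      cn_vn v (by omega), if_neg (by omega)]
    simp only [smul_eq_mul]
    ring
  · rw [sub, sub, cn_gt v (by omega), cn_gt v (by omega), mul_zero]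

theorem Triple.sub_first (h : Triple q r d s t z X Y Z) (hZ : Eig Z x (th q r z)) (n : ℕ) :
    sub X x n = z * (q ^ 2) ^ n * q * sub Y x n := by
  rcases Nat.lt_or_ge n d with hn | hn
  · rw [← th_step_down h.gen.q0 h.gen.z0 h.gen.r0 h.gen.q2_sub_ne, sub, sub]
    nth_rewrite 1 [h.eqX]
    rw [third_apply,
      map_add, map_smul, map_smul, map_sub, map_smul, map_smul, hZ.cn, hZ.vn, map_smul, map_smul,
      cn_vn x (by omega), if_neg (by omega)]
    simp only [smul_eq_mul]
    ring
  · rw [sub, sub, cn_gt x (by omega), cn_gt x (by omega), mul_zero]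

namespace Bases

theorem sysXY (h : Bases q r d s t z X Y Z v w x) : Sys q r d s t z X Y v w :=
  ⟨h.triple.gen, h.eigX, h.eigY, h.triple.rot.relZX, h.triple.relYX, h.sub_v_ne⟩

theorem sysXZ (h : Bases q r d s t z X Y Z v w x) : Sys q r d s z t X Z v x := by
  refine ⟨h.triple.gen.rot.rot.swap, h.eigX, h.eigZ, ?_, ?_, fun n hn => ?_⟩
  · rw [omg_swap]
    exact h.triple.rot.rot.relYX
  · rw [omg_swap]
    exact h.triple.relZX
  · rw [h.triple.sub_third h.eigX]
    exact mul_ne_zero (inv_ne_zero (mul_ne_zero (mul_ne_zero h.triple.gen.s0 (h.triple.gen.Q0 n))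
      h.triple.gen.q0)) (h.sub_v_ne n hn)

theorem sysZX (h : Bases q r d s t z X Y Z v w x) : Sys q r d z s t Z X x v := by
  refine ⟨h.triple.gen.rot.rot, h.eigZ, h.eigX, h.triple.relZX, h.triple.rot.rot.relYX,
    fun n hn => ?_⟩
  rw [h.triple.sub_first h.eigZ]
  exact mul_ne_zero (mul_ne_zero (mul_ne_zero h.triple.gen.z0 (h.triple.gen.Q0 n))
    h.triple.gen.q0) (h.sub_x_ne n hn)

theorem sysZY (h : Bases q r d s t z X Y Z v w x) : Sys q r d z t s Z Y x w := by
  refine ⟨h.triple.gen.rot.swap, h.eigZ, h.eigY, ?_, ?_, h.sub_x_ne⟩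
  · rw [omg_swap]
    exact h.triple.rot.relYX
  · rw [omg_swap]
    exact h.triple.rot.rot.relZX

/-- Both sides are the product of the two mutual overlaps of v_0 and x_0, the trace of a product of
two primitive idempotents. -/
theorem ovl_comm (h : Bases q r d s t z X Y Z v w x) : ovl q r d z s t 0 = ovl q r d s z t 0 := by
  have h1 := h.sysXZ.overlap (Nat.zero_le d)
  have h2 := h.sysZX.overlap (Nat.zero_le d)
  rw [prod_range_zero, one_mul] at h1 h2
  rw [← h1, ← h2, mul_comm]

/-- The normalized quotients `f_M / f_0`. -/
theorem cn_v_x_zero (h : Bases q r d s t z X Y Z v w x) (hv : ∀ n < d, sub Y v n = lw q r d s t z n)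
    {M : ℕ} (hM : M ≤ d) : cn v M (vn x 0) * cn x 0 (vn v 0) =
      ovl q r d s z t 0 * ∏ k ∈ range M, (((s * (q ^ 2) ^ k * q ^ 2)⁻¹ + q⁻¹ * t⁻¹ * z) /
        (s * (q ^ 2) ^ k + q⁻¹ * t⁻¹ * z)) := by
  rw [h.sysXZ.overlap hM, ← h.triple.gen.f_step hM]
  congr 1
  refine prod_congr rfl fun k hk => ?_
  simp only [mem_range] at hk
  rw [h.triple.sub_third h.eigX, hv k (by omega)]

theorem cn_x_v_zero (h : Bases q r d s t z X Y Z v w x) {N : ℕ} (hN : N ≤ d) :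
    cn x N (vn v 0) * cn v 0 (vn x 0) = ovl q r d s z t 0 * kk q d z s t N *
      ∏ j ∈ range N, (sub X x j * (th q r z N - th q r z j) / ph q r d z s t (j + 1)) := by
  rw [h.sysZX.overlap hN, h.sysZX.gen.ovl_eq_kk hN, h.ovl_comm, prod_div_distrib, prod_mul_distrib]
  ring

/-- The product is invariant under rescaling x_N. Accordingly the factor S of subdiagonal entries,
present in the weight (`cn_x_v_zero`) and in the polynomial (`Sys.racah`), cancels, and the first
column contributes f_M/f_0. -/
theorem cn_mul_cn (h : Bases q r d s t z X Y Z v w x) (hv : ∀ n < d, sub Y v n = lw q r d s t z n)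
    {M N : ℕ} (hM : M ≤ d) (hN : N ≤ d) :
    cn x N (vn v 0) * cn v M (vn x N) =
      (∏ k ∈ range M, (((s * (q ^ 2) ^ k * q ^ 2)⁻¹ + q⁻¹ * t⁻¹ * z) /
        (s * (q ^ 2) ^ k + q⁻¹ * t⁻¹ * z))) *
      ((nn q d s z t)⁻¹ * kk q d z s t N * Rg q r d z s t N M) := by
  have h0 := h.cn_v_x_zero hv (Nat.zero_le d)
  have h1 := h.cn_v_x_zero hv hM
  have h2 := h.cn_x_v_zero hN
  have h3 := h.sysZX.racah hN M
  have h4 := h.sysXZ.gen.ovl_zero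
  have h5 := h.sysXZ.gen.ovl_ne (M := 0)
  rw [inv_eq_of_mul_eq_one_left h4]
  rw [prod_range_zero, mul_one] at h0
  generalize (∏ k ∈ range M, _ : ℂ) = F at *
  generalize (∏ j ∈ range N, _ : ℂ) = S at *
  apply mul_left_cancel₀ h5
  rw [← h0] at h1 h2 h5 ⊢
  linear_combination (cn v M) (vn x N) * cn x 0 (vn v 0) * h2 +
    cn v 0 (vn x 0) * cn x 0 (vn v 0) * cn x 0 (vn v 0) * kk q d z s t N * h3 +
    cn v 0 (vn x 0) * cn x 0 (vn v 0) * kk q d z s t N * Rg q r d z s t N M * h1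

theorem cn_x_v_ne (h : Bases q r d s t z X Y Z v w x) {N : ℕ} (hN : N ≤ d) :
    cn x N (vn v 0) ≠ 0 := fun h0 => by
  have h1 := h.sysZX.overlap hN
  rw [h0, zero_mul] at h1
  exact mul_ne_zero (prod_ne_zero_iff.mpr fun k hk => h.sysZX.sub_ne k (by simp at hk; omega))
    h.sysZX.gen.ovl_ne h1.symm

/-- The two explicit `q`-Racah matrices are inverse to each other. -/
theorem orthogonality (h : Bases q r d s t z X Y Z v w x)
    (hv : ∀ n < d, sub Y v n = lw q r d s t z n) {M N : ℕ} (hM : M ≤ d) (hN : N ≤ d) :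
    ∑ k ∈ range (d + 1), kk q d s z t k * Rg q r d z s t M k *
      ((nn q d s z t)⁻¹ * kk q d z s t N * Rg q r d z s t N k) = if M = N then 1 else 0 := by
  have h5 := h.sysXZ.gen.ovl_ne (M := 0)
  -- Each summand is an overlap of x_N with v_k times an overlap of v_k with x_M. One comes from
  -- `cn_mul_cn`, the other from `Sys.racah` for (X, Z), and the factors f cancel between them.
  -- Summing over k is then the resolution of the identity in v.
  have key : ∀ k ≤ d, cn x M (vn v 0) * (kk q d s z t k * Rg q r d z s t M k *
      ((nn q d s z t)⁻¹ * kk q d z s t N * Rg q r d z s t N k)) =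
      cn v k (vn x N) * cn x M (vn v k) * cn x N (vn v 0) := by
    intro k hk
    have h0 := h.cn_v_x_zero hv (Nat.zero_le d)
    have h1 := h.cn_v_x_zero hv hk
    have h2 := h.sysXZ.overlap hk
    have h3 := h.sysXZ.racah hk M
    have h4 := h.cn_mul_cn hv hk hN
    have hS : ∏ j ∈ range k, sub Z v j ≠ 0 :=
      prod_ne_zero_iff.mpr fun k hk => h.sysXZ.sub_ne k (by simp at hk; omega)
    have h7 := h.sysXZ.gen.ovl_ne (M := k)
    rw [h1] at h2
    have hF := (mul_ne_zero_iff.mp (h2.trans_ne (mul_ne_zero hS h7))).2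
    rw [h.sysXZ.gen.ovl_eq_kk hk] at h2
    rw [Rg_swap, prod_div_distrib, prod_mul_distrib] at h3
    rw [← mul_left_inj' hF]
    generalize (∏ j ∈ range k, sub Z v j) = S at *
    generalize (∏ k ∈ range k, (_ : ℂ) / _) = F at *
    generalize (∏ k ∈ range k, (th q r s _ - _)) = T1 at *
    generalize (∏ k ∈ range k, ph q r d s z t _) = T2 at *
    have h2' : F = S * (kk q d s z t k * (T1 / T2)) := by
      apply mul_left_cancel₀ h5
      linear_combination h2
    linear_combination (-cn x M (vn v 0) * (kk q d s z t k * Rg q r d z s t M k)) * h4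
      - kk q d s z t k * cn x N (vn v 0) * cn v k (vn x N) * h3
      - cn v k (vn x N) * cn x M (vn v k) * cn x N (vn v 0) * h2'
  apply mul_left_cancel₀ (h.cn_x_v_ne hM)
  rw [mul_sum, sum_congr rfl fun k hk => key k (by simpa [Nat.lt_succ_iff] using hk), ← sum_mul]
  have : vn x N = ∑ k ∈ range (d + 1), cn v k (vn x N) • vn v k := (sum_cn v _).symm
  have h6 := congrArg (cn x M) this
  rw [cn_vn x hM, map_sum] at h6
  simp only [map_smul, smul_eq_mul] at h6
  rw [← h6]
  split_ifs with hMN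
  · rw [hMN]; ring
  · ring

/-- The overlaps of x_N with w_0 and with v_0 are compared through `h_step`; this allows the
reference state |θ*_0⟩ to be treated by the same matrix as |θ_0⟩. -/
theorem cn_x_w_zero (h : Bases q r d s t z X Y Z v w x) {N : ℕ} (hN : N ≤ d) :
    cn x N (vn w 0) * (cn w 0 (vn x 0) * (cn x 0 (vn v 0) *
      ∏ k ∈ range N, (((q ^ 2) ^ k) ^ 2 * z ^ 2 *
      (((z * (q ^ 2) ^ k)⁻¹ + q * t⁻¹ * s) / (z * (q ^ 2) ^ k + q⁻¹ * t⁻¹ * s))))) *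
      nn q d z t s = cn x N (vn v 0) := by
  have h1 := h.sysZY.overlap hN
  have h2 := h.sysZX.overlap hN
  have h3 := h.triple.gen.h_step hN
  have h4 := h.sysZY.gen.ovl_zero
  have h5 := h.sysZX.overlap (Nat.zero_le d)
  have h6 := h.sysZX.gen.ovl_ne (M := 0)
  rw [prod_range_zero, one_mul] at h5
  simp only [h.triple.sub_first h.eigZ] at h2
  rw [prod_mul_distrib] at h2
  generalize (∏ k ∈ range N, (_ : ℂ) * ((_ : ℂ) / _)) = F at *
  generalize (∏ k ∈ range N, sub Y x k) = S at *
  generalize (∏ k ∈ range N, z * (q ^ 2) ^ k * q) = T at *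
  generalize ovl q r d z t s N = O1 at *
  generalize ovl q r d z t s 0 = O2 at *
  generalize ovl q r d z s t N = O3 at *
  generalize ovl q r d z s t 0 = O4 at *
  generalize nn q d z t s = n at *
  rw [← h5] at h3 h6
  apply mul_left_cancel₀ h6
  generalize cn x N (vn w 0) = a1 at *
  generalize cn x N (vn v 0) = a2 at *
  generalize cn x 0 (vn v 0) = a3 at *
  generalize cn v 0 (vn x 0) = a4 at *
  generalize cn w 0 (vn x 0) = a5 at *
  linear_combination a3 * a4 * a3 * F * n * h1 + a3 * n * S * h3 - a3 * n * O2 * h2 + a3 * a2 * a4 * h4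

/-- The string of Z over all eigenvalues but θ⋄_0 sends v_0 to a multiple of x_0. Its expansion in
the split basis of (X, Y) is `Sys.third_str` with z reversed, so that θ⋄_0 is the eigenvalue left
out. -/
theorem triple_product (h : Bases q r d s t z X Y Z v w x) :
    cn v 0 (vn w 0) * cn w 0 (vn x 0) * cn x 0 (vn v 0) * ((-1) ^ d * (∏ k ∈ range d, (q ^ 2) ^ k) *
        ((poch q (s ^ 2 * q ^ 2) d * poch q (z ^ 2 * q ^ 2) d * poch q (t ^ 2 * q ^ 2) d) /
          (poch q (-(q * s * z / t)) d * poch q (-(q * s * t / z)) d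
            * poch q (-(q * z * t / s)) d))) = 1 := by
  have hq := h.triple.gen.q0
  have hz := h.triple.gen.z0
  have hO := omg_reverse_third (r := r) (d := d) (s := s) (t := t) hq hz
  have hsys : Sys q r d s t (z * (q ^ 2) ^ d)⁻¹ X Y v w := by
    refine ⟨h.triple.gen.reverse_third, h.eigX, h.eigY, ?_, ?_, h.sub_v_ne⟩ <;> rw [hO]
    exacts [h.sysXY.relX, h.sysXY.relY]
  have h1 := hsys.third_str (Nat.le_succ d)
  rw [hO, ← h.triple.eqZ] at h1
  have hP : ∏ k ∈ range d, (th q r z 0 - th q r (z * (q ^ 2) ^ d)⁻¹ k) =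
      ∏ k ∈ range d, (th q r z 0 - th q r z (k + 1)) := by
    rw [← prod_range_reflect]
    refine prod_congr rfl fun k hk => ?_
    simp only [mem_range] at hk
    rw [th_rev hq hz (by omega), show d - 1 - k = d - (k + 1) by omega]
    congr 2
    omega
  have h2 : str Z (th q r (z * (q ^ 2) ^ d)⁻¹) (vn v 0) d =
      ((∏ k ∈ range d, (th q r z 0 - th q r z (k + 1))) * cn x 0 (vn v 0)) • vn x 0 := by
    apply cn_ext x
    intro N hN
    rw [h.eigZ.cn_str, map_smul, cn_vn x hN]
    rcases Nat.eq_zero_or_pos N with rfl | hN0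
    · rw [hP]; simp
    · rw [if_neg (by omega), prod_eq_zero (i := d - N) (by simp; omega), zero_mul, smul_zero]
      rw [th_rev hq hz (by omega), Nat.sub_sub_self hN, sub_self]
  rw [h2] at h1
  -- All split vectors except v_0 itself contain the factor Y - θ*_0 and have no component along
  -- w_0.
  have h3 := congrArg (cn w 0) h1
  rw [map_sum, sum_eq_single 0] at h3
  · have h4 := h.sysXY.overlap (Nat.zero_le d)
    have h5 := h.triple.gen.triple_overlap
    have hne := h.sysXZ.gen.prod_th_ne
    rw [prod_range_zero, one_mul] at h4
    rw [← h4] at h5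
    refine Eq.trans ?_ h5
    rw [map_smul, map_smul, Nat.sub_zero, spl, str] at h3
    simp only [smul_eq_mul] at h3
    congr 1
    rw [eq_div_iff hne]
    linear_combination cn v 0 (vn w 0) * h3
  · intro k _ hk
    rw [map_smul, spl, h.eigY.cn_str, prod_eq_zero (i := 0) (by simp; omega) (sub_self _), zero_mul,
      smul_zero]
  · simp

end Bases

end LeonardBethe

/-! ### Bethe states as polynomials in A⋄ -/

namespace LeonardBethe

open Finset Idx

variable {V : Type*} [AddCommGroup V] [Module ℂ V]

theorem cn_prod_ofFn {d : ℕ} {x : Module.Basis (Fin (d + 1)) ℂ V} {N n : ℕ}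
    {L : Fin n → Module.End ℂ V} {a : Fin n → ℂ} (h : ∀ i y, cn x N (L i y) = a i * cn x N y)
    (y : V) : cn x N ((List.ofFn L).prod y) = (∏ i, a i) * cn x N y := by
  induction n with
  | zero => simp
  | succ n ih =>
    rw [List.ofFn_succ, List.prod_cons, Module.End.mul_apply, h, ih fun i => h i.succ,
      Fin.prod_univ_succ, mul_assoc]

theorem prod_zpow_reverse {q : ℂ} (hq : q ≠ 0) (n : ℕ) :
    ∏ i : Fin n, q ^ (2 * ((n : ℤ) - 1 - (i : ℤ)) + 2) = (q ^ ((n : ℤ) + 1)) ^ n := by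
  rw [Fin.prod_univ_eq_prod_range (fun i : ℕ => q ^ (2 * ((n : ℤ) - 1 - (i : ℤ)) + 2)),
    ← prod_range_reflect]
  have : ∀ i ∈ range n, q ^ (2 * ((n : ℤ) - 1 - ((n - 1 - i : ℕ) : ℤ)) + 2) =
      q ^ (2 * (i : ℤ) + 2) := by
    intro i hi
    simp only [mem_range] at hi
    congr 1
    omega
  rw [prod_congr rfl this]
  clear this
  induction n with
  | zero => simp
  | succ n ih =>
    rw [prod_range_succ, ih, ← zpow_natCast, ← zpow_natCast, ← zpow_mul, ← zpow_mul,
      ← zpow_add₀ hq]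
    congr 1
    push_cast
    ring

namespace Params

variable {p : Params} {A As : Module.End ℂ V}

/-- At β = 0 only [A*, A]_q and the identity remain, and ω occurs exactly in the combination
defining A⋄. The u-dependence of the rest is U(u). -/
theorem Admissible.dynBMinus_eq (hp : p.Admissible) {α χ u : ℂ} (hα : α ≠ 0) (hχ : χ ≠ 0)
    (hu : u ≠ 0) (m : ℤ) : p.dynBMinus A As α 0 χ u m =
      (bfun (u ^ 2) * u * p.q ^ (m + 2) * (p.q + p.q⁻¹) * (χ / (α * (p.q ^ 2 - (p.q ^ 2)⁻¹)))) •
        (p.U u • (1 : Module.End ℂ V) - (p.r0 / (p.q + p.q⁻¹)) • p.Adiam A As) := by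
  have hq := hp.q_ne_zero
  have hr := hp.r0_ne_zero
  have h1 := hp.gen.q2_sub_ne
  have h2 := hp.gen.q_sub_ne
  have h3 : p.q + p.q⁻¹ ≠ 0 := by
    rw [hp.gen.q_add]
    exact div_ne_zero h1 h2
  have hm : p.q ^ m ≠ 0 := zpow_ne_zero _ hq
  have e : p.q ^ 2 - (p.q ^ 2)⁻¹ = (p.q - p.q⁻¹) * (p.q + p.q⁻¹) := by field_simp; ring
  have e1 : p.q ^ (2 * m + 1) = (p.q ^ m) ^ 2 * p.q := by
    rw [zpow_add₀ hq, mul_comm 2 m, zpow_mul, zpow_one]; norm_cast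
  have e2 : p.q ^ (m + 2) = p.q ^ m * p.q ^ 2 := by rw [zpow_add₀ hq]; norm_cast
  have e3 : p.q ^ (-m - 1) = (p.q ^ m)⁻¹ * p.q⁻¹ := by
    rw [zpow_sub₀ hq, zpow_neg, zpow_one, div_eq_mul_inv]
  have e4 : p.q ^ (-m - 4) = (p.q ^ m)⁻¹ * (p.q ^ 4)⁻¹ := by
    rw [zpow_sub₀ hq, zpow_neg, div_eq_mul_inv]; norm_cast
  unfold dynBMinus Adiam om rho U
  rw [show bfun (p.q ^ 2) = p.q ^ 2 - (p.q ^ 2)⁻¹ from rfl, e1, e2, e3, e4]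
  generalize bfun (u ^ 2) = b
  generalize p.omega pt st di = ω
  generalize qComm p.q As A = C
  generalize p.q ^ m = x at *
  have e5 : p.q ^ 2 + 1 = p.q * (p.q + p.q⁻¹) := by field_simp
  rw [e5, e]
  generalize p.q - p.q⁻¹ = k at *
  generalize p.q + p.q⁻¹ = l at *
  simp only [zero_mul, sub_zero, zero_div, zero_smul, add_zero, zero_sub, ne_eq,
    OfNat.ofNat_ne_zero, not_false_eq_true, zero_pow]
  match_scalars
  · field_simp
  · field_simp
    ring

theorem Admissible.dynBPlus_eq (hp : p.Admissible) {α χ u : ℂ} (hα : α ≠ 0) (hχ : χ ≠ 0)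
    (hu : u ≠ 0) (m : ℤ) : p.dynBPlus A As α 0 χ u m =
      (bfun (u ^ 2) * u⁻¹ * p.q ^ (-m - 2) * (p.q + p.q⁻¹) *
        (χ / (α * (p.q ^ 2 - (p.q ^ 2)⁻¹)))) •
        (p.U u • (1 : Module.End ℂ V) - (p.r0 / (p.q + p.q⁻¹)) • p.Adiam A As) := by
  have hq := hp.q_ne_zero
  have hr := hp.r0_ne_zero
  have h1 := hp.gen.q2_sub_ne
  have h2 := hp.gen.q_sub_ne
  have h3 : p.q + p.q⁻¹ ≠ 0 := by
    rw [hp.gen.q_add]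
    exact div_ne_zero h1 h2
  have hm : p.q ^ m ≠ 0 := zpow_ne_zero _ hq
  have e : p.q ^ 2 - (p.q ^ 2)⁻¹ = (p.q - p.q⁻¹) * (p.q + p.q⁻¹) := by field_simp; ring
  have e1 : p.q ^ (2 * m + 2) = (p.q ^ m) ^ 2 * p.q ^ 2 := by
    rw [zpow_add₀ hq, mul_comm 2 m, zpow_mul]; norm_cast
  have e2 : p.q ^ (-m - 2) = (p.q ^ m)⁻¹ * (p.q ^ 2)⁻¹ := by
    rw [zpow_sub₀ hq, zpow_neg, div_eq_mul_inv]; norm_cast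
  have e3 : p.q ^ (2 * m) = (p.q ^ m) ^ 2 := by
    rw [mul_comm 2 m, zpow_mul]; norm_cast
  have e4 : p.q ^ (-m - 3) = (p.q ^ m)⁻¹ * (p.q ^ 3)⁻¹ := by
    rw [zpow_sub₀ hq, zpow_neg, div_eq_mul_inv]; norm_cast
  unfold dynBPlus Adiam om rho U
  rw [show bfun (p.q ^ 2) = p.q ^ 2 - (p.q ^ 2)⁻¹ from rfl, e1, e2, e3, e4]
  generalize bfun (u ^ 2) = b
  generalize p.omega pt st di = ω
  generalize qComm p.q As A = C
  generalize p.q ^ m = x at *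
  have e5 : p.q ^ 2 + 1 = p.q * (p.q + p.q⁻¹) := by field_simp
  rw [e5, e]
  generalize p.q - p.q⁻¹ = k at *
  generalize p.q + p.q⁻¹ = l at *
  simp only [zero_mul, sub_zero, zero_div, zero_smul, add_zero, zero_sub, ne_eq,
    OfNat.ofNat_ne_zero, not_false_eq_true, zero_pow]
  match_scalars
  · field_simp
  · field_simp
    ring

theorem Admissible.cn_psiMinus (hp : p.Admissible) {x : Module.Basis (Fin (p.d + 1)) ℂ V}
    (hx : Eig (p.Adiam A As) x (th p.q p.r0 (p.B di))) {α χ : ℂ} (hχ : χ ≠ 0) {m : ℤ}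
    (h : (p.q ^ 2 - (p.q ^ 2)⁻¹) * χ⁻¹ * α * p.b pt * p.q ^ (-m) = -1) {n : ℕ} {u : Fin n → ℂ}
    (hu : ∀ i, u i ≠ 0) (N : ℕ) (y : V) : cn x N (p.psiMinus A As α χ n u m y) =
      p.GMinus n u * (∏ i, (p.U (u i) - p.r0 / (p.q + p.q⁻¹) * p.theta di N)) * cn x N y := by
  have hq := hp.q_ne_zero
  have h1 := hp.gen.q2_sub_ne
  have hb := hp.b_ne pt
  have hα : α ≠ 0 := by rintro rfl; simp at h
  have hm : p.q ^ m ≠ 0 := zpow_ne_zero _ hq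
  -- The constraint on α and χ is what makes the state independent of them and, after cancelling
  -- q^m, of m.
  have e : χ / (α * (p.q ^ 2 - (p.q ^ 2)⁻¹)) = -p.b pt * p.q ^ (-m) := by
    rw [div_eq_iff (mul_ne_zero hα h1)]
    linear_combination χ * h - p.b pt * p.q ^ (-m) * α * (p.q ^ 2 - (p.q ^ 2)⁻¹) *
      mul_inv_cancel₀ hχ
  rw [psiMinus, bString, cn_prod_ofFn (a := fun i => (p.q ^ (2 * ((n : ℤ) - 1 - (i : ℤ)) + 2) *
    (-(p.q + p.q⁻¹) * p.b pt) * (bfun (u i ^ 2) * u i)) *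
    (p.U (u i) - p.r0 / (p.q + p.q⁻¹) * p.theta di N))]
  · congr 1
    rw [prod_mul_distrib, prod_mul_distrib, prod_mul_distrib, GMinus]
    congr 2
    rw [prod_const, card_univ, Fintype.card_fin, prod_zpow_reverse hq, ← mul_pow]
    ring
  · intro i y
    rw [hp.dynBMinus_eq hα hχ (hu i), e, hp.theta_eq]
    simp only [LinearMap.smul_apply, LinearMap.sub_apply, map_smul, map_sub, hx.cn, smul_eq_mul,
      Module.End.one_apply]
    rw [show m + 2 * ((n : ℤ) - 1 - (i : ℤ)) + 2 = m + (2 * ((n : ℤ) - 1 - (i : ℤ)) + 2) by ring,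
      zpow_add₀ hq, zpow_neg]
    field_simp

theorem Admissible.cn_psiPlus (hp : p.Admissible) {x : Module.Basis (Fin (p.d + 1)) ℂ V}
    (hx : Eig (p.Adiam A As) x (th p.q p.r0 (p.B di))) {α χ : ℂ} (hχ : χ ≠ 0) {m : ℤ}
    (h : (p.q ^ 2 - (p.q ^ 2)⁻¹) * χ⁻¹ * α * p.c st * p.q ^ m = 1) {n : ℕ} {u : Fin n → ℂ}
    (hu : ∀ i, u i ≠ 0) (N : ℕ) (y : V) : cn x N (p.psiPlus A As α χ n u m y) =
      p.GPlus n u * (∏ i, (p.U (u i) - p.r0 / (p.q + p.q⁻¹) * p.theta di N)) * cn x N y := by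
  have hq := hp.q_ne_zero
  have h1 := hp.gen.q2_sub_ne
  have hα : α ≠ 0 := by rintro rfl; simp at h
  have hm : p.q ^ m ≠ 0 := zpow_ne_zero _ hq
  have e : χ / (α * (p.q ^ 2 - (p.q ^ 2)⁻¹)) = p.c st * p.q ^ m := by
    rw [div_eq_iff (mul_ne_zero hα h1)]
    linear_combination (-χ) * h + p.c st * p.q ^ m * α * (p.q ^ 2 - (p.q ^ 2)⁻¹) *
      mul_inv_cancel₀ hχ
  rw [psiPlus, bString, cn_prod_ofFn (a := fun i => (p.q ^ (-(2 * ((n : ℤ) - 1 - (i : ℤ)) + 2)) *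
    ((p.q + p.q⁻¹) * p.c st) * (bfun (u i ^ 2) * (u i)⁻¹)) *
    (p.U (u i) - p.r0 / (p.q + p.q⁻¹) * p.theta di N))]
  · congr 1
    rw [prod_mul_distrib, prod_mul_distrib, prod_mul_distrib, GPlus]
    congr 2
    -- The exponents are opposite to those of the minus case, so the same product formula is used
    -- with q⁻¹.
    simp only [← inv_zpow']
    rw [prod_const, card_univ, Fintype.card_fin, prod_zpow_reverse (inv_ne_zero hq), ← mul_pow]
    ring
  · intro i y
    rw [hp.dynBPlus_eq hα hχ (hu i), e, hp.theta_eq]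
    simp only [LinearMap.smul_apply, LinearMap.sub_apply, map_smul, map_sub, hx.cn, smul_eq_mul,
      Module.End.one_apply]
    rw [show -(m + 2 * ((n : ℤ) - 1 - (i : ℤ))) - 2 = -m + -(2 * ((n : ℤ) - 1 - (i : ℤ)) + 2) by
      ring, zpow_add₀ hq, zpow_neg]
    field_simp

end Params

end LeonardBethe

/-! ### Normalized eigenbases and the scalar products of the theorem -/

namespace LeonardBethe

open Finset Idx

variable {V : Type*} [AddCommGroup V] [Module ℂ V] {p : Params} {A As : Module.End ℂ V}

theorem sub_fin {d : ℕ} (Y : Module.End ℂ V) (v : Module.Basis (Fin (d + 1)) ℂ V) (M : Fin d) :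
    sub Y v M = v.repr (Y (v M.castSucc)) M.succ := by
  rw [sub, ← cn_fin, ← vn_fin]
  rfl

theorem IrreducibleTridiagonal.lower {d : ℕ} {Y : Module.End ℂ V}
    {v : Module.Basis (Fin (d + 1)) ℂ V} (h : IrreducibleTridiagonal (LinearMap.toMatrix v v Y))
    (n : ℕ) (hn : n < d) : sub Y v n ≠ 0 := by
  have := h.2 (Fin.succ ⟨n, hn⟩) (Fin.castSucc ⟨n, hn⟩) (Or.inr rfl)
  rw [LinearMap.toMatrix_apply] at this
  exact (sub_fin Y v ⟨n, hn⟩).trans_ne this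

theorem IrreducibleTridiagonal.upper {d : ℕ} {Y : Module.End ℂ V}
    {v : Module.Basis (Fin (d + 1)) ℂ V} (h : IrreducibleTridiagonal (LinearMap.toMatrix v v Y))
    (n : ℕ) (hn : n < d) : cn v n (Y (vn v (n + 1))) ≠ 0 := by
  have := h.2 (Fin.castSucc ⟨n, hn⟩) (Fin.succ ⟨n, hn⟩) (Or.inl rfl)
  rw [LinearMap.toMatrix_apply, ← cn_fin, ← vn_fin] at this
  exact this

theorem Params.IsEigenbasis.eig {a : Idx} {X : Module.End ℂ V}
    {v : Module.Basis (Fin (p.d + 1)) ℂ V} (h : p.IsEigenbasis a X v) (hp : p.Admissible) :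
    Eig X v (th p.q p.r0 (p.B a)) := fun M => by
  rw [h M, hp.theta_eq]

theorem Eig.isEigenbasis {a : Idx} {X : Module.End ℂ V} {v : Module.Basis (Fin (p.d + 1)) ℂ V}
    (h : Eig X v (th p.q p.r0 (p.B a))) (hp : p.Admissible) : p.IsEigenbasis a X v := fun M => by
  rw [h M, hp.theta_eq]

theorem Params.Admissible.lowAB_ne (hp : p.Admissible) {a b c : Idx}
    (hg : Gen p.q p.r0 p.d (p.B b) (p.B a) (p.B c)) {j : ℕ} (hj : j < p.d) :
    p.lowAB a b c (j + 1) ≠ 0 := by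
  rw [hp.lowAB_eq]
  exact hg.reverse_third.lw_ne hj

/-- Eigenvectors of A⋄ come from its string on |θ_0⟩, and irreducibility of the pair gives nonzero
subdiagonal entries in that basis. Rescaling then meets all normalizations, and the scalars at index
0 are nonzero because the overlaps are. -/
theorem IsLeonardPair.exists_normalizedBases (hA : IsLeonardPair p A As) (hp : p.Admissible) :
    ∃ (v w x : Module.Basis (Fin (p.d + 1)) ℂ V) (f0 g0 h0 : ℂ),
      NormalizedBases p A As v w x f0 g0 h0 := by
  obtain ⟨v₀, hv₀, hv₁⟩ := hA.diag_A
  obtain ⟨w₀, hw₀, hw₁⟩ := hA.diag_As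
  have hg := hp.gen
  have hT := hA.triple hp
  have ev₀ := hv₀.eig hp
  have ew₀ := hw₀.eig hp
  have hsys : Sys p.q p.r0 p.d (p.B pt) (p.B st) (p.B di) A As v₀ w₀ :=
    ⟨hg, ev₀, ew₀, hT.rot.relZX, hT.relYX, hv₁.lower⟩
  have hsep : ∀ i j, i ≤ p.d → j ≤ p.d → i ≠ j →
      th p.q p.r0 (p.B di) i - th p.q p.r0 (p.B di) j ≠ 0 := fun i j hi hj hij =>
    hg.rot.th_sub_ne hij (by omega)
  have hstr := hsys.third_str_succ
  rw [← hT.eqZ] at hstr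
  obtain ⟨x₀, ex₀⟩ := exists_eigenbasis v₀ hsep fun N hN =>
    exists_eigenvector (hT.relZX.tri hg.rot.rot ev₀) (fun n hn => by
      rw [hT.sub_third ev₀]
      exact mul_ne_zero (inv_ne_zero (mul_ne_zero (mul_ne_zero hg.s0 (hg.Q0 n)) hg.q0))
        (hv₁.lower n hn)) hsep hstr hN
  have hx₁ : ∀ n < p.d, sub As x₀ n ≠ 0 := fun n hn =>
    hT.sub_ne ev₀ hv₁.lower hv₁.upper ex₀ hn
  obtain ⟨v, ev, sv, v0⟩ := exists_rescale ev₀ hv₁.lower (τ := fun n => p.lowBA pt st di (n + 1))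
    (fun n hn => by rw [hp.lowBA_eq]; exact hg.lw_ne hn) one_ne_zero
  obtain ⟨x, ex, sx, -⟩ := exists_rescale ex₀ hx₁ (τ := fun n => p.lowAB st di pt (n + 1))
    (fun n hn => hp.lowAB_ne hg.rot.swap hn) one_ne_zero
  have hb : Bases p.q p.r0 p.d (p.B pt) (p.B st) (p.B di) A As (p.Adiam A As) v w₀ x :=
    ⟨hT, ev, ew₀, ex, fun n hn => by rw [sv n hn, hp.lowBA_eq]; exact hg.lw_ne hn,
      fun n hn => by rw [sx n hn]; exact hp.lowAB_ne hg.rot.swap hn⟩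
  -- The basis of A* is rescaled last: its overall factor is fixed by the coefficient of |θ_0⟩ in
  -- |θ*_0⟩, which must first be known to be nonzero.
  have hne := hb.sysXY.overlap_zero_ne.1
  obtain ⟨w, ew, sw, w0⟩ := exists_rescale ew₀ hw₁.lower (τ := fun n => p.lowAB pt st di (n + 1))
    (fun n hn => hp.lowAB_ne hg.swap hn) (inv_ne_zero hne)
  have hb' : Bases p.q p.r0 p.d (p.B pt) (p.B st) (p.B di) A As (p.Adiam A As) v w x :=
    ⟨hT, ev, ew, ex, hb.sub_v_ne, hb.sub_x_ne⟩
  have cz : ∀ (b b' : Module.Basis (Fin (p.d + 1)) ℂ V),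
      b.repr (b' 0) 0 = cn b 0 (vn b' 0) := fun b b' => by
    rw [← cn_fin, ← vn_fin]; rfl
  refine ⟨v, w, x, 1, w.repr (x 0) 0, x.repr (v 0) 0, ev.isEigenbasis hp, ew.isEigenbasis hp,
    ex.isEigenbasis hp, fun M => ?_, fun M => ?_, fun M => ?_, one_ne_zero, ?_, ?_, ?_, rfl, ?_⟩
  · rw [← sub_fin, sv M M.2]
  · rw [← sub_fin, sw M M.2]
  · rw [← sub_fin, sx M M.2]
  · rw [cz]
    exact hb'.sysZY.overlap_zero_ne.2
  · rw [cz]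
    exact hb'.sysXZ.overlap_zero_ne.2
  · rw [cz, w0, map_smul, smul_eq_mul, inv_mul_cancel₀ hne]
  · rw [div_one]

namespace NormalizedBases

variable {v w x : Module.Basis (Fin (p.d + 1)) ℂ V} {f0 g0 h0 : ℂ}

theorem sub_v (h : NormalizedBases p A As v w x f0 g0 h0) (hp : p.Admissible) :
    ∀ n < p.d, sub As v n = lw p.q p.r0 p.d (p.B pt) (p.B st) (p.B di) n := fun n hn => by
  rw [← hp.lowBA_eq]
  exact (sub_fin As v ⟨n, hn⟩).trans (h.norm_v ⟨n, hn⟩)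

theorem bases (h : NormalizedBases p A As v w x f0 g0 h0) (hA : IsLeonardPair p A As)
    (hp : p.Admissible) :
    Bases p.q p.r0 p.d (p.B pt) (p.B st) (p.B di) A As (p.Adiam A As) v w x := by
  refine ⟨hA.triple hp, h.eigen_v.eig hp, h.eigen_w.eig hp, h.eigen_x.eig hp,
    fun n hn => ?_, fun n hn => ?_⟩
  · rw [h.sub_v hp n hn]
    exact hp.gen.lw_ne hn
  · exact ((sub_fin As x ⟨n, hn⟩).trans (h.norm_x ⟨n, hn⟩)).trans_ne
      (hp.lowAB_ne hp.gen.rot.swap hn)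

theorem cn_v_w (h : NormalizedBases p A As v w x f0 g0 h0) : cn v 0 (vn w 0) = 1 := by
  rw [← h.v_w, ← cn_fin, ← vn_fin]; rfl

theorem cn_w_x (h : NormalizedBases p A As v w x f0 g0 h0) : cn w 0 (vn x 0) = g0 := by
  rw [← h.w_x, ← cn_fin, ← vn_fin]; rfl

theorem cn_x_v (h : NormalizedBases p A As v w x f0 g0 h0) : cn x 0 (vn v 0) = h0 / f0 := by
  rw [← h.x_v, ← cn_fin, ← vn_fin]; rfl

/-- In the chosen normalization the three overlaps of `Bases.triple_product` are 1, g₀ and h₀/f₀. -/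
theorem scalar_product (h : NormalizedBases p A As v w x f0 g0 h0) (hA : IsLeonardPair p A As)
    (hp : p.Admissible) :
    f0 * h0⁻¹ * g0⁻¹ = (-1) ^ p.d * p.q ^ ((p.d : ℤ) * ((p.d : ℤ) - 1)) *
        ((poch p.q (p.q ^ 2 * p.r0 ^ 2 * p.b pt ^ 2) p.d
            * poch p.q (p.q ^ 2 * p.r0 ^ 2 * p.b di ^ 2) p.d
            * poch p.q (p.q ^ 2 * p.r0 ^ 2 * p.b st ^ 2) p.d) /
          (poch p.q (-(p.q * p.r0 * p.b pt * p.b di / p.b st)) p.d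
            * poch p.q (-(p.q * p.r0 * p.b pt * p.b st / p.b di)) p.d
            * poch p.q (-(p.q * p.r0 * p.b di * p.b st / p.b pt)) p.d)) := by
  have hr := hp.r0_ne_zero
  have hT := (h.bases hA hp).triple_product
  have hB : ∀ a, p.q ^ 2 * p.r0 ^ 2 * p.b a ^ 2 = p.B a ^ 2 * p.q ^ 2 := fun a => by
    unfold Params.B; ring
  have hK : ∀ a b c, p.q * p.r0 * p.b a * p.b b / p.b c = p.q * p.B a * p.B b / p.B c :=
    fun a b c => by
      have := hp.b_ne c
      unfold Params.B
      field_simp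
  have hQ : p.q ^ ((p.d : ℤ) * ((p.d : ℤ) - 1)) = ∏ k ∈ range p.d, (p.q ^ 2) ^ k := by
    generalize p.d = d
    induction d with
    | zero => simp
    | succ d ih =>
      rw [prod_range_succ, ← ih, ← zpow_two_mul_cast, ← zpow_add₀ hp.q_ne_zero]
      congr 1
      push_cast
      ring
  rw [hB, hB, hB, hK, hK, hK, hQ]
  rw [h.cn_v_w, h.cn_w_x, h.cn_x_v, one_mul] at hT
  rw [eq_inv_of_mul_eq_one_right hT, mul_inv, inv_div, div_eq_mul_inv]
  ring

theorem cn_mul_cn (h : NormalizedBases p A As v w x f0 g0 h0) (hA : IsLeonardPair p A As)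
    (hp : p.Admissible) (M N : Fin (p.d + 1)) :
    cn x N (vn v 0) * cn v M (vn x N) = p.fSeq f0 M / f0 * p.Pinv di pt st M N := by
  rw [(h.bases hA hp).cn_mul_cn (h.sub_v hp) (by omega) (by omega), hp.fSeq_eq,
    mul_div_cancel_left₀ _ h.f0_ne_zero, Params.Pinv, Matrix.of_apply, hp.nu0_eq, hp.kBAC_eq,
    hp.racahR_eq hp.gen.rot.rot (by omega)]

theorem cn_w_mul_cn (h : NormalizedBases p A As v w x f0 g0 h0) (hA : IsLeonardPair p A As)
    (hp : p.Admissible) (M N : Fin (p.d + 1)) :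
    cn x N (vn w 0) * cn v M (vn x N) =
      p.fSeq f0 M / (g0 * p.nu0 st di pt) * (1 / p.hSeq h0 N * p.Pinv di pt st M N) := by
  have h1 := h.cn_mul_cn hA hp M N
  have h2 := (h.bases hA hp).cn_x_w_zero (N := N) (by omega)
  have h3 := (h.bases hA hp).cn_x_v_ne (N := N) (by omega)
  rw [h.cn_w_x, h.cn_x_v, div_mul_eq_mul_div, ← hp.hSeq_eq, ← hp.nu0_eq st di pt] at h2
  rw [← h2] at h1 h3
  simp only [mul_ne_zero_iff, div_ne_zero_iff] at h3
  obtain ⟨⟨-, hg, hh, hf⟩, hn⟩ := h3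
  generalize p.hSeq h0 N = H at *
  generalize p.nu0 st di pt = n at *
  field_simp at h1 ⊢
  linear_combination h1

end NormalizedBases

/-- The identity concerns the parameters only; it is read off from any normalized bases, whose
existence the Leonard pair provides. -/
theorem Params.Admissible.P_mul_Pinv (hp : p.Admissible) (hA : IsLeonardPair p A As) :
    p.P di pt st * p.Pinv di pt st = 1 := by
  obtain ⟨v, w, x, f0, g0, h0, h⟩ := hA.exists_normalizedBases hp
  ext M N
  rw [Matrix.mul_apply, Matrix.one_apply]
  have h1 := (h.bases hA hp).orthogonality (h.sub_v hp) (M := M) (N := N) (by omega) (by omega)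
  rw [Finset.sum_range] at h1
  simp only [Fin.ext_iff]
  rw [← h1]
  refine sum_congr rfl fun k _ => ?_
  rw [Params.P, Params.Pinv, Matrix.of_apply, Matrix.of_apply, hp.nu0_eq, hp.kBAC_eq, hp.kABC_eq,
    hp.racahR_eq hp.gen.rot.rot (by omega), hp.racahR_eq hp.gen.rot.rot (by omega)]

/-- A left eigenvector vanishes on the other eigenlines of X, hence is a multiple of a coordinate
form. Quotients by its value on v_M are therefore coordinates. -/
theorem eigenform_apply {d : ℕ} {X : Module.End ℂ V} {v : Module.Basis (Fin (d + 1)) ℂ V}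
    {c : ℕ → ℂ} (hv : Eig X v c) (hc : ∀ i j, i ≤ d → j ≤ d → i ≠ j → c i - c j ≠ 0)
    {M : ℕ} (hM : M ≤ d) {φ : Module.Dual ℂ V} (hφ : φ ∘ₗ X = c M • φ) (y : V) :
    φ y = cn v M y * φ (vn v M) := by
  conv_lhs => rw [← sum_cn v y]
  rw [map_sum, sum_eq_single M]
  · simp
  · intro j hj hjM
    have h1 := LinearMap.congr_fun hφ (vn v j)
    simp only [LinearMap.comp_apply, hv.vn, map_smul, LinearMap.smul_apply, smul_eq_mul] at h1
    have h2 : (c j - c M) * φ (vn v j) = 0 := by linear_combination h1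
    rw [map_smul, (mul_eq_zero.mp h2).resolve_left
      (hc j M (by simpa [Nat.lt_succ_iff] using hj) hM hjM), smul_zero]
  · intro hM'
    simp at hM'
    omega

theorem cn_eq_sum_cn {d : ℕ} (v x : Module.Basis (Fin (d + 1)) ℂ V) (M : ℕ) (y : V) :
    cn v M y = ∑ N : Fin (d + 1), cn x N y * cn v M (vn x N) := by
  conv_lhs => rw [← sum_cn x y]
  rw [map_sum, Finset.sum_range]
  simp

end LeonardBethe

open LeonardBethe LeonardBethe.Idx in
theorem theorem3p1 {V : Type*} [AddCommGroup V] [Module ℂ V] (p : Params) (hp : p.Admissible)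
    (A As : Module.End ℂ V) (hA : IsLeonardPair p A As) :
    (∃ (v w x : Module.Basis (Fin (p.d + 1)) ℂ V) (f0 g0 h0 : ℂ),
      NormalizedBases p A As v w x f0 g0 h0) ∧
    p.P di pt st * p.Pinv di pt st = 1 ∧
    ∀ (v w x : Module.Basis (Fin (p.d + 1)) ℂ V) (f0 g0 h0 : ℂ),
      NormalizedBases p A As v w x f0 g0 h0 →
      (f0 * h0⁻¹ * g0⁻¹ = (-1) ^ p.d * p.q ^ ((p.d : ℤ) * ((p.d : ℤ) - 1)) *
        ((poch p.q (p.q ^ 2 * p.r0 ^ 2 * p.b pt ^ 2) p.d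
            * poch p.q (p.q ^ 2 * p.r0 ^ 2 * p.b di ^ 2) p.d
            * poch p.q (p.q ^ 2 * p.r0 ^ 2 * p.b st ^ 2) p.d) /
          (poch p.q (-(p.q * p.r0 * p.b pt * p.b di / p.b st)) p.d
            * poch p.q (-(p.q * p.r0 * p.b pt * p.b st / p.b di)) p.d
            * poch p.q (-(p.q * p.r0 * p.b di * p.b st / p.b pt)) p.d))) ∧
      ∀ (M : Fin (p.d + 1)) (φ : Module.Dual ℂ V), φ ≠ 0 → φ ∘ₗ A = p.theta pt M • φ →
        φ (v M) ≠ 0 ∧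
        ∀ (n : ℕ) (u : Fin n → ℂ), (∀ i, u i ≠ 0) → ∀ (m : ℤ) (α χ : ℂ), χ ≠ 0 →
          ((p.q ^ 2 - (p.q ^ 2)⁻¹) * χ⁻¹ * α * p.b pt * p.q ^ (-m) = -1 →
            φ (p.psiMinus A As α χ n u m (v 0)) / φ (v M) =
              p.GMinus n u * (p.fSeq f0 M / f0) *
                ∑ M' : Fin (p.d + 1), p.Pinv di pt st M M' *
                  ∏ i, (p.U (u i) - p.r0 / (p.q + p.q⁻¹) * p.theta di M')) ∧
          ((p.q ^ 2 - (p.q ^ 2)⁻¹) * χ⁻¹ * α * p.c st * p.q ^ m = 1 →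
            φ (p.psiPlus A As α χ n u m (w 0)) / φ (v M) =
              p.GPlus n u * (p.fSeq f0 M / (g0 * p.nu0 st di pt)) *
                ∑ M' : Fin (p.d + 1), 1 / p.hSeq h0 M' * p.Pinv di pt st M M' *
                  ∏ i, (p.U (u i) - p.r0 / (p.q + p.q⁻¹) * p.theta di M')) := by
  refine ⟨hA.exists_normalizedBases hp, hp.P_mul_Pinv hA, fun v w x f0 g0 h0 h =>
    ⟨h.scalar_product hA hp, fun M φ hφ0 hφ => ?_⟩⟩
  have hb := h.bases hA hp
  have hsep : ∀ i j, i ≤ p.d → j ≤ p.d → i ≠ j →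
      th p.q p.r0 (p.B pt) i - th p.q p.r0 (p.B pt) j ≠ 0 := fun i j hi hj hij =>
    hp.gen.swap.th_sub_ne hij (by omega)
  rw [hp.theta_eq] at hφ
  have key := eigenform_apply hb.eigX hsep (Nat.lt_succ_iff.mp M.2) hφ
  rw [vn_fin] at key
  have hne : φ (v M) ≠ 0 := fun h0 => hφ0 (LinearMap.ext fun y => by
    rw [key, h0, mul_zero, LinearMap.zero_apply])
  refine ⟨hne, fun n u hu m α χ hχ => ⟨fun hm => ?_, fun hm => ?_⟩⟩
  -- The state is decomposed in the eigenbasis of A⋄, on which the string of operators acts by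
  -- scalars.
  · rw [key, mul_div_cancel_right₀ _ hne, cn_eq_sum_cn v x, Finset.mul_sum]
    refine Finset.sum_congr rfl fun N _ => ?_
    rw [hp.cn_psiMinus hb.eigZ hχ hm hu]
    have h1 := h.cn_mul_cn hA hp M N
    rw [show vn v 0 = v 0 from vn_fin v 0] at h1
    linear_combination (p.GMinus n u *
      ∏ i, (p.U (u i) - p.r0 / (p.q + p.q⁻¹) * p.theta di N)) * h1
  · rw [key, mul_div_cancel_right₀ _ hne, cn_eq_sum_cn v x, Finset.mul_sum]
    refine Finset.sum_congr rfl fun N _ => ?_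
    rw [hp.cn_psiPlus hb.eigZ hχ hm hu]
    have h1 := h.cn_w_mul_cn hA hp M N
    rw [show vn w 0 = w 0 from vn_fin w 0] at h1
    linear_combination (p.GPlus n u *
      ∏ i, (p.U (u i) - p.r0 / (p.q + p.q⁻¹) * p.theta di N)) * h1
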